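/- **Notation.** $A'$ is the transpose, $|A|$ the determinant and $\mathrm{etr}(A)=\exp(\mathrm{tr}\,A)$. For a diagonal $N=\mathrm{diag}(n_1,\dots,n_p)$ with all $n_i>0$, $N^{1/2}=\mathrm{diag}(\sqrt{n_1},\dots,\sqrt{n_p})$. * $Y\sim N_{r\times p}(m,P,\Sigma)$ means that the $r\times p$ random matrix $Y$ satisfies $\mathrm{vec}(Y)\sim N_{rp}(\mathrm{vec}(m),\Sigma\otimes P)$ (possibly degenerate). * $\Sigma\sim MIW_p(S,N,v)$ (modified inverted Wishart; $S$ positive definite, $N$ diagonal with positive diagonal entries) means that $\Sigma$ has, on the positive definite $p\times p$ matrices, the density $c\,|\Sigma|^{-\{v+\mathrm{tr}(N)/(2p)\}}\,\mathrm{etr}\left(-\tfrac12N^{1/2}SN^{1/2}\Sigma^{-1}\right)$, with $c$ the normalizing constant. * $(Y,\Sigma)\sim NMIW_{r\times p,p}(m,P,S,N,v)$ means $\Sigma\sim MIW_p(S,N,v)$ and $Y\mid\Sigma\sim N_{r\times p}(m,P,\Sigma)$. * $Y\sim MT_{r\times p}(f,Q,S,N,v)$ (modified matrix $t$; $Q$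 positive definite) means that the $r\times p$ random matrix $Y$ has the density $c\,\left|N^{1/2}SN^{1/2}+(Y-f)'Q^{-1}(Y-f)\right|^{-\{2v+\mathrm{tr}(N)/p+r-p-1\}/2}$, with $c$ the normalizing constant. **Model.** For $t=1,\dots,T$ let $$y_t'=F_t'\Theta_t+\epsilon_t',\qquad \Theta_t=G_t\Theta_{t-1}+\omega_t,$$ where $y_t$ is $p\times r$, $\Theta_t$ is $d\times p$, and $F_t$ ($d\times r$), $G_t$ ($d\times d$) and the positive semidefinite $V_t$ ($r\times r$), $W_t$ ($d\times d$) are known. Let $\Sigma\sim MIW_p(S_0,N_0,p)$ and, conditionally on $\Sigma$, let $\Theta_0,\epsilon_1',\dots,\epsilon_T',\omega_1,\dots,\omega_T$ be independent with $$\Theta_0\mid\Sigma\sim N_{d\times p}(m_0,P_0,\Sigma),\quad \epsilon_t'\mid\Sigma\sim N_{r\times p}(0,V_t,\Sigma),\quad \omega_t\mid\Sigma\sim N_{d\times p}(0,W_t,\Sigma),$$ where $m_0$, $P_0$ (positive semidefinite), $S_0$ (positive definite) and $N_0$ (diagonal with positive diagonal entries) are known. Write $y^t=(y_1,\dots,y_t)$.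 Starting from $m_0,P_0,S_0,N_0$ define for $t=1,\dots,T$ $$a_t=G_tm_{t-1},\quad R_t=G_tP_{t-1}G_t'+W_t,\quad f_t'=F_t'a_t,\quad Q_t=F_t'R_tF_t+V_t,$$ $$A_t=R_tF_tQ_t^{-1},\quad e_t=y_t-f_t,\quad m_t=a_t+A_te_t',\quad P_t=R_t-A_tQ_tA_t',$$ $$N_t=N_{t-1}+rI_p,\qquad N_t^{1/2}S_tN_t^{1/2}=N_{t-1}^{1/2}S_{t-1}N_{t-1}^{1/2}+e_tQ_t^{-1}e_t',$$ and assume that every $Q_t$ is nonsingular (which is automatic when $V_t$ is positive definite). **Proposition.** For every $t=1,\dots,T$ (conditional distributions holding for almost every value of the conditioning variables): (a) Posterior at $t-1$: $\Theta_{t-1},\Sigma\mid y^{t-1}\sim NMIW_{d\times p,p}(m_{t-1},P_{t-1},S_{t-1},N_{t-1},p)$. (b) Prior at $t$: $\Theta_t,\Sigma\mid y^{t-1}\sim NMIW_{d\times p,p}(a_t,R_t,S_{t-1},N_{t-1},p)$. (c) One-step forecast at $t$: $y_t'\mid\Sigma,y^{t-1}\sim N_{r\times p}(f_t',Q_t,\Sigma)$,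 with marginal $y_t'\mid y^{t-1}\sim MT_{r\times p}(f_t',Q_t,S_{t-1},N_{t-1},p)$. (d) Posterior at $t$: $\Theta_t,\Sigma\mid y^t\sim NMIW_{d\times p,p}(m_t,P_t,S_t,N_t,p)$. Moreover $R_t$ and $P_t$ are positive semidefinite, $Q_t$ and $S_t$ are positive definite, and $N_t$ is diagonal with positive diagonal entries. -/

import Mathlib

open MeasureTheory ProbabilityTheory Matrix
open scoped Kronecker

noncomputable section

/-! ### Borel structure on real matrices -/

instance matrixMeasurableSpace {a b : ℕ} : MeasurableSpace (Matrix (Fin a) (Fin b) ℝ) :=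
  inferInstanceAs (MeasurableSpace (Fin a → Fin b → ℝ))

instance matrixBorelSpace {a b : ℕ} : BorelSpace (Matrix (Fin a) (Fin b) ℝ) :=
  inferInstanceAs (BorelSpace (Fin a → Fin b → ℝ))

instance matrixStandardBorelSpace {a b : ℕ} :
    StandardBorelSpace (Matrix (Fin a) (Fin b) ℝ) :=
  inferInstanceAs (StandardBorelSpace (Fin a → Fin b → ℝ))

/-! ### Conditional laws -/

/-- The conditional law of `X` given `Y = b` under `μ` is `κ b`, for almost every value `b`
of `Y`. -/
def HasCondLaw {Ω α β : Type*} [MeasurableSpace Ω] [MeasurableSpace α] [StandardBorelSpace α]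
    [Nonempty α] [MeasurableSpace β] (X : Ω → α) (Y : Ω → β) (κ : β → Measure α)
    (μ : Measure Ω) [IsFiniteMeasure μ] : Prop :=
  ∀ᵐ b ∂(μ.map Y), condDistrib X Y μ b = κ b

/-- The probability measure proportional to `μ` (when `0 < μ univ < ∞`). -/
def normalized {α : Type*} [MeasurableSpace α] (μ : Measure α) : Measure α :=
  (μ Set.univ)⁻¹ • μ

/-! ### The matrix distributions -/

/-- The square root `N^{1/2}` of a diagonal matrix `N` with nonnegative diagonal entries. -/
def sqrtDiag {p : ℕ} (N : Matrix (Fin p) (Fin p) ℝ) : Matrix (Fin p) (Fin p) ℝ :=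
  Matrix.diagonal fun i => √(N i i)

/-- The matrix-variate normal distribution `N_{r×p}(m, P, Sg)`: the law of an `r × p` random
matrix `Y` such that `vec Y` (the stacked columns of `Y`) is multivariate normal with mean `vec m`
and covariance matrix `Sg ⊗ P`. The matrices `P` and `Sg` may be singular. -/
def matrixNormal {r p : ℕ} (m : Matrix (Fin r) (Fin p) ℝ) (P : Matrix (Fin r) (Fin r) ℝ)
    (Sg : Matrix (Fin p) (Fin p) ℝ) : Measure (Matrix (Fin r) (Fin p) ℝ) :=
  (multivariateGaussian (WithLp.toLp 2 (Matrix.vec m)) (Sg ⊗ₖ P)).map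
    fun x => Matrix.of fun i j => x (j, i)

/-- Lebesgue measure on the symmetric `p × p` matrices, in the coordinates given by the entries
on and above the diagonal, as a measure on all `p × p` matrices. -/
def symLebesgue (p : ℕ) : Measure (Matrix (Fin p) (Fin p) ℝ) :=
  (volume : Measure ({ij : Fin p × Fin p // ij.1 ≤ ij.2} → ℝ)).map
    fun x => Matrix.of fun i j => x ⟨(min i j, max i j), min_le_max⟩

/-- The modified inverted Wishart distribution `MIW_p(S, N, v)`: the distribution on the positive
definite `p × p` matrices `Sg` whose density with respect to Lebesgue measure is
`c |Sg|^{-(v + tr N / (2p))} etr(-½ N^{1/2} S N^{1/2} Sg⁻¹)`, where `c` is the normalizing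
constant. -/
def MIW {p : ℕ} (S N : Matrix (Fin p) (Fin p) ℝ) (v : ℝ) : Measure (Matrix (Fin p) (Fin p) ℝ) :=
  normalized (((symLebesgue p).restrict {Sg | Sg.PosDef}).withDensity fun Sg =>
    ENNReal.ofReal (Sg.det ^ (-(v + N.trace / (2 * p))) *
      Real.exp (-(1 / 2) * (sqrtDiag N * S * sqrtDiag N * Sg⁻¹).trace)))

/-- The joint normal modified inverted Wishart distribution `NMIW_{r×p,p}(m, P, S, N, v)`: the
law of a pair `(Y, Sg)` with `Sg ∼ MIW_p(S, N, v)` and `Y | Sg ∼ N_{r×p}(m, P, Sg)`. -/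
def NMIW {r p : ℕ} (m : Matrix (Fin r) (Fin p) ℝ) (P : Matrix (Fin r) (Fin r) ℝ)
    (S N : Matrix (Fin p) (Fin p) ℝ) (v : ℝ) :
    Measure (Matrix (Fin r) (Fin p) ℝ × Matrix (Fin p) (Fin p) ℝ) :=
  (MIW S N v).bind fun Sg => (matrixNormal m P Sg).map fun Y => (Y, Sg)

/-- The modified matrix `t` distribution `MT_{r×p}(f, Q, S, N, v)`: the distribution on the
`r × p` matrices `Y` whose density with respect to Lebesgue measure is
`c |N^{1/2} S N^{1/2} + (Y - f)' Q⁻¹ (Y - f)|^{-(2v + tr N / p + r - p - 1)/2}`, where `c` is the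
normalizing constant. -/
def MT {r p : ℕ} (f : Matrix (Fin r) (Fin p) ℝ) (Q : Matrix (Fin r) (Fin r) ℝ)
    (S N : Matrix (Fin p) (Fin p) ℝ) (v : ℝ) : Measure (Matrix (Fin r) (Fin p) ℝ) :=
  normalized (((volume : Measure (Fin r → Fin p → ℝ)).map
      fun x => (Matrix.of x : Matrix (Fin r) (Fin p) ℝ)).withDensity fun Y =>
    ENNReal.ofReal ((sqrtDiag N * S * sqrtDiag N + (Y - f)ᵀ * Q⁻¹ * (Y - f)).det ^
      (-(2 * v + N.trace / p + r - p - 1) / 2)))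

/-! ### The model -/

/-- The known quantities of a matrix-variate dynamic linear model: the design matrices `F t`, the
evolution matrices `G t`, the covariance matrices `V t`, `W t` (all used for `t ≥ 1`) and the
parameters of the prior at time `0`. -/
structure MVDLM (d p r : ℕ) where
  F : ℕ → Matrix (Fin d) (Fin r) ℝ
  G : ℕ → Matrix (Fin d) (Fin d) ℝ
  V : ℕ → Matrix (Fin r) (Fin r) ℝ
  W : ℕ → Matrix (Fin d) (Fin d) ℝ
  m₀ : Matrix (Fin d) (Fin p) ℝ
  P₀ : Matrix (Fin d) (Fin d) ℝ
  S₀ : Matrix (Fin p) (Fin p) ℝ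
  N₀ : Matrix (Fin p) (Fin p) ℝ

/-- The information `y^t = (y_1, …, y_t)`. -/
def history {Ω : Type*} {p r : ℕ} (y : ℕ → Ω → Matrix (Fin p) (Fin r) ℝ) (t : ℕ) (w : Ω) :
    Fin t → Matrix (Fin p) (Fin r) ℝ :=
  fun i => y ((i : ℕ) + 1) w

namespace MVDLM

variable {d p r : ℕ} (M : MVDLM d p r)

/-- The known matrices of the model are covariance matrices (up to the time horizon `T`), with
`S₀` nonsingular, and `N₀` is diagonal with positive diagonal entries. -/
structure IsAdmissible (T : ℕ) : Prop where
  V_psd : ∀ t < T, (M.V (t + 1)).PosSemidef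
  W_psd : ∀ t < T, (M.W (t + 1)).PosSemidef
  P₀_psd : M.P₀.PosSemidef
  S₀_pd : M.S₀.PosDef
  N₀_diag : M.N₀.IsDiag
  N₀_pos : ∀ i, 0 < M.N₀ i i

/-- The random matrices `Sg`, `Θ t`, `y t`, `ε t`, `ω t` on the probability space `(Ω, μ)` follow
the model `M` for the times `1, …, T`:
`y_t' = F_t' Θ_t + ε_t'`, `Θ_t = G_t Θ_{t-1} + ω_t`, `Sg ∼ MIW_p(S₀, N₀, p)` and, conditionally on
`Sg`, the random matrices `Θ_0, ε_1', …, ε_T', ω_1, …, ω_T` are independent with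
`Θ_0 ∼ N_{d×p}(m₀, P₀, Sg)`, `ε_t' ∼ N_{r×p}(0, V_t, Sg)` and `ω_t ∼ N_{d×p}(0, W_t, Sg)`. -/
structure Follows {Ω : Type*} [MeasurableSpace Ω] (μ : Measure Ω) [IsProbabilityMeasure μ]
    (T : ℕ) (Sg : Ω → Matrix (Fin p) (Fin p) ℝ) (Θ : ℕ → Ω → Matrix (Fin d) (Fin p) ℝ)
    (y ε : ℕ → Ω → Matrix (Fin p) (Fin r) ℝ) (ω : ℕ → Ω → Matrix (Fin d) (Fin p) ℝ) :
    Prop where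
  measurable_Sg : Measurable Sg
  measurable_Θ₀ : Measurable (Θ 0)
  measurable_ε : ∀ t < T, Measurable (ε (t + 1))
  measurable_ω : ∀ t < T, Measurable (ω (t + 1))
  observation : ∀ t < T, ∀ w, (y (t + 1) w)ᵀ = (M.F (t + 1))ᵀ * Θ (t + 1) w + (ε (t + 1) w)ᵀ
  evolution : ∀ t < T, ∀ w, Θ (t + 1) w = M.G (t + 1) * Θ t w + ω (t + 1) w
  law_Sg : μ.map Sg = MIW M.S₀ M.N₀ p
  law_innovations :
    HasCondLaw
      (fun w => (Θ 0 w, (fun i : Fin T => (ε ((i : ℕ) + 1) w)ᵀ), (fun i : Fin T => ω ((i : ℕ) + 1) w))) Sg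
      (fun s => (matrixNormal M.m₀ M.P₀ s).prod
        ((Measure.pi fun i : Fin T => matrixNormal (0 : Matrix (Fin r) (Fin p) ℝ)
            (M.V ((i : ℕ) + 1)) s).prod
          (Measure.pi fun i : Fin T => matrixNormal (0 : Matrix (Fin d) (Fin p) ℝ)
            (M.W ((i : ℕ) + 1)) s))) μ

/-! ### The recursions

The quantities `m_t`, `P_t`, `S_t`, `N_t` are `M.m t`, `M.P t`, `M.S t`, `M.N t`; the quantities
`a_{t+1}`, `R_{t+1}`, `f_{t+1}`, `Q_{t+1}`, `A_{t+1}`, which are known at time `t`, are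
`M.aNext t`, `M.RNext t`, `M.fNext t`, `M.QNext t`, `M.ANext t`. Those which depend on the data
are functions of `h = (y_1, …, y_t)`. -/

/-- `P_t`. -/
def P : ℕ → Matrix (Fin d) (Fin d) ℝ
  | 0 => M.P₀
  | t + 1 =>
    let R := M.G (t + 1) * P t * (M.G (t + 1))ᵀ + M.W (t + 1)
    let Q := (M.F (t + 1))ᵀ * R * M.F (t + 1) + M.V (t + 1)
    let A := R * M.F (t + 1) * Q⁻¹
    R - A * Q * Aᵀ

/-- `R_{t+1} = G_{t+1} P_t G_{t+1}' + W_{t+1}`. -/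
def RNext (t : ℕ) : Matrix (Fin d) (Fin d) ℝ :=
  M.G (t + 1) * M.P t * (M.G (t + 1))ᵀ + M.W (t + 1)

/-- `Q_{t+1} = F_{t+1}' R_{t+1} F_{t+1} + V_{t+1}`. -/
def QNext (t : ℕ) : Matrix (Fin r) (Fin r) ℝ :=
  (M.F (t + 1))ᵀ * M.RNext t * M.F (t + 1) + M.V (t + 1)

/-- `A_{t+1} = R_{t+1} F_{t+1} Q_{t+1}⁻¹`. -/
def ANext (t : ℕ) : Matrix (Fin d) (Fin r) ℝ :=
  M.RNext t * M.F (t + 1) * (M.QNext t)⁻¹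

/-- `m_t`. -/
def m : (t : ℕ) → (Fin t → Matrix (Fin p) (Fin r) ℝ) → Matrix (Fin d) (Fin p) ℝ
  | 0, _ => M.m₀
  | t + 1, h =>
    let a := M.G (t + 1) * m t (fun i => h i.castSucc)
    let f := ((M.F (t + 1))ᵀ * a)ᵀ
    let e := h (Fin.last t) - f
    a + M.ANext t * eᵀ

/-- `a_{t+1} = G_{t+1} m_t`. -/
def aNext (t : ℕ) (h : Fin t → Matrix (Fin p) (Fin r) ℝ) : Matrix (Fin d) (Fin p) ℝ :=
  M.G (t + 1) * M.m t h

/-- `f_{t+1}`, with `f_{t+1}' = F_{t+1}' a_{t+1}`. -/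
def fNext (t : ℕ) (h : Fin t → Matrix (Fin p) (Fin r) ℝ) : Matrix (Fin p) (Fin r) ℝ :=
  ((M.F (t + 1))ᵀ * M.aNext t h)ᵀ

/-- `N_t`. -/
def N : ℕ → Matrix (Fin p) (Fin p) ℝ
  | 0 => M.N₀
  | t + 1 => N t + (r : ℝ) • (1 : Matrix (Fin p) (Fin p) ℝ)

/-- `S_t`, the solution of
`N_t^{1/2} S_t N_t^{1/2} = N_{t-1}^{1/2} S_{t-1} N_{t-1}^{1/2} + e_t Q_t⁻¹ e_t'`. -/
def S : (t : ℕ) → (Fin t → Matrix (Fin p) (Fin r) ℝ) → Matrix (Fin p) (Fin p) ℝ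
  | 0, _ => M.S₀
  | t + 1, h =>
    let h' : Fin t → Matrix (Fin p) (Fin r) ℝ := fun i => h i.castSucc
    let e := h (Fin.last t) - M.fNext t h'
    (sqrtDiag (M.N (t + 1)))⁻¹ *
      (sqrtDiag (M.N t) * S t h' * sqrtDiag (M.N t) + e * (M.QNext t)⁻¹ * eᵀ) *
      (sqrtDiag (M.N (t + 1)))⁻¹

end MVDLM

end

/-! Fix a value `s` of the random covariance. Given `s`, all innovations are independent matrix
normal variables with the same column covariance `s`, and every state and observation is an affine
function of them. The invariant, proved by induction in `map_hist_resid`, is that the residual `Θ_t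
- m_t` is independent of `y_1, …, y_t` with law `N(0, P_t, s)`. The noise of time `t + 1` is
independent of the past (`map_hist_resid_innovations`), so `u = Θ_{t+1} - a_{t+1}` has row
covariance `R` and `e = F'u + ε'` has row covariance `Q`. The gain `A` is the matrix for which `u -
A e` is uncorrelated with `e`; both being linear in the same Gaussian pair, they are independent,
and the residual covariance is `R - A Q A'`. Since `s` enters every covariance only as a common
Kronecker factor, the gains and means are the same for all `s`.

For the law of `s` given the data, each forecast error contributes to the likelihood the factor
`|s|^{-r/2} etr(-½ e' Q⁻¹ e s⁻¹)`, with `e` of shape `r × p`. This has the form of the inverted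
Wishart density (`wishartKernel_mul_matrixNormalKernel`): the exponent grows by `r/2`, which is
adding `r I` to `N`, and the scale matrix grows by `e' Q⁻¹ e`, which is the recursion for `S`.
Bayes' formula gives the posterior `MIW` law (`exists_kernel_MIW_posterior`). Independence of
residual and data given `s` then makes the joint posterior "draw `s` from `MIW`, then a normal
residual" (`hasCondLaw_NMIW`), applied to `Θ_t - m_t`, `Θ_{t+1} - a_{t+1}` and `y_{t+1}' -
f_{t+1}'`.

The marginal forecast comes from integrating `s` out (`NMIW_map_fst`): the substitution `s = B u
B'`, with Jacobian `|B|^{p+1}`, shows that the integral of `|s|^{-a} etr(-½ C s⁻¹)` is a constant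
times `|C|^{(p+1)/2 - a}`. Normalizing constants are never evaluated; they are forced by total mass
one. State covariances may be singular, so states are handled by characteristic functions, and
densities are used only for the forecast errors. -/

noncomputable section

open scoped MatrixOrder

/-! ### Measurability of matrix operations and of the positive definite cone. -/

section MatrixMeasurability

theorem measurable_matrix_iff {α : Type*} [MeasurableSpace α] {a b : ℕ}
    {f : α → Matrix (Fin a) (Fin b) ℝ} :
    Measurable f ↔ ∀ i j, Measurable fun x => f x i j := by
  constructor
  · intro hf i j
    exact (measurable_pi_apply j).comp ((measurable_pi_apply i).comp hf)
  · intro hf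
    exact measurable_pi_lambda _ fun i => measurable_pi_lambda _ fun j => hf i j

theorem Measurable.matrix_elem {α : Type*} [MeasurableSpace α] {a b : ℕ}
    {f : α → Matrix (Fin a) (Fin b) ℝ} (hf : Measurable f) (i j) :
    Measurable fun x => f x i j :=
  measurable_matrix_iff.1 hf i j

@[fun_prop]
theorem Measurable.matrix_mul {α : Type*} [MeasurableSpace α] {a b c : ℕ}
    {f : α → Matrix (Fin a) (Fin b) ℝ} {g : α → Matrix (Fin b) (Fin c) ℝ}
    (hf : Measurable f) (hg : Measurable g) : Measurable fun x => f x * g x := by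
  refine measurable_matrix_iff.2 fun i j => ?_
  simp only [Matrix.mul_apply]
  exact Finset.measurable_sum _ fun k _ => (hf.matrix_elem i k).mul (hg.matrix_elem k j)

@[fun_prop]
theorem Measurable.matrix_add {α : Type*} [MeasurableSpace α] {a b : ℕ}
    {f g : α → Matrix (Fin a) (Fin b) ℝ}
    (hf : Measurable f) (hg : Measurable g) : Measurable fun x => f x + g x :=
  measurable_matrix_iff.2 fun i j => (hf.matrix_elem i j).add (hg.matrix_elem i j)

@[fun_prop]
theorem Measurable.matrix_sub {α : Type*} [MeasurableSpace α] {a b : ℕ}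
    {f g : α → Matrix (Fin a) (Fin b) ℝ}
    (hf : Measurable f) (hg : Measurable g) : Measurable fun x => f x - g x :=
  measurable_matrix_iff.2 fun i j => (hf.matrix_elem i j).sub (hg.matrix_elem i j)

@[fun_prop]
theorem Measurable.matrix_transpose {α : Type*} [MeasurableSpace α] {a b : ℕ}
    {f : α → Matrix (Fin a) (Fin b) ℝ}
    (hf : Measurable f) : Measurable fun x => (f x)ᵀ :=
  measurable_matrix_iff.2 fun i j => hf.matrix_elem j i

@[fun_prop]
theorem Measurable.matrix_trace {α : Type*} [MeasurableSpace α] {a : ℕ}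
    {f : α → Matrix (Fin a) (Fin a) ℝ}
    (hf : Measurable f) : Measurable fun x => (f x).trace :=
  Finset.measurable_sum _ fun i _ => hf.matrix_elem i i

@[fun_prop]
theorem Measurable.matrix_det {α : Type*} [MeasurableSpace α] {a : ℕ}
    {f : α → Matrix (Fin a) (Fin a) ℝ}
    (hf : Measurable f) : Measurable fun x => (f x).det := by
  simp only [Matrix.det_apply]
  refine Finset.measurable_sum _ fun σ _ => Measurable.const_smul ?_ _
  exact Finset.measurable_prod _ fun i _ => hf.matrix_elem _ _

-- The total inverse is discontinuous at singular matrices, but it is the inverse determinant times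
-- the adjugate, each measurable in the entries.
@[fun_prop]
theorem Measurable.matrix_inv {α : Type*} [MeasurableSpace α] {a : ℕ}
    {f : α → Matrix (Fin a) (Fin a) ℝ}
    (hf : Measurable f) : Measurable fun x => (f x)⁻¹ := by
  refine measurable_matrix_iff.2 fun i j => ?_
  simp only [Matrix.inv_def, Matrix.smul_apply, Ring.inverse_eq_inv', Matrix.adjugate_apply]
  refine (Measurable.inv hf.matrix_det).smul (Measurable.matrix_det ?_)
  refine measurable_matrix_iff.2 fun k l => ?_
  by_cases hk : k = j
  · subst hk; simp
  · simpa [Matrix.updateRow_ne hk] using hf.matrix_elem k l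

/-- Positive definite means positive semidefinite with nonzero determinant. The semidefinite
condition is an uncountable intersection, measurable because it is closed. -/
theorem measurableSet_posDef (p : ℕ) : MeasurableSet {s : Matrix (Fin p) (Fin p) ℝ | s.PosDef} := by
  have h : {s : Matrix (Fin p) (Fin p) ℝ | s.PosDef} =
      ({s | s.IsHermitian} ∩ ⋂ x : Fin p → ℝ, {s | 0 ≤ star x ⬝ᵥ (s *ᵥ x)}) ∩ {s | s.det ≠ 0} := by
    ext s
    simp only [Set.mem_ofPred_eq, Set.mem_inter_iff, Set.mem_iInter]
    constructor
    · intro h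
      exact ⟨⟨h.1, fun x => h.posSemidef.dotProduct_mulVec_nonneg x⟩, h.det_pos.ne'⟩
    · rintro ⟨⟨h1, h2⟩, h3⟩
      exact (PosSemidef.of_dotProduct_mulVec_nonneg h1 h2).posDef_iff_det_ne_zero.2 h3
  rw [h]
  refine MeasurableSet.inter (IsClosed.measurableSet (IsClosed.inter ?_ ?_)) ?_
  · exact isClosed_eq (by fun_prop) continuous_id
  · exact isClosed_iInter fun x => isClosed_le continuous_const (by fun_prop)
  · exact (measurableSet_eq_fun (Measurable.matrix_det measurable_id) measurable_const).compl

end MatrixMeasurability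

/-! ### Matrix laws are determined by their characteristic functions. -/

section CharacteristicFunction

/-- Every linear functional on pairs of matrices is a trace pairing with its values `T`, `U` on
matrix units, so the hypothesis is equality of the whole characteristic function. -/
theorem ext_of_integral_exp_trace_pi {a b c e : ℕ}
    {μ ν : Measure ((Fin a → Fin b → ℝ) × (Fin c → Fin e → ℝ))}
    [IsFiniteMeasure μ] [IsFiniteMeasure ν]
    (h : ∀ (T : Matrix (Fin a) (Fin b) ℝ) (U : Matrix (Fin c) (Fin e) ℝ),
      ∫ x, Complex.exp ((((Tᵀ * Matrix.of x.1).trace + (Uᵀ * Matrix.of x.2).trace : ℝ) : ℂ) *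
        Complex.I) ∂μ =
      ∫ x, Complex.exp ((((Tᵀ * Matrix.of x.1).trace + (Uᵀ * Matrix.of x.2).trace : ℝ) : ℂ) *
        Complex.I) ∂ν) :
    μ = ν := by
  refine Measure.ext_of_charFunDual ?_
  funext L
  rw [charFunDual_apply, charFunDual_apply]
  let T : Matrix (Fin a) (Fin b) ℝ := Matrix.of fun i j => L (Pi.single i (Pi.single j 1), 0)
  let U : Matrix (Fin c) (Fin e) ℝ := Matrix.of fun i j => L (0, Pi.single i (Pi.single j 1))
  have key : ∀ x : (Fin a → Fin b → ℝ) × (Fin c → Fin e → ℝ),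
      L x = ((Tᵀ * (Matrix.of x.1)).trace + (Uᵀ * (Matrix.of x.2)).trace : ℝ) := by
    rintro ⟨x, y⟩
    have hx : x = ∑ i, ∑ j, x i j • (Pi.single i (Pi.single j 1) : Fin a → Fin b → ℝ) := by
      ext i j
      simp [Finset.sum_apply, Pi.single_apply, apply_ite, ite_apply]
    have hy : y = ∑ i, ∑ j, y i j • (Pi.single i (Pi.single j 1) : Fin c → Fin e → ℝ) := by
      ext i j
      simp [Finset.sum_apply, Pi.single_apply, apply_ite, ite_apply]
    have h1 : L (x, 0) = ((T)ᵀ * (Matrix.of x)).trace := by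
      calc L (x, 0) = (L.comp (ContinuousLinearMap.inl ℝ _ _))
            (∑ i, ∑ j, x i j • Pi.single i (Pi.single j 1)) := by rw [← hx]; rfl
        _ = ∑ i, ∑ j, x i j * T i j := by
          simp only [map_sum, map_smul, smul_eq_mul]; rfl
        _ = _ := by
          simp only [Matrix.trace, Matrix.diag, Matrix.mul_apply, Matrix.transpose_apply,
            Matrix.of_apply]
          rw [Finset.sum_comm]
          simp only [mul_comm]
    have h2 : L (0, y) = ((U)ᵀ * (Matrix.of y)).trace := by
      calc L (0, y) = (L.comp (ContinuousLinearMap.inr ℝ _ _))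
            (∑ i, ∑ j, y i j • Pi.single i (Pi.single j 1)) := by rw [← hy]; rfl
        _ = ∑ i, ∑ j, y i j * U i j := by
          simp only [map_sum, map_smul, smul_eq_mul]; rfl
        _ = _ := by
          simp only [Matrix.trace, Matrix.diag, Matrix.mul_apply, Matrix.transpose_apply,
            Matrix.of_apply]
          rw [Finset.sum_comm]
          simp only [mul_comm]
    rw [← h1, ← h2, ← map_add]
    simp
  simp_rw [key]
  exact h T U

/-- Finite measures on pairs of matrices with the same characteristic function are equal. -/
theorem ext_of_integral_exp_trace_prod {a b c e : ℕ}
    {μ ν : Measure (Matrix (Fin a) (Fin b) ℝ × Matrix (Fin c) (Fin e) ℝ)}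
    [hμ : IsFiniteMeasure μ] [hν : IsFiniteMeasure ν]
    (h : ∀ (T : Matrix (Fin a) (Fin b) ℝ) (U : Matrix (Fin c) (Fin e) ℝ),
      ∫ x, Complex.exp ((((Tᵀ * x.1).trace + (Uᵀ * x.2).trace : ℝ) : ℂ) * Complex.I) ∂μ =
      ∫ x, Complex.exp ((((Tᵀ * x.1).trace + (Uᵀ * x.2).trace : ℝ) : ℂ) * Complex.I) ∂ν) :
    μ = ν :=
  @ext_of_integral_exp_trace_pi a b c e μ ν hμ hν h

/-- Finite measures on matrices with the same characteristic function are equal. -/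
theorem ext_of_integral_exp_trace {a b : ℕ} {μ ν : Measure (Matrix (Fin a) (Fin b) ℝ)}
    [IsFiniteMeasure μ] [IsFiniteMeasure ν]
    (h : ∀ T : Matrix (Fin a) (Fin b) ℝ,
      ∫ x, Complex.exp ((((Tᵀ * x).trace : ℝ) : ℂ) * Complex.I) ∂μ =
      ∫ x, Complex.exp ((((Tᵀ * x).trace : ℝ) : ℂ) * Complex.I) ∂ν) :
    μ = ν := by
  -- Pairing with the unique `0 × 0` matrix reduces to the statement for pairs.
  have hm : Measurable fun x : Matrix (Fin a) (Fin b) ℝ => (x, (0 : Matrix (Fin 0) (Fin 0) ℝ)) :=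
    measurable_prodMk_right
  have : μ.map (fun x => (x, (0 : Matrix (Fin 0) (Fin 0) ℝ))) = ν.map (fun x => (x, 0)) := by
    refine ext_of_integral_exp_trace_prod fun T U => ?_
    rw [integral_map hm.aemeasurable (Measurable.aestronglyMeasurable (by fun_prop)),
      integral_map hm.aemeasurable (Measurable.aestronglyMeasurable (by fun_prop))]
    simpa using h T
  have h2 := congrArg (Measure.map Prod.fst) this
  rwa [Measure.map_map measurable_fst hm, Measure.map_map measurable_fst hm,
    show (Prod.fst ∘ fun x : Matrix (Fin a) (Fin b) ℝ => (x, (0 : Matrix (Fin 0) (Fin 0) ℝ))) = id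
      from rfl, Measure.map_id, Measure.map_id] at h2

end CharacteristicFunction

/-! ### Matrix normal laws, possibly singular, and their linear images. -/

section MatrixNormal

theorem measurable_unvec (r p : ℕ) : Measurable fun x : EuclideanSpace ℝ (Fin p × Fin r) =>
    (Matrix.of fun i j => x (j, i) : Matrix (Fin r) (Fin p) ℝ) :=
  measurable_matrix_iff.2 fun i j => by simp only [Matrix.of_apply]; fun_prop

instance isProbabilityMeasure_matrixNormal {r p : ℕ} (m : Matrix (Fin r) (Fin p) ℝ)
    (P : Matrix (Fin r) (Fin r) ℝ) (s : Matrix (Fin p) (Fin p) ℝ) :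
    IsProbabilityMeasure (matrixNormal m P s) :=
  Measure.isProbabilityMeasure_map (measurable_unvec r p).aemeasurable

/-- The quadratic form of `s ⊗ P` at `vec T` is `tr(T' P T s)`. The image laws below are identified
through this formula, which needs no density and so covers singular `P` and `s`. -/
theorem integral_exp_trace_matrixNormal {r p : ℕ} (m : Matrix (Fin r) (Fin p) ℝ)
    {P : Matrix (Fin r) (Fin r) ℝ} (hP : P.PosSemidef)
    {s : Matrix (Fin p) (Fin p) ℝ} (hs : s.PosSemidef) (T : Matrix (Fin r) (Fin p) ℝ) :
    ∫ x, Complex.exp ((((Tᵀ * x).trace : ℝ) : ℂ) * Complex.I) ∂(matrixNormal m P s) =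
      Complex.exp ((((Tᵀ * m).trace : ℝ) : ℂ) * Complex.I -
        (((Tᵀ * P * T * s).trace : ℝ) : ℂ) / 2) := by
  have h := charFun_multivariateGaussian (μ := WithLp.toLp 2 (Matrix.vec m)) (hs.kronecker hP)
    (WithLp.toLp 2 (Matrix.vec T))
  rw [matrixNormal, integral_map (measurable_unvec r p).aemeasurable
    (Measurable.aestronglyMeasurable (by fun_prop))]
  rw [charFun_apply] at h
  have hsT : sᵀ = s := by simpa [Matrix.IsHermitian] using hs.1
  have e1 : ∀ x : EuclideanSpace ℝ (Fin p × Fin r),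
      inner ℝ x (WithLp.toLp 2 (Matrix.vec T)) = (Tᵀ * (Matrix.of fun i j => x (j, i))).trace := by
    intro x
    rw [← vec_dotProduct_vec]
    simp [PiLp.inner_apply, dotProduct, Matrix.vec]
  have e2 : inner ℝ (WithLp.toLp 2 (Matrix.vec T)) (WithLp.toLp 2 (Matrix.vec m)) =
      (Tᵀ * m).trace := by
    rw [← vec_dotProduct_vec]
    simp [PiLp.inner_apply, dotProduct, mul_comm]
  have e3 : Matrix.vec T ⬝ᵥ (s ⊗ₖ P) *ᵥ Matrix.vec T = (Tᵀ * P * T * s).trace := by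
    rw [kronecker_mulVec_vec, vec_dotProduct_vec, hsT]
    simp only [Matrix.mul_assoc]
  simp only [e1, e2, e3] at h
  exact h

theorem integral_exp_trace_matrixNormal_prod {a b p : ℕ}
    {P : Matrix (Fin a) (Fin a) ℝ} (hP : P.PosSemidef)
    {W : Matrix (Fin b) (Fin b) ℝ} (hW : W.PosSemidef)
    {s : Matrix (Fin p) (Fin p) ℝ} (hs : s.PosSemidef)
    (T : Matrix (Fin a) (Fin p) ℝ) (U : Matrix (Fin b) (Fin p) ℝ) :
    ∫ x, Complex.exp ((((Tᵀ * x.1).trace + (Uᵀ * x.2).trace : ℝ) : ℂ) * Complex.I)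
        ∂((matrixNormal 0 P s).prod (matrixNormal 0 W s)) =
      Complex.exp (-(((Tᵀ * P * T * s).trace + (Uᵀ * W * U * s).trace : ℝ) : ℂ) / 2) := by
  simp only [Complex.ofReal_add, add_mul, Complex.exp_add]
  rw [integral_prod_mul (fun x : Matrix (Fin a) (Fin p) ℝ =>
      Complex.exp ((((Tᵀ * x).trace : ℝ) : ℂ) * Complex.I))
    (fun x : Matrix (Fin b) (Fin p) ℝ => Complex.exp ((((Uᵀ * x).trace : ℝ) : ℂ) * Complex.I)),
    integral_exp_trace_matrixNormal 0 hP hs, integral_exp_trace_matrixNormal 0 hW hs,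
    ← Complex.exp_add]
  simp only [Matrix.mul_zero, Matrix.trace_zero, Complex.ofReal_zero, zero_mul, zero_sub]
  congr 1
  ring

theorem matrixNormal_map_const_add {r p : ℕ} (m : Matrix (Fin r) (Fin p) ℝ)
    {P : Matrix (Fin r) (Fin r) ℝ} (hP : P.PosSemidef)
    {s : Matrix (Fin p) (Fin p) ℝ} (hs : s.PosSemidef) :
    (matrixNormal 0 P s).map (fun Z => m + Z) = matrixNormal m P s := by
  have hm : Measurable fun Z : Matrix (Fin r) (Fin p) ℝ => m + Z := by fun_prop
  have := Measure.isProbabilityMeasure_map (μ := matrixNormal 0 P s) hm.aemeasurable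
  refine ext_of_integral_exp_trace fun T => ?_
  rw [integral_map hm.aemeasurable (Measurable.aestronglyMeasurable (by fun_prop)),
    integral_exp_trace_matrixNormal m hP hs]
  simp only [Matrix.mul_add, Matrix.trace_add, Complex.ofReal_add, add_mul, Complex.exp_add]
  rw [integral_const_mul, integral_exp_trace_matrixNormal 0 hP hs, ← Complex.exp_add]
  congr 1
  simp [sub_eq_add_neg]

theorem matrixNormal_map_sub_const {r p : ℕ} (m : Matrix (Fin r) (Fin p) ℝ)
    {P : Matrix (Fin r) (Fin r) ℝ} (hP : P.PosSemidef)
    {s : Matrix (Fin p) (Fin p) ℝ} (hs : s.PosSemidef) :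
    (matrixNormal m P s).map (fun Z => Z - m) = matrixNormal 0 P s := by
  rw [← matrixNormal_map_const_add m hP hs, Measure.map_map (by fun_prop) (by fun_prop)]
  convert! Measure.map_id
  ext1 Z
  simp

/-- With factorizations `Q = A A'` and `s = B' B`, this reduces the density of `N(0, Q, s)` to that
of the standard law. -/
theorem matrixNormal_one_map_mul_mul {r p : ℕ} (A : Matrix (Fin r) (Fin r) ℝ)
    (B : Matrix (Fin p) (Fin p) ℝ) :
    (matrixNormal (0 : Matrix (Fin r) (Fin p) ℝ) 1 1).map (fun Z => A * Z * B) =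
      matrixNormal 0 (A * Aᵀ) (Bᵀ * B) := by
  have hm : Measurable fun Z : Matrix (Fin r) (Fin p) ℝ => A * Z * B := by fun_prop
  have := Measure.isProbabilityMeasure_map (μ := matrixNormal (0 : Matrix (Fin r) (Fin p) ℝ) 1 1)
    hm.aemeasurable
  have hA : (A * Aᵀ).PosSemidef := by simpa using posSemidef_self_mul_conjTranspose A
  have hB : (Bᵀ * B).PosSemidef := by simpa using posSemidef_conjTranspose_mul_self B
  refine ext_of_integral_exp_trace fun T => ?_
  rw [integral_map hm.aemeasurable (Measurable.aestronglyMeasurable (by fun_prop)),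
    integral_exp_trace_matrixNormal 0 hA hB]
  have e : ∀ Z : Matrix (Fin r) (Fin p) ℝ,
      (Tᵀ * (A * Z * B)).trace = ((Aᵀ * T * Bᵀ)ᵀ * Z).trace := by
    intro Z
    rw [← Matrix.mul_assoc, Matrix.trace_mul_comm]
    simp only [Matrix.transpose_mul, Matrix.transpose_transpose, Matrix.mul_assoc]
  simp only [e]
  rw [integral_exp_trace_matrixNormal 0 PosSemidef.one PosSemidef.one]
  have e2 : ((Aᵀ * T * Bᵀ)ᵀ * (1 : Matrix (Fin r) (Fin r) ℝ) * (Aᵀ * T * Bᵀ) *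
      (1 : Matrix (Fin p) (Fin p) ℝ)).trace =
      (Tᵀ * (A * Aᵀ) * T * (Bᵀ * B)).trace := by
    rw [← Matrix.mul_assoc (Tᵀ * (A * Aᵀ) * T), Matrix.trace_mul_comm _ B]
    simp only [Matrix.transpose_mul, Matrix.transpose_transpose, Matrix.mul_assoc, Matrix.mul_one]
  rw [e2]
  simp

theorem matrixNormal_map_mul_left {a b p : ℕ} (A : Matrix (Fin b) (Fin a) ℝ)
    {P : Matrix (Fin a) (Fin a) ℝ} (hP : P.PosSemidef)
    {s : Matrix (Fin p) (Fin p) ℝ} (hs : s.PosSemidef) :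
    (matrixNormal 0 P s).map (fun Z => A * Z) = matrixNormal 0 (A * P * Aᵀ) s := by
  have hm : Measurable fun Z : Matrix (Fin a) (Fin p) ℝ => A * Z := by fun_prop
  have := Measure.isProbabilityMeasure_map (μ := matrixNormal 0 P s) hm.aemeasurable
  have hA : (A * P * Aᵀ).PosSemidef := by simpa using hP.mul_mul_conjTranspose_same A
  refine ext_of_integral_exp_trace fun T => ?_
  rw [integral_map hm.aemeasurable (Measurable.aestronglyMeasurable (by fun_prop)),
    integral_exp_trace_matrixNormal 0 hA hs]
  have e : ∀ Z : Matrix (Fin a) (Fin p) ℝ, (Tᵀ * (A * Z)).trace = ((Aᵀ * T)ᵀ * Z).trace := by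
    intro Z
    simp only [Matrix.transpose_mul, Matrix.transpose_transpose, Matrix.mul_assoc]
  simp only [e]
  rw [integral_exp_trace_matrixNormal 0 hP hs]
  simp only [Matrix.transpose_mul, Matrix.transpose_transpose, Matrix.mul_assoc, Matrix.mul_zero]

theorem matrixNormal_prod_map_add {a b p : ℕ} (A : Matrix (Fin b) (Fin a) ℝ)
    {P : Matrix (Fin a) (Fin a) ℝ} (hP : P.PosSemidef)
    {W : Matrix (Fin b) (Fin b) ℝ} (hW : W.PosSemidef)
    {s : Matrix (Fin p) (Fin p) ℝ} (hs : s.PosSemidef) :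
    ((matrixNormal (0 : Matrix (Fin a) (Fin p) ℝ) P s).prod
        (matrixNormal (0 : Matrix (Fin b) (Fin p) ℝ) W s)).map (fun z =>
        (A * z.1 + z.2 : Matrix (Fin b) (Fin p) ℝ)) =
      matrixNormal 0 (A * P * Aᵀ + W) s := by
  have hm : Measurable fun z : Matrix (Fin a) (Fin p) ℝ × Matrix (Fin b) (Fin p) ℝ =>
    A * z.1 + z.2 := by fun_prop
  have := Measure.isProbabilityMeasure_map
    (μ := (matrixNormal 0 P s).prod (matrixNormal 0 W s)) hm.aemeasurable
  have hA : (A * P * Aᵀ + W).PosSemidef :=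
    (by simpa using hP.mul_mul_conjTranspose_same A : (A * P * Aᵀ).PosSemidef).add hW
  refine ext_of_integral_exp_trace fun T => ?_
  rw [integral_map hm.aemeasurable (Measurable.aestronglyMeasurable (by fun_prop)),
    integral_exp_trace_matrixNormal 0 hA hs]
  have e : ∀ z : Matrix (Fin a) (Fin p) ℝ × Matrix (Fin b) (Fin p) ℝ,
      (Tᵀ * (A * z.1 + z.2)).trace = ((Aᵀ * T)ᵀ * z.1).trace + (Tᵀ * z.2).trace := by
    intro z
    simp only [Matrix.transpose_mul, Matrix.transpose_transpose, Matrix.mul_assoc, Matrix.mul_add,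
      Matrix.trace_add]
  simp only [e]
  rw [integral_exp_trace_matrixNormal_prod hP hW hs]
  simp only [Matrix.transpose_mul, Matrix.transpose_transpose, Matrix.mul_assoc, Matrix.mul_zero,
    Matrix.mul_add, Matrix.add_mul, Matrix.trace_add, Matrix.trace_zero, Complex.ofReal_zero,
    zero_mul, zero_sub, neg_div]

/-- Two uncorrelated linear images of a pair of independent matrix normal variables are
independent. -/
theorem matrixNormal_prod_map_prodMk {a b c e p : ℕ}
    {P : Matrix (Fin a) (Fin a) ℝ} (hP : P.PosSemidef)
    {W : Matrix (Fin b) (Fin b) ℝ} (hW : W.PosSemidef)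
    {s : Matrix (Fin p) (Fin p) ℝ} (hs : s.PosSemidef)
    (A : Matrix (Fin c) (Fin a) ℝ) (B : Matrix (Fin c) (Fin b) ℝ)
    (C : Matrix (Fin e) (Fin a) ℝ) (D : Matrix (Fin e) (Fin b) ℝ)
    (h : A * P * Cᵀ + B * W * Dᵀ = 0) :
    ((matrixNormal 0 P s).prod (matrixNormal 0 W s)).map
        (fun z => (A * z.1 + B * z.2, C * z.1 + D * z.2)) =
      (matrixNormal 0 (A * P * Aᵀ + B * W * Bᵀ) s).prod
        (matrixNormal 0 (C * P * Cᵀ + D * W * Dᵀ) s) := by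
  have hm : Measurable fun z : Matrix (Fin a) (Fin p) ℝ × Matrix (Fin b) (Fin p) ℝ =>
    (A * z.1 + B * z.2, C * z.1 + D * z.2) := by fun_prop
  have := Measure.isProbabilityMeasure_map
    (μ := (matrixNormal 0 P s).prod (matrixNormal 0 W s)) hm.aemeasurable
  have hA : (A * P * Aᵀ + B * W * Bᵀ).PosSemidef :=
    (by simpa using hP.mul_mul_conjTranspose_same A : (A * P * Aᵀ).PosSemidef).add
      (by simpa using hW.mul_mul_conjTranspose_same B : (B * W * Bᵀ).PosSemidef)
  have hC : (C * P * Cᵀ + D * W * Dᵀ).PosSemidef :=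
    (by simpa using hP.mul_mul_conjTranspose_same C : (C * P * Cᵀ).PosSemidef).add
      (by simpa using hW.mul_mul_conjTranspose_same D : (D * W * Dᵀ).PosSemidef)
  have hPT : Pᵀ = P := by simpa [Matrix.IsHermitian] using hP.1
  have hWT : Wᵀ = W := by simpa [Matrix.IsHermitian] using hW.1
  have h' : C * P * Aᵀ + D * W * Bᵀ = 0 := by
    have := congrArg Matrix.transpose h
    simpa only [Matrix.transpose_add, Matrix.transpose_mul, Matrix.transpose_transpose, hPT, hWT,
      Matrix.mul_assoc, Matrix.transpose_zero] using this
  refine ext_of_integral_exp_trace_prod fun T U => ?_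
  rw [integral_map hm.aemeasurable (Measurable.aestronglyMeasurable (by fun_prop)),
    integral_exp_trace_matrixNormal_prod hA hC hs]
  have e : ∀ z : Matrix (Fin a) (Fin p) ℝ × Matrix (Fin b) (Fin p) ℝ,
      (Tᵀ * (A * z.1 + B * z.2)).trace + (Uᵀ * (C * z.1 + D * z.2)).trace =
        ((Aᵀ * T + Cᵀ * U)ᵀ * z.1).trace + ((Bᵀ * T + Dᵀ * U)ᵀ * z.2).trace := by
    intro z
    simp only [Matrix.transpose_mul, Matrix.transpose_transpose, Matrix.mul_assoc, Matrix.mul_add,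
      Matrix.trace_add, Matrix.transpose_add, Matrix.add_mul]
    ring
  simp only [e]
  rw [integral_exp_trace_matrixNormal_prod hP hW hs]
  have e3 : (Aᵀ * T + Cᵀ * U)ᵀ * P * (Aᵀ * T + Cᵀ * U) * s +
      (Bᵀ * T + Dᵀ * U)ᵀ * W * (Bᵀ * T + Dᵀ * U) * s =
      Tᵀ * (A * P * Aᵀ + B * W * Bᵀ) * T * s + Uᵀ * (C * P * Cᵀ + D * W * Dᵀ) * U * s +
      (Tᵀ * (A * P * Cᵀ + B * W * Dᵀ) * U * s + Uᵀ * (C * P * Aᵀ + D * W * Bᵀ) * T * s) := by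
    simp only [Matrix.transpose_mul, Matrix.transpose_transpose, Matrix.mul_assoc, Matrix.mul_add,
      Matrix.transpose_add, Matrix.add_mul]
    abel
  rw [← Matrix.trace_add, e3, h, h']
  simp

end MatrixNormal

/-! ### The density of the standard Gaussian product measure. -/

section WithDensity

theorem map_withDensity_comp {α β : Type*} [MeasurableSpace α] [MeasurableSpace β]
    {μ : Measure α} {g : α → β} (hg : Measurable g) {f : β → ENNReal} (hf : Measurable f) :
    (μ.withDensity fun x => f (g x)).map g = (μ.map g).withDensity f := by
  ext s hs
  rw [Measure.map_apply hg hs, withDensity_apply _ (hg hs), withDensity_apply _ hs,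
    setLIntegral_map hs hf hg]

theorem lintegral_pi_prod {ι : Type*} [Fintype ι] (ν : ι → Measure ℝ)
    [∀ i, IsProbabilityMeasure (ν i)] {f : ι → ℝ → ENNReal} (hf : ∀ i, Measurable (f i)) :
    ∫⁻ x, ∏ i, f i (x i) ∂(Measure.pi ν) = ∏ i, ∫⁻ x, f i x ∂(ν i) := by
  rw [lintegral_prod_eq_prod_lintegral_of_indepFun Finset.univ (fun i (x : ι → ℝ) => f i (x i))
    (iIndepFun_pi fun i => (hf i).aemeasurable) fun i => (hf i).comp (measurable_pi_apply i)]
  refine Finset.prod_congr rfl fun i _ => ?_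
  rw [← lintegral_map (hf i) (measurable_pi_apply i)]
  congr 1
  exact (measurePreserving_eval ν i).map_eq

/-- Integrals of products factor by independence under a product of probability measures, which
Lebesgue measure is not. So Lebesgue measure is first shown to have the reciprocal density against
the Gaussian, and the positive finite density is then inverted. -/
theorem pi_gaussianReal_eq_withDensity {ι : Type*} [Fintype ι] :
    (Measure.pi fun _ : ι => gaussianReal 0 1) =
      (volume : Measure (ι → ℝ)).withDensity fun x => ∏ i, gaussianPDF 0 1 (x i) := by
  have hpos : ∀ x, gaussianPDF 0 1 x ≠ 0 := fun x => (gaussianPDF_pos 0 one_ne_zero x).ne'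
  have htop : ∀ x, gaussianPDF 0 1 x ≠ ⊤ := fun x => ENNReal.ofReal_ne_top
  have hm : Measurable (gaussianPDF 0 1) := measurable_gaussianPDF 0 1
  have hm' : Measurable fun x : ι → ℝ => ∏ i, gaussianPDF 0 1 (x i) :=
    Finset.measurable_prod _ fun i _ => hm.comp (measurable_pi_apply i)
  have key : (volume : Measure (ι → ℝ)) = (Measure.pi fun _ : ι => gaussianReal 0 1).withDensity
      fun x => (∏ i, gaussianPDF 0 1 (x i))⁻¹ := by
    refine Measure.pi_eq fun s hs => ?_
    rw [withDensity_apply _ (MeasurableSet.univ_pi hs),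
      ← lintegral_indicator (MeasurableSet.univ_pi hs)]
    have e : ∀ x : ι → ℝ, (Set.univ.pi s).indicator
        (fun x => (∏ i, gaussianPDF 0 1 (x i))⁻¹) x =
        ∏ i, (s i).indicator (fun t => (gaussianPDF 0 1 t)⁻¹) (x i) := by
      intro x
      by_cases hx : x ∈ Set.univ.pi s
      · rw [Set.indicator_of_mem hx, ENNReal.prod_inv_distrib]
        · refine Finset.prod_congr rfl fun i _ => ?_
          rw [Set.indicator_of_mem (hx i (Set.mem_univ i))]
        · intro i _ j _ _
          exact Or.inl (hpos _)
      · rw [Set.indicator_of_notMem hx]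
        simp only [Set.mem_pi, Set.mem_univ, true_implies, not_forall] at hx
        obtain ⟨i, hi⟩ := hx
        exact (Finset.prod_eq_zero (Finset.mem_univ i) (Set.indicator_of_notMem hi _)).symm
    simp only [e]
    rw [lintegral_pi_prod (f := fun i => (s i).indicator fun t => (gaussianPDF 0 1 t)⁻¹) _
      fun i => Measurable.indicator (measurable_inv.comp hm) (hs i)]
    refine Finset.prod_congr rfl fun i _ => ?_
    rw [lintegral_indicator (hs i), ← withDensity_apply _ (hs i),
      gaussianReal_of_var_ne_zero 0 one_ne_zero,
      withDensity_inv_same hm (ae_of_all _ hpos) (ae_of_all _ htop)]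
  have hinv : (fun x : ι → ℝ => ∏ i, gaussianPDF 0 1 (x i)) =
      fun x => ((∏ i, gaussianPDF 0 1 (x i))⁻¹)⁻¹ := by
    funext x; rw [inv_inv]
  conv_rhs => rw [key, hinv]
  refine (withDensity_inv_same (f := fun x : ι → ℝ => (∏ i, gaussianPDF 0 1 (x i))⁻¹)
    (measurable_inv.comp hm') (ae_of_all _ fun x => ?_) (ae_of_all _ fun x => ?_)).symm
  · exact ENNReal.inv_ne_zero.2 (ENNReal.prod_ne_top fun i _ => htop _)
  · exact ENNReal.inv_ne_top.2 (Finset.prod_ne_zero_iff.2 fun i _ => hpos _)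

end WithDensity

/-! ### Lebesgue measure on rectangular matrices. -/

section MatrixVolume

/-- Lebesgue measure on the `r × p` matrices. -/
def matrixVolume (r p : ℕ) : Measure (Matrix (Fin r) (Fin p) ℝ) :=
  (volume : Measure (Fin r → Fin p → ℝ)).map fun x => (Matrix.of x : Matrix (Fin r) (Fin p) ℝ)

instance sFinite_matrixVolume (r p : ℕ) : SFinite (matrixVolume r p) := by
  unfold matrixVolume; infer_instance

theorem measurable_matrix_of (r p : ℕ) : Measurable fun x : Fin r → Fin p → ℝ =>
    (Matrix.of x : Matrix (Fin r) (Fin p) ℝ) := measurable_id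

theorem matrixVolume_map_const_add {r p : ℕ} (m : Matrix (Fin r) (Fin p) ℝ) :
    (matrixVolume r p).map (fun Z => m + Z) = matrixVolume r p := by
  rw [matrixVolume, Measure.map_map (by fun_prop) (measurable_matrix_of r p)]
  have : ((fun Z => m + Z) ∘ fun x : Fin r → Fin p → ℝ => (Matrix.of x)) =
      (fun x => Matrix.of x) ∘ fun x => (fun i j => m i j) + x := rfl
  rw [this, ← Measure.map_map (measurable_matrix_of r p) (measurable_const_add _),
    map_add_left_eq_self]

/-- The matrix with given stacked columns. -/
def unvec {r p : ℕ} (x : Fin p × Fin r → ℝ) : Matrix (Fin r) (Fin p) ℝ :=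
  Matrix.of fun i j => x (j, i)

theorem measurable_unvec' {r p : ℕ} : Measurable (unvec (r := r) (p := p)) :=
  measurable_matrix_iff.2 fun i j => measurable_pi_apply (j, i)

theorem unvec_kronecker_mulVec {r p : ℕ} (A : Matrix (Fin r) (Fin r) ℝ)
    (B : Matrix (Fin p) (Fin p) ℝ) (x : Fin p × Fin r → ℝ) :
    unvec ((Bᵀ ⊗ₖ A) *ᵥ x) = A * unvec x * B := by
  have hx : x = Matrix.vec (unvec x) := rfl
  conv_lhs => rw [hx, kronecker_mulVec_vec, transpose_transpose]
  rfl

/-- Uniqueness of Haar measure up to a factor. The factor may stay unknown, since it is absorbed in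
normalizing constants. -/
theorem volume_map_unvec (r p : ℕ) : ∃ c : ENNReal, c ≠ ⊤ ∧
    (volume : Measure (Fin p × Fin r → ℝ)).map unvec = c • matrixVolume r p := by
  let e : (Fin p × Fin r → ℝ) ≃ₗ[ℝ] (Fin r → Fin p → ℝ) :=
    { toFun := fun x i j => x (j, i)
      invFun := fun y ij => y ij.2 ij.1
      map_add' := fun _ _ => rfl
      map_smul' := fun _ _ => rfl
      left_inv := fun _ => rfl
      right_inv := fun _ => rfl }
  let e' : (Fin p × Fin r → ℝ) ≃L[ℝ] (Fin r → Fin p → ℝ) := e.toContinuousLinearEquiv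
  have he : Measurable e' := e'.continuous.measurable
  have hH : (Measure.map e' (volume : Measure (Fin p × Fin r → ℝ))).IsAddHaarMeasure :=
    e'.isAddHaarMeasure_map _
  have hV : (volume : Measure (Fin r → Fin p → ℝ)).IsAddHaarMeasure := by
    have : (volume : Measure (Fin p → ℝ)).IsAddHaarMeasure := inferInstance
    exact (inferInstance : (Measure.pi fun _ : Fin r =>
      (volume : Measure (Fin p → ℝ))).IsAddHaarMeasure)
  have h := Measure.isAddLeftInvariant_eq_smul (Measure.map e' volume)
    (volume : Measure (Fin r → Fin p → ℝ))
  refine ⟨_, ENNReal.coe_ne_top (r := Measure.addHaarScalarFactor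
    (Measure.map e' volume) (volume : Measure (Fin r → Fin p → ℝ))), ?_⟩
  have hu : (unvec : (Fin p × Fin r → ℝ) → Matrix (Fin r) (Fin p) ℝ) =
    (fun x => Matrix.of x) ∘ e' := rfl
  rw [hu, ← Measure.map_map (measurable_matrix_of r p) he, matrixVolume]
  exact (congrArg (Measure.map _) h).trans (Measure.map_smul _ _ _)

end MatrixVolume

/-! ### The density of a nonsingular matrix normal law. -/

section Density

/-- The density of `N_{r×p}(0, Q, s)`, up to a factor that does not depend on `s`. -/
def matrixNormalKernel {r p : ℕ} (Q : Matrix (Fin r) (Fin r) ℝ) (s : Matrix (Fin p) (Fin p) ℝ)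
    (Y : Matrix (Fin r) (Fin p) ℝ) : ENNReal :=
  ENNReal.ofReal (s.det ^ (-(r / 2 : ℝ)) * Real.exp (-(1 / 2) * (Yᵀ * Q⁻¹ * Y * s⁻¹).trace))

theorem measurable_matrixNormalKernel {r p : ℕ} (Q : Matrix (Fin r) (Fin r) ℝ) :
    Measurable fun x : Matrix (Fin p) (Fin p) ℝ × Matrix (Fin r) (Fin p) ℝ =>
      matrixNormalKernel Q x.1 x.2 := by
  unfold matrixNormalKernel
  fun_prop

theorem measurable_matrixNormalKernel_right {r p : ℕ} (Q : Matrix (Fin r) (Fin r) ℝ)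
    (s : Matrix (Fin p) (Fin p) ℝ) : Measurable (matrixNormalKernel Q s) := by
  unfold matrixNormalKernel
  fun_prop

theorem matrixNormal_one_eq_map_pi (r p : ℕ) :
    matrixNormal (0 : Matrix (Fin r) (Fin p) ℝ) 1 1 =
      (Measure.pi fun _ : Fin p × Fin r => gaussianReal 0 1).map unvec := by
  have h0 : (WithLp.toLp 2 (Matrix.vec (0 : Matrix (Fin r) (Fin p) ℝ)) :
      EuclideanSpace ℝ (Fin p × Fin r)) = 0 := rfl
  rw [matrixNormal, one_kronecker_one, h0, multivariateGaussian_zero_one, ← map_pi_eq_stdGaussian,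
    Measure.map_map (measurable_unvec r p) (by fun_prop)]
  rfl

theorem prod_gaussianPDF_eq (r p : ℕ) : ∃ c : ENNReal, c ≠ ⊤ ∧ ∀ x : Fin p × Fin r → ℝ,
    ∏ i, gaussianPDF 0 1 (x i) =
      c * ENNReal.ofReal (Real.exp (-(1 / 2) * ((unvec x)ᵀ * unvec x).trace)) := by
  refine ⟨ENNReal.ofReal (∏ _i : Fin p × Fin r, (√(2 * Real.pi * (1 : NNReal)))⁻¹),
    ENNReal.ofReal_ne_top, fun x => ?_⟩
  have e : ((unvec x)ᵀ * unvec x).trace = ∑ i, x i ^ 2 := by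
    simp [Matrix.trace, Matrix.mul_apply, unvec, Fintype.sum_prod_type, pow_two]
  simp only [gaussianPDF, gaussianPDFReal]
  rw [← ENNReal.ofReal_prod_of_nonneg fun i _ => by positivity, Finset.prod_mul_distrib,
    ENNReal.ofReal_mul (by positivity), ← Real.exp_sum, e, Finset.mul_sum]
  congr 4
  funext i
  simp
  ring

theorem matrixNormal_one_eq_withDensity (r p : ℕ) : ∃ c : ENNReal, c ≠ ⊤ ∧
    matrixNormal (0 : Matrix (Fin r) (Fin p) ℝ) 1 1 =
      c • ((volume : Measure (Fin p × Fin r → ℝ)).map unvec).withDensity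
        fun Z => ENNReal.ofReal (Real.exp (-(1 / 2) * (Zᵀ * Z).trace)) := by
  obtain ⟨c, hc, h⟩ := prod_gaussianPDF_eq r p
  refine ⟨c, hc, ?_⟩
  rw [matrixNormal_one_eq_map_pi, pi_gaussianReal_eq_withDensity]
  simp only [h]
  rw [← map_withDensity_comp measurable_unvec' (by fun_prop), ← Measure.map_smul]
  congr 1
  exact withDensity_smul _ (Measurable.ennreal_ofReal
    (Real.measurable_exp.comp (((measurable_unvec'.matrix_transpose.matrix_mul
      measurable_unvec').matrix_trace).const_mul _)))

/-- In stacked columns, `Z ↦ A Z B` is the matrix `B' ⊗ A`, of determinant `|B|^r |A|^p`. -/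
theorem volume_map_unvec_map_mul_mul {r p : ℕ} {A : Matrix (Fin r) (Fin r) ℝ}
    {B : Matrix (Fin p) (Fin p) ℝ} (hA : A.det ≠ 0) (hB : B.det ≠ 0) :
    ((volume : Measure (Fin p × Fin r → ℝ)).map unvec).map (fun Z => A * Z * B) =
      ENNReal.ofReal |(B.det ^ r * A.det ^ p)⁻¹| •
        (volume : Measure (Fin p × Fin r → ℝ)).map unvec := by
  have hdet : (Bᵀ ⊗ₖ A).det = B.det ^ r * A.det ^ p := by
    rw [det_kronecker, det_transpose]; simp
  have h0 : (Bᵀ ⊗ₖ A).det ≠ 0 := by rw [hdet]; positivity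
  rw [Measure.map_map (by fun_prop) measurable_unvec', ← Measure.map_smul, ← hdet,
    ← Real.map_matrix_volume_pi_eq_smul_volume_pi h0, Measure.map_map measurable_unvec'
      (by fun_prop)]
  congr 1
  funext x
  simp [unvec_kronecker_mulVec]

theorem Matrix.PosDef.exists_eq_transpose_mul_self {n : ℕ} {s : Matrix (Fin n) (Fin n) ℝ}
    (hs : s.PosDef) : ∃ B : Matrix (Fin n) (Fin n) ℝ, s = Bᵀ * B ∧ B.det ≠ 0 ∧
      |B.det| = s.det ^ (1 / 2 : ℝ) := by
  obtain ⟨B, hB⟩ := CStarAlgebra.nonneg_iff_eq_star_mul_self.1 hs.posSemidef.nonneg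
  have hB' : s = Bᵀ * B := by simpa [star_eq_conjTranspose] using hB
  have hd : s.det = B.det ^ 2 := by rw [hB', det_mul, det_transpose, sq]
  refine ⟨B, hB', ?_, ?_⟩
  · intro h0
    have := hs.det_pos
    rw [hd, h0] at this
    simp at this
  · rw [hd, ← Real.sqrt_eq_rpow, Real.sqrt_sq_eq_abs]

/-- For positive definite `s`, the law `N_{r×p}(0, Q, s)` has the expected density. -/
theorem exists_matrixNormal_eq_withDensity {r p : ℕ} {Q : Matrix (Fin r) (Fin r) ℝ}
    (hQ : Q.PosDef) : ∃ K : ENNReal, K ≠ ⊤ ∧ ∀ s : Matrix (Fin p) (Fin p) ℝ, s.PosDef →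
      matrixNormal 0 Q s = K • (matrixVolume r p).withDensity (matrixNormalKernel Q s) := by
  obtain ⟨c, hc, hvol⟩ := volume_map_unvec r p
  obtain ⟨k, hk, hone⟩ := matrixNormal_one_eq_withDensity r p
  obtain ⟨A', hA', hAdet', -⟩ := hQ.exists_eq_transpose_mul_self
  obtain ⟨A, hA, hAdet⟩ : ∃ A : Matrix (Fin r) (Fin r) ℝ, Q = A * Aᵀ ∧ A.det ≠ 0 :=
    ⟨A'ᵀ, by simpa using hA', by simpa using hAdet'⟩
  -- The constant is chosen before `s`: of the Jacobian, only `|A|^{-p}` enters it, while `|B|^{-r}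
  -- = |s|^{-r/2}` stays in the kernel. Bayes' formula in `s` depends on this separation.
  refine ⟨k * (ENNReal.ofReal |(A.det ^ p)⁻¹| * c), ENNReal.mul_ne_top hk
    (ENNReal.mul_ne_top ENNReal.ofReal_ne_top hc), fun s hs => ?_⟩
  obtain ⟨B, hB, hBdet, hBabs⟩ := hs.exists_eq_transpose_mul_self
  have hAu : IsUnit A.det := isUnit_iff_ne_zero.2 hAdet
  have hBu : IsUnit B.det := isUnit_iff_ne_zero.2 hBdet
  have hg : Measurable fun Z : Matrix (Fin r) (Fin p) ℝ => A * Z * B := by fun_prop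
  have hdens : ∀ Z : Matrix (Fin r) (Fin p) ℝ, (Zᵀ * Z).trace =
      ((A * Z * B)ᵀ * Q⁻¹ * (A * Z * B) * s⁻¹).trace := by
    intro Z
    rw [hA, hB, Matrix.mul_inv_rev, Matrix.mul_inv_rev]
    have : (A * Z * B)ᵀ * (Aᵀ⁻¹ * A⁻¹) * (A * Z * B) * (B⁻¹ * Bᵀ⁻¹) =
        Bᵀ * (Zᵀ * ((Aᵀ * Aᵀ⁻¹) * ((A⁻¹ * A) * (Z * (B * B⁻¹ * Bᵀ⁻¹))))) := by
      simp only [Matrix.transpose_mul, Matrix.mul_assoc]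
    rw [this, Matrix.mul_nonsing_inv _ (by simpa using hAu), Matrix.nonsing_inv_mul _ hAu,
      Matrix.mul_nonsing_inv _ hBu, Matrix.one_mul, Matrix.one_mul, Matrix.one_mul,
      Matrix.trace_mul_comm Bᵀ, Matrix.mul_assoc, Matrix.mul_assoc,
      Matrix.nonsing_inv_mul _ (by simpa using hBu), Matrix.mul_one]
  have hφ : Measurable fun Y : Matrix (Fin r) (Fin p) ℝ =>
      ENNReal.ofReal (Real.exp (-(1 / 2) * (Yᵀ * Q⁻¹ * Y * s⁻¹).trace)) := by fun_prop
  have hconst : ENNReal.ofReal |(B.det ^ r * A.det ^ p)⁻¹| =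
      ENNReal.ofReal |(A.det ^ p)⁻¹| * ENNReal.ofReal (s.det ^ (-(r / 2 : ℝ))) := by
    rw [← ENNReal.ofReal_mul (abs_nonneg _), mul_inv, abs_mul, mul_comm, abs_inv (B.det ^ r),
      abs_pow, hBabs, ← Real.rpow_natCast _ r, ← Real.rpow_mul hs.det_pos.le,
      ← Real.rpow_neg hs.det_pos.le]
    congr 3
    ring
  have hker : matrixNormalKernel Q s = ENNReal.ofReal (s.det ^ (-(r / 2 : ℝ))) •
      fun Y : Matrix (Fin r) (Fin p) ℝ =>
        ENNReal.ofReal (Real.exp (-(1 / 2) * (Yᵀ * Q⁻¹ * Y * s⁻¹).trace)) := by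
    funext Y
    rw [matrixNormalKernel, ENNReal.ofReal_mul (Real.rpow_nonneg hs.det_pos.le _)]
    rfl
  conv_lhs => rw [hA, hB, ← matrixNormal_one_map_mul_mul, hone]
  simp only [hdens]
  rw [Measure.map_smul, map_withDensity_comp hg hφ, volume_map_unvec_map_mul_mul hAdet hBdet,
    hvol, hker, withDensity_smul _ hφ, withDensity_smul_measure, withDensity_smul_measure, hconst]
  simp only [smul_smul]
  congr 1
  ring

end Density

/-! ### Measurable dependence of the normal law on `s`. -/

section NormalKernel

/-- Measurability in `s` is read off the jointly measurable density. -/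
theorem exists_kernel_matrixNormal_one (r p : ℕ) : ∃ G : Kernel (Matrix (Fin p) (Fin p) ℝ)
    (Matrix (Fin r) (Fin p) ℝ), ∀ s, s.PosDef → G s = matrixNormal 0 1 s := by
  obtain ⟨K, -, h⟩ := exists_matrixNormal_eq_withDensity (r := r) (p := p)
    (PosDef.one : (1 : Matrix (Fin r) (Fin r) ℝ).PosDef)
  have hm := (measurable_matrixNormalKernel (p := p) (1 : Matrix (Fin r) (Fin r) ℝ))
  have hm' : Measurable (Function.uncurry fun (s : Matrix (Fin p) (Fin p) ℝ)
      (Y : Matrix (Fin r) (Fin p) ℝ) => K * matrixNormalKernel 1 s Y) := hm.const_mul K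
  refine ⟨Kernel.withDensity (Kernel.const _ (matrixVolume r p))
      fun s Y => K * matrixNormalKernel 1 s Y, fun s hs => ?_⟩
  have e : (fun Y : Matrix (Fin r) (Fin p) ℝ => K * matrixNormalKernel 1 s Y) = K • matrixNormalKernel 1 s := by
    funext Y
    rw [Pi.smul_apply, smul_eq_mul]
  rw [h s hs, Kernel.withDensity_apply _ hm', Kernel.const_apply, e, 
    withDensity_smul K (measurable_matrixNormalKernel_right 1 s)]

/-- The laws `N_{r×p}(0, P, s)`, for positive definite `s`, form a Markov kernel. -/
theorem exists_kernel_matrixNormal {r p : ℕ} {P : Matrix (Fin r) (Fin r) ℝ}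
    (hP : P.PosSemidef) : ∃ G : Kernel (Matrix (Fin p) (Fin p) ℝ) (Matrix (Fin r) (Fin p) ℝ),
      IsMarkovKernel G ∧ ∀ s, s.PosDef → G s = matrixNormal 0 P s := by
  classical
  -- A singular `P` admits no density, so the kernel is the image under `Z ↦ A Z`, with `P = A A'`,
  -- of the kernel for the identity.
  obtain ⟨B, hB⟩ := CStarAlgebra.nonneg_iff_eq_star_mul_self.1 hP.nonneg
  obtain ⟨A, hA⟩ : ∃ A : Matrix (Fin r) (Fin r) ℝ, P = A * Aᵀ :=
    ⟨Bᵀ, by simpa [star_eq_conjTranspose] using hB⟩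
  obtain ⟨G, hG⟩ := exists_kernel_matrixNormal_one r p
  have hm : Measurable fun Z : Matrix (Fin r) (Fin p) ℝ => A * Z := by fun_prop
  -- Off the positive definite cone, where `MIW` has no mass, a Dirac measure keeps the kernel
  -- Markov.
  let G' : Kernel (Matrix (Fin p) (Fin p) ℝ) (Matrix (Fin r) (Fin p) ℝ) :=
    Kernel.piecewise (measurableSet_posDef p) (G.map fun Z => A * Z)
      (Kernel.const _ (Measure.dirac 0))
  have key : ∀ s, s.PosDef → G' s = matrixNormal 0 P s := by
    intro s hs
    have : G' s = (G.map fun Z => A * Z) s := by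
      simp only [G', Kernel.piecewise_apply]
      exact if_pos hs
    rw [this, Kernel.map_apply _ hm, hG s hs, matrixNormal_map_mul_left A PosSemidef.one
      hs.posSemidef, Matrix.mul_one, hA]
  refine ⟨G', ⟨fun s => ?_⟩, key⟩
  by_cases hs : s.PosDef
  · rw [key s hs]; infer_instance
  · have : G' s = Measure.dirac 0 := by
      simp only [G', Kernel.piecewise_apply]
      exact if_neg hs
    rw [this]; infer_instance

end NormalKernel

/-! ### The Jacobian of the congruence `s ↦ B s B'` on symmetric matrices. -/

section SymmetricMatrices

/-- The symmetric matrix with the given entries on and above the diagonal. -/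
def symOfUpper {p : ℕ} (x : {ij : Fin p × Fin p // ij.1 ≤ ij.2} → ℝ) :
    Matrix (Fin p) (Fin p) ℝ :=
  Matrix.of fun i j => x ⟨(min i j, max i j), min_le_max⟩

theorem measurable_symOfUpper (p : ℕ) : Measurable (symOfUpper (p := p)) :=
  measurable_matrix_iff.2 fun _ _ => measurable_pi_apply _

theorem symLebesgue_eq (p : ℕ) : symLebesgue p = (volume :
    Measure ({ij : Fin p × Fin p // ij.1 ≤ ij.2} → ℝ)).map symOfUpper := rfl

instance sFinite_symLebesgue (p : ℕ) : SFinite (symLebesgue p) := by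
  unfold symLebesgue; infer_instance

theorem isSymm_symOfUpper {p : ℕ} (x : {ij : Fin p × Fin p // ij.1 ≤ ij.2} → ℝ) :
    (symOfUpper x).IsSymm := by
  ext i j
  simp only [symOfUpper, Matrix.transpose_apply, Matrix.of_apply, min_comm j i, max_comm j i]

/-- The map `s ↦ B s B'` on symmetric matrices, in the coordinates given by the entries on and
above the diagonal. -/
def congrUpper {p : ℕ} (B : Matrix (Fin p) (Fin p) ℝ) :
    ({ij : Fin p × Fin p // ij.1 ≤ ij.2} → ℝ) →ₗ[ℝ] ({ij : Fin p × Fin p // ij.1 ≤ ij.2} → ℝ) where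
  toFun x ij := (B * symOfUpper x * Bᵀ) ij.1.1 ij.1.2
  map_add' x y := by
    have : symOfUpper (x + y) = symOfUpper x + symOfUpper y := rfl
    funext ij
    simp only [this, Matrix.mul_add, Matrix.add_mul, Matrix.add_apply, Pi.add_apply]
  map_smul' c x := by
    have : symOfUpper (c • x) = c • symOfUpper x := rfl
    funext ij
    simp only [this, Matrix.mul_smul, Matrix.smul_mul, Matrix.smul_apply, Pi.smul_apply,
      RingHom.id_apply]

theorem symOfUpper_congrUpper {p : ℕ} (B : Matrix (Fin p) (Fin p) ℝ)
    (x : {ij : Fin p × Fin p // ij.1 ≤ ij.2} → ℝ) :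
    symOfUpper (congrUpper B x) = B * symOfUpper x * Bᵀ := by
  have hs : (B * symOfUpper x * Bᵀ).IsSymm := by
    rw [Matrix.IsSymm, Matrix.transpose_mul, Matrix.transpose_mul, (isSymm_symOfUpper x).eq,
      Matrix.transpose_transpose, Matrix.mul_assoc]
  ext i j
  rcases le_total i j with h | h
  · simp [symOfUpper, congrUpper, min_eq_left h, max_eq_right h]
  · rw [← hs.apply]
    simp [symOfUpper, congrUpper, min_eq_right h, max_eq_left h]

theorem symOfUpper_injective {p : ℕ} : Function.Injective (symOfUpper (p := p)) := by
  intro x y h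
  funext ⟨⟨i, j⟩, hij⟩
  have := congrFun (congrFun h i) j
  simpa [symOfUpper, min_eq_left hij, max_eq_right hij] using this

theorem congrUpper_mul {p : ℕ} (A B : Matrix (Fin p) (Fin p) ℝ) :
    congrUpper (A * B) = congrUpper A ∘ₗ congrUpper B := by
  refine LinearMap.ext fun x => symOfUpper_injective ?_
  simp only [LinearMap.comp_apply, symOfUpper_congrUpper, Matrix.transpose_mul, Matrix.mul_assoc]

theorem congrUpper_one (p : ℕ) : congrUpper (1 : Matrix (Fin p) (Fin p) ℝ) = LinearMap.id := by
  refine LinearMap.ext fun x => symOfUpper_injective ?_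
  simp [symOfUpper_congrUpper]

theorem det_congrUpper_mul {p : ℕ} (A B : Matrix (Fin p) (Fin p) ℝ) :
    LinearMap.det (congrUpper (A * B)) =
      LinearMap.det (congrUpper A) * LinearMap.det (congrUpper B) := by
  rw [congrUpper_mul, LinearMap.det_comp]

/-- The upper and lower triangles have equal products and together cover all pairs, with the
diagonal counted twice. So the square is `∏ D_i D_j` over all pairs times `∏ D_i²`. Squaring avoids
any discussion of signs. -/
theorem prod_upper_sq {p : ℕ} (D : Fin p → ℝ) :
    (∏ ij : {ij : Fin p × Fin p // ij.1 ≤ ij.2}, D ij.1.1 * D ij.1.2) ^ 2 =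
      ((∏ i, D i) ^ (p + 1)) ^ 2 := by
  have h1 : (∏ ij : {ij : Fin p × Fin p // ij.1 ≤ ij.2}, D ij.1.1 * D ij.1.2) =
      ∏ ij ∈ Finset.univ.filter fun ij : Fin p × Fin p => ij.1 ≤ ij.2, D ij.1 * D ij.2 := by
    rw [Finset.prod_subtype (Finset.univ.filter fun ij : Fin p × Fin p => ij.1 ≤ ij.2)
      (p := fun ij => ij.1 ≤ ij.2) (by simp) fun ij => D ij.1 * D ij.2]
  have h2 : (∏ ij ∈ Finset.univ.filter fun ij : Fin p × Fin p => ij.1 ≤ ij.2, D ij.1 * D ij.2) =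
      ∏ ij ∈ Finset.univ.filter fun ij : Fin p × Fin p => ij.2 ≤ ij.1, D ij.1 * D ij.2 := by
    refine Finset.prod_bij (fun ij _ => (ij.2, ij.1)) (by simp)
      (fun a _ b _ h => Prod.ext (congrArg Prod.snd h) (congrArg Prod.fst h)) (fun b hb => ?_) ?_
    · exact ⟨(b.2, b.1), by simpa using hb, rfl⟩
    · simp [mul_comm]
  have h3 : (∏ ij ∈ Finset.univ.filter fun ij : Fin p × Fin p => ij.2 ≤ ij.1, D ij.1 * D ij.2) =
      (∏ ij ∈ Finset.univ.filter fun ij : Fin p × Fin p => ¬ ij.1 ≤ ij.2, D ij.1 * D ij.2) *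
        ∏ i, D i ^ 2 := by
    have : (Finset.univ.filter fun ij : Fin p × Fin p => ij.2 ≤ ij.1) =
        (Finset.univ.filter fun ij : Fin p × Fin p => ¬ ij.1 ≤ ij.2) ∪
          Finset.univ.image fun i : Fin p => (i, i) := by
      ext ⟨i, j⟩
      simp only [Finset.mem_filter, Finset.mem_univ, true_and, Finset.mem_union, not_le,
        Finset.mem_image, Prod.mk.injEq, exists_eq_left]
      rw [le_iff_lt_or_eq, eq_comm (a := j)]
    rw [this, Finset.prod_union, Finset.prod_image fun a _ b _ h => congrArg Prod.fst h]
    · simp only [pow_two]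
    · rw [Finset.disjoint_left]
      rintro ⟨i, j⟩ h h'
      simp only [Finset.mem_image, Finset.mem_univ, true_and, Prod.mk.injEq] at h'
      obtain ⟨k, rfl, rfl⟩ := h'
      simp at h
  rw [pow_two, h1]
  nth_rw 2 [h2]
  rw [h3, ← mul_assoc, Finset.prod_filter_mul_prod_filter_not, Fintype.prod_prod_type]
  simp only [Finset.prod_mul_distrib, Finset.prod_const, Finset.card_univ, Fintype.card_fin,
    Finset.prod_pow]
  ring

theorem congrUpper_diagonal {p : ℕ} (D : Fin p → ℝ) :
    congrUpper (diagonal D) = Matrix.toLin' (diagonal fun ij => D ij.1.1 * D ij.1.2) := by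
  refine LinearMap.ext fun x => funext fun ⟨⟨i, j⟩, hij⟩ => ?_
  simp only [congrUpper, LinearMap.coe_mk, AddHom.coe_mk, Matrix.diagonal_transpose,
    Matrix.diagonal_mul, Matrix.mul_diagonal, Matrix.toLin'_apply, Matrix.mulVec_diagonal,
    symOfUpper, Matrix.of_apply]
  have hij' : i ≤ j := hij
  simp only [min_eq_left hij', max_eq_right hij']
  ring

theorem abs_det_congrUpper_diagonal {p : ℕ} (D : Fin p → ℝ) :
    |LinearMap.det (congrUpper (diagonal D))| = |(diagonal D).det| ^ (p + 1) := by
  rw [congrUpper_diagonal, LinearMap.det_toLin', det_diagonal, det_diagonal, ← abs_pow]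
  exact (sq_eq_sq_iff_abs_eq_abs _ _).1 (prod_upper_sq D)

theorem det_congrUpper_ne_zero {p : ℕ} {B : Matrix (Fin p) (Fin p) ℝ} (hB : B.det ≠ 0) :
    LinearMap.det (congrUpper B) ≠ 0 := by
  intro h
  have := det_congrUpper_mul B B⁻¹
  rw [Matrix.mul_nonsing_inv _ (isUnit_iff_ne_zero.2 hB), congrUpper_one, h] at this
  simp at this

/-- Conjugating a transvection `T` by the diagonal matrix that doubles coordinate `i` gives `T²`.
The determinant of the congruence is multiplicative and nonzero, so its value at `T` equals its own
square and is `1`. -/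
theorem det_congrUpper_transvection {p : ℕ} {i j : Fin p} (hij : i ≠ j) (c : ℝ) :
    LinearMap.det (congrUpper (transvection i j c)) = 1 := by
  let D : Fin p → ℝ := Function.update 1 i 2
  have hD : (diagonal D).det ≠ 0 := by
    rw [det_diagonal]
    refine Finset.prod_ne_zero_iff.2 fun k _ => ?_
    by_cases hk : k = i
    · subst hk; simp [D]
    · simp [D, hk]
  have hcomm : diagonal D * transvection i j c =
      transvection i j c * transvection i j c * diagonal D := by
    rw [transvection_mul_transvection_same i j hij]
    ext a b
    simp only [Matrix.diagonal_mul, Matrix.mul_diagonal, transvection, Matrix.add_apply,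
      Matrix.one_apply, Matrix.single_apply, D]
    by_cases ha : i = a <;> by_cases hb : j = b
    · subst ha hb; simp [hij, hij.symm]; ring
    · subst ha
      by_cases hab : i = b
      · subst hab; simp [hb]
      · simp [hb, hab]
    · subst hb
      by_cases hab : a = j
      · subst hab; simp [ha, Ne.symm ha]
      · simp [ha, hab]
    · by_cases hab : a = b
      · subst hab; simp [ha, hb]
      · simp [ha, hb, hab]
  have h := congrArg (fun M => LinearMap.det (congrUpper M)) hcomm
  simp only [det_congrUpper_mul] at h
  have h1 := det_congrUpper_ne_zero hD
  have h2 := det_congrUpper_ne_zero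
    (show (transvection i j c).det ≠ 0 by rw [det_transvection_of_ne i j hij]; exact one_ne_zero)
  rw [mul_comm] at h
  have h3 := mul_right_cancel₀ h1 h
  exact (mul_eq_left₀ h2).1 h3.symm

/-- The determinant of `s ↦ B s B'` on the symmetric `p × p` matrices is `|B|^(p+1)`, up to
sign. -/
theorem abs_det_congrUpper {p : ℕ} {B : Matrix (Fin p) (Fin p) ℝ} (hB : B.det ≠ 0) :
    |LinearMap.det (congrUpper B)| = |B.det| ^ (p + 1) := by
  -- Both sides are multiplicative, and invertible matrices are products of diagonal matrices and
  -- transvections.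
  refine diagonal_transvection_induction_of_det_ne_zero
    (fun B => |LinearMap.det (congrUpper B)| = |B.det| ^ (p + 1)) B hB
    (fun D _ => abs_det_congrUpper_diagonal D) (fun t => ?_) fun A B _ _ hA hB => ?_
  · rw [TransvectionStruct.toMatrix, det_congrUpper_transvection t.hij,
      det_transvection_of_ne _ _ t.hij]
    simp
  · rw [det_congrUpper_mul, abs_mul, hA, hB, det_mul, abs_mul, mul_pow]

theorem symLebesgue_map_congr {p : ℕ} {B : Matrix (Fin p) (Fin p) ℝ} (hB : B.det ≠ 0) :
    (symLebesgue p).map (fun s => B * s * Bᵀ) =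
      ENNReal.ofReal (|B.det| ^ (p + 1))⁻¹ • symLebesgue p := by
  have hm : Measurable (congrUpper B) :=
    (LinearMap.continuous_on_pi (congrUpper B)).measurable
  have e : (fun s => B * s * Bᵀ) ∘ symOfUpper = symOfUpper ∘ congrUpper B := by
    funext x; simp [symOfUpper_congrUpper]
  rw [symLebesgue_eq, Measure.map_map (by fun_prop) (measurable_symOfUpper p), e,
    ← Measure.map_map (measurable_symOfUpper p) hm,
    Real.map_linearMap_volume_pi_eq_smul_volume_pi (det_congrUpper_ne_zero hB), Measure.map_smul,
    abs_inv, abs_det_congrUpper hB]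

/-- Change of variables `s = B u B'` in integrals over the symmetric matrices. -/
theorem lintegral_symLebesgue_congr {p : ℕ} {B : Matrix (Fin p) (Fin p) ℝ} (hB : B.det ≠ 0)
    {f : Matrix (Fin p) (Fin p) ℝ → ENNReal} (hf : Measurable f) :
    ∫⁻ s, f s ∂(symLebesgue p) =
      ENNReal.ofReal (|B.det| ^ (p + 1)) * ∫⁻ u, f (B * u * Bᵀ) ∂(symLebesgue p) := by
  have hpos : 0 < |B.det| ^ (p + 1) := by positivity
  rw [← lintegral_map (g := fun u => B * u * Bᵀ) hf (by fun_prop), symLebesgue_map_congr hB, lintegral_smul_measure,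
    smul_eq_mul, ← mul_assoc, ← ENNReal.ofReal_mul hpos.le, mul_inv_cancel₀ hpos.ne',
    ENNReal.ofReal_one, one_mul]

end SymmetricMatrices

/-! ### The inverted Wishart integral as a function of its scale matrix. -/

section InvertedWishartIntegral

/-- The unnormalized density `|s|^{-a} etr(-½ C s⁻¹)`. -/
def wishartKernel {p : ℕ} (a : ℝ) (C s : Matrix (Fin p) (Fin p) ℝ) : ENNReal :=
  ENNReal.ofReal (s.det ^ (-a) * Real.exp (-(1 / 2) * (C * s⁻¹).trace))

theorem measurable_wishartKernel_right {p : ℕ} (a : ℝ) (C : Matrix (Fin p) (Fin p) ℝ) :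
    Measurable (wishartKernel a C) := by
  unfold wishartKernel
  fun_prop

/-- Lebesgue measure on the positive definite matrices. -/
def posDefLebesgue (p : ℕ) : Measure (Matrix (Fin p) (Fin p) ℝ) :=
  (symLebesgue p).restrict {s | s.PosDef}

instance sFinite_posDefLebesgue (p : ℕ) : SFinite (posDefLebesgue p) := by
  unfold posDefLebesgue; infer_instance

theorem ae_posDef_posDefLebesgue (p : ℕ) : ∀ᵐ s ∂(posDefLebesgue p), s.PosDef :=
  ae_restrict_mem (measurableSet_posDef p)

theorem posDef_mul_mul_transpose_iff {p : ℕ} {B u : Matrix (Fin p) (Fin p) ℝ}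
    (hB : B.det ≠ 0) : (B * u * Bᵀ).PosDef ↔ u.PosDef := by
  have := IsUnit.posDef_star_right_conjugate_iff (x := u)
    ((Matrix.isUnit_iff_isUnit_det B).2 (isUnit_iff_ne_zero.2 hB))
  simpa [star_eq_conjTranspose] using this

/-- Substitute `s = B u B'` with `C = B B'`: the trace becomes `tr u⁻¹`, the determinant gives
`|C|^{-a}` and the Jacobian `|C|^{(p+1)/2}`. The remaining integral depends only on `a` and `p`;
neither its value nor its finiteness matters. -/
theorem lintegral_wishartKernel {p : ℕ} (a : ℝ) {C : Matrix (Fin p) (Fin p) ℝ} (hC : C.PosDef) :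
    ∫⁻ s, wishartKernel a C s ∂(posDefLebesgue p) =
      ENNReal.ofReal (C.det ^ ((p + 1) / 2 - a : ℝ)) *
        ∫⁻ s, wishartKernel a 1 s ∂(posDefLebesgue p) := by
  obtain ⟨B', hB', hBdet', hBabs'⟩ := hC.exists_eq_transpose_mul_self
  obtain ⟨B, hB, hBdet, hBabs⟩ : ∃ B : Matrix (Fin p) (Fin p) ℝ, C = B * Bᵀ ∧ B.det ≠ 0 ∧
      |B.det| = C.det ^ (1 / 2 : ℝ) :=
    ⟨B'ᵀ, by simpa using hB', by simpa using hBdet', by simpa using hBabs'⟩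
  have hBu : IsUnit B.det := isUnit_iff_ne_zero.2 hBdet
  have hCpos := hC.det_pos
  have hms := measurableSet_posDef p
  simp only [posDefLebesgue]
  rw [← lintegral_indicator hms, ← lintegral_indicator hms, lintegral_symLebesgue_congr hBdet
    ((measurable_wishartKernel_right a C).indicator hms), ← lintegral_const_mul _
      ((measurable_wishartKernel_right a 1).indicator hms), ← lintegral_const_mul
      (f := fun u => {s : Matrix (Fin p) (Fin p) ℝ | s.PosDef}.indicator (wishartKernel a C)
        (B * u * Bᵀ)) _ ((((measurable_wishartKernel_right a C).indicator hms).comp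
        (show Measurable fun u => B * u * Bᵀ by fun_prop)))]
  refine lintegral_congr fun u => ?_
  by_cases hu : u.PosDef
  · have hu' : (B * u * Bᵀ).PosDef := (posDef_mul_mul_transpose_iff hBdet).2 hu
    rw [Set.indicator_of_mem (show B * u * Bᵀ ∈ {s | s.PosDef} from hu'),
      Set.indicator_of_mem (show u ∈ {s | s.PosDef} from hu), wishartKernel, wishartKernel,
      ← ENNReal.ofReal_mul (by positivity), ← ENNReal.ofReal_mul (Real.rpow_nonneg hCpos.le _)]
    have htr : (C * (B * u * Bᵀ)⁻¹).trace = (1 * u⁻¹).trace := by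
      rw [Matrix.mul_inv_rev, Matrix.mul_inv_rev, hB]
      have : B * Bᵀ * (Bᵀ⁻¹ * (u⁻¹ * B⁻¹)) = B * ((Bᵀ * Bᵀ⁻¹) * (u⁻¹ * B⁻¹)) := by
        simp only [Matrix.mul_assoc]
      rw [this, Matrix.mul_nonsing_inv _ (by simpa using hBu), Matrix.trace_mul_comm, Matrix.one_mul,
        Matrix.mul_assoc, Matrix.nonsing_inv_mul _ hBu, Matrix.mul_one, Matrix.one_mul]
    have hdet : (B * u * Bᵀ).det = C.det * u.det := by
      rw [hB]; simp only [det_mul, det_transpose]; ring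
    rw [htr, hdet, Real.mul_rpow hCpos.le hu.det_pos.le, hBabs, ← Real.rpow_natCast,
      ← Real.rpow_mul hCpos.le, ← mul_assoc, ← mul_assoc, ← mul_assoc, ← Real.rpow_add hCpos]
    congr 4
    push_cast
    ring
  · have hu' : ¬ (B * u * Bᵀ).PosDef := fun h => hu ((posDef_mul_mul_transpose_iff hBdet).1 h)
    rw [Set.indicator_of_notMem (show B * u * Bᵀ ∉ {s | s.PosDef} from hu'),
      Set.indicator_of_notMem (show u ∉ {s | s.PosDef} from hu), mul_zero, mul_zero]

end InvertedWishartIntegral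

/-! ### Disintegration, Bayes' formula and conditional independence. -/

section ConditionalLaws

variable {Ω α β γ : Type*} [MeasurableSpace Ω] [MeasurableSpace α] [MeasurableSpace β]
  [MeasurableSpace γ]

theorem HasCondLaw.congr [StandardBorelSpace α] [Nonempty α] {X : Ω → α} {Y : Ω → β}
    {κ κ' : β → Measure α} {μ : Measure Ω} [IsFiniteMeasure μ] (h : HasCondLaw X Y κ μ)
    (hκ : ∀ᵐ b ∂(μ.map Y), κ b = κ' b) : HasCondLaw X Y κ' μ := by
  filter_upwards [h, hκ] with b h1 h2 using h1.trans h2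

theorem compProd_map_param (η : Measure β) [SFinite η] (E : Kernel β α) [IsSFiniteKernel E]
    {φ : β → α → γ} (hφ : Measurable (Function.uncurry φ)) :
    (η ⊗ₘ E).map (fun x => (x.1, φ x.1 x.2)) =
      η ⊗ₘ ((Kernel.id ×ₖ E).map (Function.uncurry φ)) := by
  have hm : Measurable fun x : β × α => (x.1, φ x.1 x.2) := measurable_fst.prodMk hφ
  ext A hA
  rw [Measure.map_apply hm hA, Measure.compProd_apply (hm hA), Measure.compProd_apply hA]
  refine lintegral_congr fun b => ?_
  have hb : Measurable (Prod.mk b : γ → β × γ) := measurable_prodMk_left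
  rw [Kernel.map_apply' _ hφ _ (hb hA), Kernel.prod_apply, Kernel.id_apply,
    Measure.prod_apply (hφ (hb hA)), lintegral_dirac' _
      (measurable_measure_prodMk_left (hφ (hb hA)))]
  rfl

theorem id_prod_map_apply (E : Kernel β α) [IsSFiniteKernel E]
    {φ : β → α → γ} (hφ : Measurable (Function.uncurry φ)) (b : β) :
    ((Kernel.id ×ₖ E).map (Function.uncurry φ)) b = (E b).map (φ b) := by
  have hb : Measurable (φ b) := hφ.comp measurable_prodMk_left
  ext A hA
  rw [Kernel.map_apply' _ hφ _ hA, Kernel.prod_apply, Kernel.id_apply,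
    Measure.prod_apply (hφ hA), lintegral_dirac' _ (measurable_measure_prodMk_left (hφ hA)),
    Measure.map_apply hb hA]
  rfl

/-- If `E` disintegrates the joint law of `(Y, X)`, then the conditional law of a function of `Y`
and `X` given `Y` is an image of `E`. -/
theorem hasCondLaw_of_map_eq_compProd [StandardBorelSpace γ] [Nonempty γ] {μ : Measure Ω}
    [IsFiniteMeasure μ] {X : Ω → α} {Y : Ω → β} (hX : Measurable X) (hY : Measurable Y)
    {E : Kernel β α} [IsFiniteKernel E]
    (h : μ.map (fun w => (Y w, X w)) = μ.map Y ⊗ₘ E)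
    {φ : β → α → γ} (hφ : Measurable (Function.uncurry φ)) :
    HasCondLaw (fun w => φ (Y w) (X w)) Y (fun b => (E b).map (φ b)) μ := by
  have hm : Measurable fun w => φ (Y w) (X w) := hφ.comp (hY.prodMk hX)
  have hm2 : Measurable fun x : β × α => (x.1, φ x.1 x.2) := measurable_fst.prodMk hφ
  have := compProd_map_param (μ.map Y) E hφ
  rw [← h, Measure.map_map hm2 (hY.prodMk hX)] at this
  have h2 := condDistrib_ae_eq_of_measure_eq_compProd Y hm.aemeasurable this
  filter_upwards [h2] with b hb
  rw [hb, id_prod_map_apply E hφ]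

/-- Bayes' formula for a joint density with respect to a product measure. -/
theorem exists_kernel_normalized_withDensity {b : Measure β} [SFinite b] {l : Measure α}
    [SFinite l] {q : β → α → ENNReal} (hq : Measurable (Function.uncurry q))
    {ν : Measure (β × α)} [IsProbabilityMeasure ν]
    (hν : ν = (b.prod l).withDensity (Function.uncurry q)) :
    ∃ K : Kernel β α, IsFiniteKernel K ∧ ν = ν.map Prod.fst ⊗ₘ K ∧
      ∀ᵐ h ∂(ν.map Prod.fst), K h = normalized (l.withDensity (q h)) ∧
        IsProbabilityMeasure (K h) := by
  let Z : β → ENNReal := fun h => ∫⁻ s, q h s ∂l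
  have hZ : Measurable Z := hq.lintegral_prod_right'
  have hqh : ∀ h, Measurable (q h) := fun h => hq.comp measurable_prodMk_left
  have hm : Measurable (Function.uncurry fun h s => (Z h)⁻¹ * q h s) :=
    (measurable_inv.comp (hZ.comp measurable_fst)).mul hq
  let K : Kernel β α := Kernel.withDensity (Kernel.const β l) fun h s => (Z h)⁻¹ * q h s
  have hK : ∀ h, K h = (Z h)⁻¹ • l.withDensity (q h) := by
    intro h
    have e : (fun s => (Z h)⁻¹ * q h s) = (Z h)⁻¹ • q h := by
      funext s; rw [Pi.smul_apply, smul_eq_mul]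
    rw [Kernel.withDensity_apply _ hm, Kernel.const_apply, e, withDensity_smul _ (hqh h)]
  have huniv : ∀ h, l.withDensity (q h) Set.univ = Z h := fun h => by
    rw [withDensity_apply _ MeasurableSet.univ, Measure.restrict_univ]
  -- In the extended reals `Z⁻¹ * Z ≤ 1` also for `Z = 0` and `Z = ∞`, so `K` is a finite kernel
  -- everywhere although its mass is one only almost everywhere.
  have hfin : IsFiniteKernel K := ⟨1, ENNReal.one_lt_top, fun h => by
    rw [hK, Measure.smul_apply, huniv, smul_eq_mul]; exact ENNReal.inv_mul_le_one _⟩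
  have hfst : ν.map Prod.fst = b.withDensity Z := by
    ext A hA
    rw [Measure.map_apply measurable_fst hA, hν, withDensity_apply _ (measurable_fst hA),
      withDensity_apply _ hA, ← lintegral_indicator (measurable_fst hA), lintegral_prod _
        (hq.indicator (measurable_fst hA)).aemeasurable, ← lintegral_indicator hA]
    refine lintegral_congr fun h => ?_
    by_cases hh : h ∈ A
    · simp only [Set.indicator_of_mem hh, Z]
      exact lintegral_congr fun s => Set.indicator_of_mem (s := Prod.fst ⁻¹' A) hh _
    · rw [Set.indicator_of_notMem hh]
      exact (lintegral_congr fun s =>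
        Set.indicator_of_notMem (s := Prod.fst ⁻¹' A) hh _).trans lintegral_zero
  have hfstprob : IsProbabilityMeasure (ν.map Prod.fst) :=
    Measure.isProbabilityMeasure_map measurable_fst.aemeasurable
  have hZint : ∫⁻ h, Z h ∂b = 1 := by
    have := hfstprob.measure_univ
    rwa [hfst, withDensity_apply _ MeasurableSet.univ, Measure.restrict_univ] at this
  have hZtop : ∀ᵐ h ∂b, Z h < ⊤ := ae_lt_top hZ (by rw [hZint]; exact ENNReal.one_ne_top)
  refine ⟨K, hfin, ?_, ?_⟩
  · ext A hA
    rw [Measure.compProd_apply hA, hfst, lintegral_withDensity_eq_lintegral_mul _ hZ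
      (Kernel.measurable_kernel_prodMk_left hA), hν, withDensity_apply _ hA,
      ← lintegral_indicator hA, lintegral_prod _ (hq.indicator hA).aemeasurable]
    refine lintegral_congr_ae ?_
    filter_upwards [hZtop] with h hh
    have hAh : MeasurableSet (Prod.mk h ⁻¹' A) := measurable_prodMk_left hA
    have e1 : ∫⁻ s, A.indicator (Function.uncurry q) (h, s) ∂l =
        l.withDensity (q h) (Prod.mk h ⁻¹' A) := by
      rw [withDensity_apply _ hAh, ← lintegral_indicator hAh]
      rfl
    rw [e1, Pi.mul_apply, hK, Measure.smul_apply, smul_eq_mul, ← mul_assoc]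
    by_cases h0 : Z h = 0
    · rw [h0, zero_mul, zero_mul]
      refine measure_mono_null (Set.subset_univ _) ?_
      rw [huniv, h0]
    · rw [ENNReal.mul_inv_cancel h0 hh.ne, one_mul]
  -- The marginal has density `Z` with total integral one, so histories with `Z = 0` or `Z = ∞` form
  -- a null set.
  · rw [hfst, ae_withDensity_iff hZ]
    filter_upwards [hZtop] with h hh h0
    refine ⟨by rw [hK, normalized, huniv], ⟨?_⟩⟩
    rw [hK, Measure.smul_apply, huniv, smul_eq_mul, ENNReal.inv_mul_cancel h0 hh.ne]

/-- If, given `S`, the variables `Y` and `X` are independent with laws `η` and `G`, and `K` is the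
conditional law of `S` given `Y`, then `S, X` given `Y` have the joint law `K ⊗ G`. -/
theorem map_eq_compProd_of_condIndep {μ : Measure Ω} [IsFiniteMeasure μ] {S : Ω → α} {Y : Ω → β}
    {X : Ω → γ} (hS : Measurable S) (hY : Measurable Y) (hX : Measurable X)
    {η : Kernel α β} [IsMarkovKernel η] {G : Kernel α γ} [IsMarkovKernel G]
    (h : μ.map (fun w => (S w, (Y w, X w))) = μ.map S ⊗ₘ (η ×ₖ G)) :
    μ.map (fun w => ((S w, Y w), X w)) =
      μ.map (fun w => (S w, Y w)) ⊗ₘ (Kernel.comap G Prod.fst measurable_fst) := by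
  have h1 : μ.map (fun w => (S w, Y w)) = μ.map S ⊗ₘ η := by
    have := congrArg (Measure.map fun x : α × β × γ => (x.1, x.2.1)) h
    rw [Measure.map_map (by fun_prop) (by fun_prop)] at this
    refine this.trans ?_
    ext A hA
    rw [Measure.map_apply (by fun_prop) hA, Measure.compProd_apply hA,
      Measure.compProd_apply ((show Measurable fun x : α × β × γ => (x.1, x.2.1) by fun_prop) hA)]
    refine lintegral_congr fun s => ?_
    have hs : MeasurableSet (Prod.mk s ⁻¹' A) := measurable_prodMk_left hA
    have e : Prod.mk s ⁻¹' ((fun x : α × β × γ => (x.1, x.2.1)) ⁻¹' A) =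
        (Prod.mk s ⁻¹' A) ×ˢ Set.univ := by ext; simp
    rw [Kernel.prod_apply, e, Measure.prod_prod, measure_univ, mul_one]
  have h2 : μ.map (fun w => ((S w, Y w), X w)) =
      (μ.map fun w => (S w, (Y w, X w))).map MeasurableEquiv.prodAssoc.symm := by
    rw [Measure.map_map (by fun_prop) (by fun_prop)]
    rfl
  rw [h2, h, h1]
  ext A hA
  rw [Measure.map_apply (by fun_prop) hA, Measure.compProd_apply (MeasurableEquiv.measurable _ hA),
    Measure.compProd_apply hA, Measure.lintegral_compProd
      (Kernel.measurable_kernel_prodMk_left hA)]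
  refine lintegral_congr fun s => ?_
  have hs : Measurable fun x : β × γ => ((s, x.1), x.2) := by fun_prop
  have e : Prod.mk s ⁻¹' (MeasurableEquiv.prodAssoc.symm ⁻¹' A) =
      (fun x : β × γ => ((s, x.1), x.2)) ⁻¹' A := rfl
  rw [Kernel.prod_apply, e, Measure.prod_apply (hs hA)]
  rfl

/-- Given `(S, Y)`, the law of `X` is `G S`, with no dependence on `Y`. Hence, given `Y`, one may
draw `S` from its posterior and then `X` from `G`. -/
theorem map_eq_compProd_of_condIndep_of_posterior {μ : Measure Ω} [IsFiniteMeasure μ]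
    {S : Ω → α} {Y : Ω → β}
    {X : Ω → γ} (hS : Measurable S) (hY : Measurable Y) (hX : Measurable X)
    {η : Kernel α β} [IsMarkovKernel η] {G : Kernel α γ} [IsMarkovKernel G]
    {K : Kernel β α} [IsFiniteKernel K]
    (h : μ.map (fun w => (S w, (Y w, X w))) = μ.map S ⊗ₘ (η ×ₖ G))
    (hK : μ.map (fun w => (Y w, S w)) = μ.map Y ⊗ₘ K) :
    μ.map (fun w => (Y w, (S w, X w))) =
      μ.map Y ⊗ₘ (K ⊗ₖ (Kernel.comap G Prod.snd measurable_snd)) := by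
  have h1 := map_eq_compProd_of_condIndep hS hY hX h
  have hsw : μ.map (fun w => (S w, Y w)) = (μ.map (fun w => (Y w, S w))).map Prod.swap := by
    rw [Measure.map_map (by fun_prop) (by fun_prop)]
    rfl
  have hm : Measurable fun x : (α × β) × γ => (x.1.2, (x.1.1, x.2)) := by fun_prop
  have h2 : μ.map (fun w => (Y w, (S w, X w))) =
      (μ.map fun w => ((S w, Y w), X w)).map fun x => (x.1.2, (x.1.1, x.2)) := by
    rw [Measure.map_map hm (by fun_prop)]
    rfl
  rw [h2, h1, hsw, hK]
  ext A hA
  rw [Measure.map_apply hm hA, Measure.compProd_apply (hm hA), Measure.compProd_apply hA,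
    lintegral_map (Kernel.measurable_kernel_prodMk_left (hm hA)) measurable_swap]
  refine (Measure.lintegral_compProd ((Kernel.measurable_kernel_prodMk_left (hm hA)).comp
    measurable_swap)).trans (lintegral_congr fun y => ?_)
  rw [Kernel.compProd_apply (measurable_prodMk_left hA)]
  rfl

end ConditionalLaws

/-! ### Normalization of measures. -/

section Normalized

/-- Total mass one forces the factor, so a density needs to be known only up to a constant. -/
theorem normalized_eq_self_of_eq_smul {α : Type*} [MeasurableSpace α] {μ ν : Measure α}
    [IsProbabilityMeasure ν] {c : ENNReal} (h : ν = c • μ) : normalized μ = ν := by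
  have h1 : c * μ Set.univ = 1 := by
    have := measure_univ (μ := ν)
    rwa [h, Measure.smul_apply, smul_eq_mul] at this
  rw [normalized, h, ← ENNReal.eq_inv_of_mul_eq_one_left h1]

end Normalized

/-! ### Conjugacy of the modified inverted Wishart law, and the matrix `t` marginal. -/

section ModifiedInvertedWishart

/-- Conjugacy: as functions of `s`, prior and likelihood have the same form, so the powers of `|s|`
and the trace exponents add. -/
theorem wishartKernel_mul_matrixNormalKernel {r p : ℕ} (a : ℝ) (C : Matrix (Fin p) (Fin p) ℝ)
    (Q : Matrix (Fin r) (Fin r) ℝ) {s : Matrix (Fin p) (Fin p) ℝ} (hs : s.PosDef)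
    (Y : Matrix (Fin r) (Fin p) ℝ) :
    wishartKernel a C s * matrixNormalKernel Q s Y =
      wishartKernel (a + r / 2) (C + Yᵀ * Q⁻¹ * Y) s := by
  have hd := hs.det_pos
  rw [wishartKernel, wishartKernel, matrixNormalKernel, ← ENNReal.ofReal_mul (by positivity),
    mul_mul_mul_comm, ← Real.rpow_add hd, ← Real.exp_add, Matrix.add_mul, Matrix.trace_add]
  congr 3
  · ring
  · ring

theorem MIW_eq {p : ℕ} (S N : Matrix (Fin p) (Fin p) ℝ) (v : ℝ) :
    MIW S N v = normalized ((posDefLebesgue p).withDensity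
      (wishartKernel (v + N.trace / (2 * p)) (sqrtDiag N * S * sqrtDiag N))) := rfl

instance sFinite_MIW {p : ℕ} (S N : Matrix (Fin p) (Fin p) ℝ) (v : ℝ) : SFinite (MIW S N v) := by
  rw [MIW_eq, normalized]; infer_instance

theorem ae_posDef_MIW {p : ℕ} (S N : Matrix (Fin p) (Fin p) ℝ) (v : ℝ) :
    ∀ᵐ s ∂(MIW S N v), s.PosDef := by
  rw [MIW_eq, normalized]
  exact Measure.ae_smul_measure
    ((withDensity_absolutelyContinuous _ _).ae_le (ae_posDef_posDefLebesgue p)) _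

theorem posDef_sqrtDiag {p : ℕ} {N : Matrix (Fin p) (Fin p) ℝ} (hN : ∀ i, 0 < N i i) :
    (sqrtDiag N).PosDef :=
  PosDef.diagonal fun i => Real.sqrt_pos.2 (hN i)

theorem posDef_sqrtDiag_mul_mul {p : ℕ} {S N : Matrix (Fin p) (Fin p) ℝ} (hS : S.PosDef)
    (hN : ∀ i, 0 < N i i) : (sqrtDiag N * S * sqrtDiag N).PosDef := by
  have h := (posDef_mul_mul_transpose_iff (u := S) (posDef_sqrtDiag hN).det_pos.ne').2 hS
  rwa [sqrtDiag, Matrix.diagonal_transpose, ← sqrtDiag] at h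

/-- A bind is meaningful only along an almost everywhere measurable family. The normal laws are
controlled only at positive definite `s`, and almost everywhere agreement with a genuine kernel
suffices. -/
theorem bind_matrixNormal_eq {r p : ℕ} {γ : Type*} [MeasurableSpace γ]
    {P : Matrix (Fin r) (Fin r) ℝ} {π : Measure (Matrix (Fin p) (Fin p) ℝ)} [SFinite π]
    (hπ : ∀ᵐ s ∂π, s.PosDef)
    {G : Kernel (Matrix (Fin p) (Fin p) ℝ) (Matrix (Fin r) (Fin p) ℝ)} [IsMarkovKernel G]
    (hG : ∀ s, s.PosDef → G s = matrixNormal 0 P s)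
    {κ : Matrix (Fin p) (Fin p) ℝ → Measure γ}
    {φ : Matrix (Fin p) (Fin p) ℝ × Matrix (Fin r) (Fin p) ℝ → γ} (hφ : Measurable φ)
    (hκ : ∀ s, s.PosDef → κ s = (matrixNormal 0 P s).map fun z => φ (s, z)) :
    π.bind κ = (π ⊗ₘ G).map φ := by
  have e : κ =ᵐ[π] ((Kernel.id ×ₖ G).map φ) := by
    filter_upwards [hπ] with s hs
    rw [hκ s hs, ← hG s hs]
    exact (id_prod_map_apply G (φ := fun s z => φ (s, z)) hφ s).symm
  rw [Measure.bind_congr_right e, Measure.compProd_eq_comp_prod, Measure.map_comp _ _ hφ]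

theorem NMIW_eq {r p : ℕ} (m : Matrix (Fin r) (Fin p) ℝ) {P : Matrix (Fin r) (Fin r) ℝ}
    (hP : P.PosSemidef) (S N : Matrix (Fin p) (Fin p) ℝ) (v : ℝ)
    {G : Kernel (Matrix (Fin p) (Fin p) ℝ) (Matrix (Fin r) (Fin p) ℝ)} [IsMarkovKernel G]
    (hG : ∀ s, s.PosDef → G s = matrixNormal 0 P s) :
    NMIW m P S N v = (MIW S N v ⊗ₘ G).map fun x => (m + x.2, x.1) := by
  refine bind_matrixNormal_eq (ae_posDef_MIW S N v) hG (by fun_prop) fun s hs => ?_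
  rw [← matrixNormal_map_const_add m hP hs.posSemidef, Measure.map_map (by fun_prop) (by fun_prop)]
  rfl

/-- The first marginal of a normal modified inverted Wishart law is a modified matrix `t` law. -/
theorem NMIW_map_fst {r p : ℕ} (f : Matrix (Fin r) (Fin p) ℝ) {Q : Matrix (Fin r) (Fin r) ℝ}
    (hQ : Q.PosDef) {S N : Matrix (Fin p) (Fin p) ℝ} (hS : S.PosDef) (hN : ∀ i, 0 < N i i) (v : ℝ)
    [hprob : IsProbabilityMeasure (MIW S N v)] :
    (NMIW f Q S N v).map Prod.fst = MT f Q S N v := by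
  obtain ⟨G, hGm, hG⟩ := exists_kernel_matrixNormal (p := p) hQ.posSemidef
  obtain ⟨K, -, hK⟩ := exists_matrixNormal_eq_withDensity (p := p) hQ
  set C := sqrtDiag N * S * sqrtDiag N with hC
  have hCpd : C.PosDef := posDef_sqrtDiag_mul_mul hS hN
  set a : ℝ := v + N.trace / (2 * p) with ha
  rw [NMIW_eq f hQ.posSemidef S N v hG, Measure.map_map measurable_fst (by fun_prop)]
  have hm : Measurable fun x : Matrix (Fin p) (Fin p) ℝ × Matrix (Fin r) (Fin p) ℝ => f + x.2 := by
    fun_prop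
  have hpr : IsProbabilityMeasure ((MIW S N v ⊗ₘ G).map fun x => f + x.2) :=
    Measure.isProbabilityMeasure_map hm.aemeasurable
  let Z := ((posDefLebesgue p).withDensity (wishartKernel a C)) Set.univ
  let I := ∫⁻ s, wishartKernel (a + r / 2) 1 s ∂(posDefLebesgue p)
  let g : Matrix (Fin r) (Fin p) ℝ → ENNReal := fun Y => ENNReal.ofReal
    ((C + (Y - f)ᵀ * Q⁻¹ * (Y - f)).det ^ (-(2 * v + N.trace / p + r - p - 1) / 2))
  have hg : Measurable g := by
    refine Measurable.ennreal_ofReal (Measurable.pow_const (Measurable.matrix_det ?_) _)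
    fun_prop
  -- Only proportionality to the `t` density is needed, because the left side is a probability
  -- measure.
  have key : (MIW S N v ⊗ₘ G).map (fun x => f + x.2) =
      (Z⁻¹ * K * I) • (matrixVolume r p).withDensity g := by
    ext A hA
    have hw : Measurable fun x : Matrix (Fin p) (Fin p) ℝ × Matrix (Fin r) (Fin p) ℝ =>
        wishartKernel (a + r / 2) (C + x.2ᵀ * Q⁻¹ * x.2) x.1 := by
      unfold wishartKernel
      fun_prop
    have hf : Measurable fun z : Matrix (Fin r) (Fin p) ℝ => f + z := by fun_prop
    have hfA := hf hA
    have hgf : Measurable fun z => g (f + z) := hg.comp hf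
    have hGA : Measurable fun s => G s ((fun z => f + z) ⁻¹' A) := Kernel.measurable_coe G hfA
    have h1 : ∀ s, s.PosDef → wishartKernel a C s * G s ((fun z => f + z) ⁻¹' A) =
        K * ∫⁻ z, ((fun z => f + z) ⁻¹' A).indicator
          (fun z => wishartKernel (a + r / 2) (C + zᵀ * Q⁻¹ * z) s) z ∂(matrixVolume r p) := by
      intro s hs
      rw [hG s hs, hK s hs, Measure.smul_apply, smul_eq_mul, withDensity_apply _ hfA,
        mul_left_comm, ← lintegral_const_mul _ (measurable_matrixNormalKernel_right Q s),
        lintegral_indicator hfA]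
      simp only [wishartKernel_mul_matrixNormalKernel a C Q hs]
    have h2 : ∀ z : Matrix (Fin r) (Fin p) ℝ,
        ∫⁻ s, wishartKernel (a + r / 2) (C + zᵀ * Q⁻¹ * z) s ∂(posDefLebesgue p) =
          g (f + z) * I := by
      intro z
      have hz : (zᵀ * Q⁻¹ * z).PosSemidef := by
        simpa using hQ.inv.posSemidef.conjTranspose_mul_mul_same z
      rw [lintegral_wishartKernel _ (hCpd.add_posSemidef hz)]
      simp only [g, add_sub_cancel_left]
      congr 3
      -- The two exponents agree: `(p+1)/2 - (v + tr N/(2p) + r/2) = -(2v + tr N/p + r - p - 1)/2`.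
      rw [ha]
      ring
    calc ((MIW S N v ⊗ₘ G).map fun x => f + x.2) A
        = ∫⁻ s, G s ((fun z => f + z) ⁻¹' A) ∂(MIW S N v) := by
          rw [Measure.map_apply hm hA, Measure.compProd_apply (hm hA)]
          rfl
      _ = Z⁻¹ * ∫⁻ s, wishartKernel a C s * G s ((fun z => f + z) ⁻¹' A) ∂(posDefLebesgue p) := by
          rw [MIW_eq, normalized, lintegral_smul_measure, smul_eq_mul,
            lintegral_withDensity_eq_lintegral_mul _ (measurable_wishartKernel_right a C) hGA]
          rfl
      _ = Z⁻¹ * ∫⁻ s, K * ∫⁻ z, ((fun z => f + z) ⁻¹' A).indicator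
          (fun z => wishartKernel (a + r / 2) (C + zᵀ * Q⁻¹ * z) s) z ∂(matrixVolume r p)
            ∂(posDefLebesgue p) := by
          congr 1
          refine lintegral_congr_ae ?_
          filter_upwards [ae_posDef_posDefLebesgue p] with s hs using h1 s hs
      -- Tonelli: integrating over `s` first leaves an inverted Wishart integral with scale `C + z'
      -- Q⁻¹ z`.
      _ = Z⁻¹ * (K * ∫⁻ z, ∫⁻ s, ((fun z => f + z) ⁻¹' A).indicator
          (fun z => wishartKernel (a + r / 2) (C + zᵀ * Q⁻¹ * z) s) z ∂(posDefLebesgue p)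
            ∂(matrixVolume r p)) := by
          have hind : Measurable (Function.uncurry fun (s : Matrix (Fin p) (Fin p) ℝ)
              (z : Matrix (Fin r) (Fin p) ℝ) => ((fun z => f + z) ⁻¹' A).indicator
                (fun z => wishartKernel (a + r / 2) (C + zᵀ * Q⁻¹ * z) s) z) :=
            hw.indicator (measurable_snd hfA)
          congr 1
          exact (lintegral_const_mul _ hind.lintegral_prod_right').trans
            (congrArg _ (lintegral_lintegral_swap hind.aemeasurable))
      _ = Z⁻¹ * (K * ∫⁻ z, ((fun z => f + z) ⁻¹' A).indicator (fun z => g (f + z) * I) z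
            ∂(matrixVolume r p)) := by
          congr 2
          refine lintegral_congr fun z => ?_
          by_cases hz : z ∈ (fun z => f + z) ⁻¹' A
          · simp only [Set.indicator_of_mem hz, h2 z]
          · simp only [Set.indicator_of_notMem hz, lintegral_zero]
      _ = Z⁻¹ * (K * ((∫⁻ Y in A, g Y ∂(matrixVolume r p)) * I)) := by
          rw [lintegral_indicator hfA, lintegral_mul_const _ hgf,
            ← setLIntegral_map hA hg hf, matrixVolume_map_const_add]
      _ = _ := by
          rw [Measure.smul_apply, withDensity_apply _ hA, smul_eq_mul]
          ring
  exact (normalized_eq_self_of_eq_smul key).symm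

end ModifiedInvertedWishart

/-! ### Independence through resampling. -/

section Resampling

/-- Resampling one coordinate of a product of probability measures does not change the law. -/
theorem measurePreserving_update {ι : Type*} [Fintype ι] [DecidableEq ι] {E : ι → Type*}
    [∀ i, MeasurableSpace (E i)] (ν : ∀ i, Measure (E i)) [∀ i, IsProbabilityMeasure (ν i)]
    (i : ι) : MeasurePreserving (fun x : (∀ j, E j) × E i => Function.update x.1 i x.2)
      ((Measure.pi ν).prod (ν i)) (Measure.pi ν) := by
  have hm : Measurable fun x : (∀ j, E j) × E i => Function.update x.1 i x.2 :=
    measurable_update'.comp measurable_id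
  refine ⟨hm, (Measure.pi_eq fun s hs => ?_).symm⟩
  have e : (fun x : (∀ j, E j) × E i => Function.update x.1 i x.2) ⁻¹' Set.univ.pi s =
      (Set.univ.pi (Function.update s i Set.univ)) ×ˢ s i := by
    ext ⟨x, y⟩
    simp only [Set.mem_preimage, Set.mem_pi, Set.mem_univ, true_implies, Set.mem_prod]
    constructor
    · intro h
      refine ⟨fun j => ?_, by simpa using h i⟩
      by_cases hj : j = i
      · subst hj; simp
      · simpa [hj] using h j
    · rintro ⟨h1, h2⟩ j
      by_cases hj : j = i
      · subst hj; simpa using h2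
      · simpa [hj] using h1 j
  rw [Measure.map_apply hm (MeasurableSet.univ_pi hs), e, Measure.prod_prod, Measure.pi_pi,
    ← Finset.prod_erase_mul _ _ (Finset.mem_univ i),
    ← Finset.prod_erase_mul _ (fun j => ν j (s j)) (Finset.mem_univ i)]
  simp only [Function.update_self, measure_univ, mul_one]
  congr 1
  refine Finset.prod_congr rfl fun j hj => ?_
  rw [Function.update_of_ne (Finset.ne_of_mem_erase hj)]

/-- Both noises of one time are resampled at once, which avoids splitting the index set into past,
present and future. The map is a product of two single updates up to a reordering of coordinates,
checked by Tonelli. -/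
theorem measurePreserving_update_pair {ι α : Type*} [Fintype ι] [DecidableEq ι]
    [MeasurableSpace α] {E F : Type*} [MeasurableSpace E] [MeasurableSpace F]
    (κ : Measure α) [IsProbabilityMeasure κ]
    (ν : ι → Measure E) [∀ i, IsProbabilityMeasure (ν i)]
    (ξ : ι → Measure F) [∀ i, IsProbabilityMeasure (ξ i)] (i : ι) :
    MeasurePreserving (fun x : (α × (ι → E) × (ι → F)) × F × E =>
        (x.1.1, Function.update x.1.2.1 i x.2.2, Function.update x.1.2.2 i x.2.1))
      ((κ.prod ((Measure.pi ν).prod (Measure.pi ξ))).prod ((ξ i).prod (ν i)))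
      (κ.prod ((Measure.pi ν).prod (Measure.pi ξ))) := by
  have h : MeasurePreserving (fun x : α × ((ι → E) × E) × ((ι → F) × F) =>
      (x.1, Function.update x.2.1.1 i x.2.1.2, Function.update x.2.2.1 i x.2.2.2))
      (κ.prod (((Measure.pi ν).prod (ν i)).prod ((Measure.pi ξ).prod (ξ i))))
      (κ.prod ((Measure.pi ν).prod (Measure.pi ξ))) :=
    (MeasurePreserving.id κ).prod
      ((measurePreserving_update ν i).prod (measurePreserving_update ξ i))
  have hm : Measurable fun x : (α × (ι → E) × (ι → F)) × F × E =>
      (x.1.1, (x.1.2.1, x.2.2), (x.1.2.2, x.2.1)) := by fun_prop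
  refine h.comp (g := fun x : α × ((ι → E) × E) × ((ι → F) × F) =>
      (x.1, Function.update x.2.1.1 i x.2.1.2, Function.update x.2.2.1 i x.2.2.2))
    (f := fun x : (α × (ι → E) × (ι → F)) × F × E =>
      (x.1.1, (x.1.2.1, x.2.2), (x.1.2.2, x.2.1))) ⟨hm, ?_⟩
  refine Measure.ext_of_lintegral _ fun f hf => ?_
  rw [lintegral_map hf hm, lintegral_prod _ hf.aemeasurable]
  refine (lintegral_prod _ (hf.comp hm).aemeasurable).trans
    ((lintegral_prod _ (hf.comp hm).lintegral_prod_right'.aemeasurable).trans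
      (lintegral_congr fun a => ?_))
  rw [lintegral_prod _ (by fun_prop), lintegral_prod _ (by fun_prop),
    lintegral_prod _ (by fun_prop)]
  refine lintegral_congr fun b => ?_
  have e1 : ∀ c : ι → F, ∫⁻ z : F × E, f (a, (b, z.2), (c, z.1)) ∂((ξ i).prod (ν i)) =
      ∫⁻ e, ∫⁻ w, f (a, (b, e), (c, w)) ∂(ξ i) ∂(ν i) := fun c => by
    rw [lintegral_prod_symm _ (by fun_prop)]
  simp only [Function.comp_apply, e1]
  rw [lintegral_lintegral_swap (by
    refine Measurable.aemeasurable ?_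
    exact Measurable.lintegral_prod_right' (f := fun x : ((ι → F) × E) × F =>
      f (a, (b, x.1.2), (x.1.1, x.2))) (by fun_prop))]
  refine lintegral_congr fun e => ?_
  rw [lintegral_prod _ (by fun_prop)]

/-- A variable that is unaffected by resampling is independent of the resampled coordinates. -/
theorem map_prodMk_eq_prod_of_update {X γ E : Type*} [MeasurableSpace X] [MeasurableSpace γ]
    [MeasurableSpace E] {ρ : Measure X} [IsProbabilityMeasure ρ] {ν : Measure E}
    [IsProbabilityMeasure ν] {Φ : X × E → X} (hΦ : MeasurePreserving Φ (ρ.prod ν) ρ)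
    {g : X → γ} (hg : Measurable g) (hgΦ : ∀ x, g (Φ x) = g x.1)
    {w : X → E} (hw : Measurable w) (hwΦ : ∀ x, w (Φ x) = x.2) :
    ρ.map (fun x => (g x, w x)) = (ρ.map g).prod ν := by
  -- Replace `ρ` by the law of the resampled point: there `g` sees only the old point and `w` is the
  -- fresh value.
  conv_lhs => rw [← hΦ.map_eq]
  rw [Measure.map_map (hg.prodMk hw) hΦ.measurable]
  have e : (fun x => (g x, w x)) ∘ Φ = Prod.map g id := by
    funext x
    simp only [Function.comp_apply, hgΦ, hwΦ, Prod.map, id]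
  have := Measure.isProbabilityMeasure_map (μ := ρ) hg.aemeasurable
  rw [e, ← Measure.map_prod_map _ _ hg measurable_id, Measure.map_id]

end Resampling

/-! ### The algebra of the gain matrix. -/

section Innovation

/-- The left side is the row covariance of `u - A(F'u + ε) = (1 - A F')u - Aε`. It is visibly
positive semidefinite, unlike the difference on the right. -/
theorem joseph_form {d r : ℕ} {R : Matrix (Fin d) (Fin d) ℝ} {F A : Matrix (Fin d) (Fin r) ℝ}
    {V Q : Matrix (Fin r) (Fin r) ℝ} (hR : Rᵀ = R) (hQ : Qᵀ = Q) (hQeq : Q = Fᵀ * R * F + V)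
    (hA : A * Q = R * F) :
    (1 - A * Fᵀ) * R * (1 - A * Fᵀ)ᵀ + (-A) * V * (-A)ᵀ = R - A * Q * Aᵀ := by
  have hA' : Fᵀ * R = Q * Aᵀ := by
    have := congrArg Matrix.transpose hA
    simpa only [Matrix.transpose_mul, hR, hQ] using this.symm
  have e : (1 - A * Fᵀ) * R * (1 - A * Fᵀ)ᵀ + (-A) * V * (-A)ᵀ =
      R - A * (Fᵀ * R) - (R * F) * Aᵀ + A * (Fᵀ * R * F + V) * Aᵀ := by
    simp only [Matrix.sub_mul, Matrix.mul_sub, Matrix.transpose_sub, Matrix.transpose_one,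
      Matrix.transpose_mul, Matrix.transpose_transpose, Matrix.one_mul, Matrix.mul_one,
      Matrix.mul_add, Matrix.add_mul, Matrix.transpose_neg, Matrix.neg_mul, Matrix.mul_neg,
      neg_neg, Matrix.mul_assoc]
    abel
  rw [e, ← hQeq, hA', ← hA, Matrix.mul_assoc A Q Aᵀ]
  abel

/-- The cross covariance of `F'u + ε` and `u - A(F'u + ε)` is `F'R - Q A'`, which vanishes exactly
because `A Q = R F`. -/
theorem innovation_uncorrelated {d r : ℕ} {R : Matrix (Fin d) (Fin d) ℝ}
    {F A : Matrix (Fin d) (Fin r) ℝ}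
    {V Q : Matrix (Fin r) (Fin r) ℝ} (hR : Rᵀ = R) (hQ : Qᵀ = Q) (hQeq : Q = Fᵀ * R * F + V)
    (hA : A * Q = R * F) :
    Fᵀ * R * (1 - A * Fᵀ)ᵀ + 1 * V * (-A)ᵀ = 0 := by
  have hA' : Fᵀ * R = Q * Aᵀ := by
    have := congrArg Matrix.transpose hA
    simpa only [Matrix.transpose_mul, hR, hQ] using this.symm
  have e : Fᵀ * R * (1 - A * Fᵀ)ᵀ + 1 * V * (-A)ᵀ = Fᵀ * R - (Fᵀ * R * F + V) * Aᵀ := by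
    simp only [Matrix.mul_sub, Matrix.transpose_sub, Matrix.transpose_one,
      Matrix.transpose_mul, Matrix.transpose_transpose, Matrix.one_mul, Matrix.mul_one,
      Matrix.add_mul, Matrix.transpose_neg, Matrix.mul_neg, Matrix.mul_assoc]
    abel
  rw [e, ← hQeq, hA', sub_self]

/-- The forecast error `e = F' u + ε` and the posterior residual `u - A e` are independent. -/
theorem matrixNormal_prod_map_innovation {d r p : ℕ} {R : Matrix (Fin d) (Fin d) ℝ}
    {F A : Matrix (Fin d) (Fin r) ℝ} {V Q : Matrix (Fin r) (Fin r) ℝ} (hR : R.PosSemidef)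
    (hV : V.PosSemidef) (hQ : Q.IsSymm) (hQeq : Q = Fᵀ * R * F + V) (hA : A * Q = R * F)
    {s : Matrix (Fin p) (Fin p) ℝ} (hs : s.PosSemidef) :
    ((matrixNormal (0 : Matrix (Fin d) (Fin p) ℝ) R s).prod
        (matrixNormal (0 : Matrix (Fin r) (Fin p) ℝ) V s)).map
        (fun z => ((Fᵀ * z.1 + z.2 : Matrix (Fin r) (Fin p) ℝ), z.1 - A * (Fᵀ * z.1 + z.2))) =
      (matrixNormal 0 Q s).prod (matrixNormal 0 (R - A * Q * Aᵀ) s) := by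
  have hRT : Rᵀ = R := by simpa [Matrix.IsHermitian] using hR.1
  have h := matrixNormal_prod_map_prodMk hR hV hs Fᵀ 1 (1 - A * Fᵀ) (-A)
    (innovation_uncorrelated hRT hQ hQeq hA)
  rw [joseph_form hRT hQ hQeq hA, Matrix.transpose_transpose, Matrix.transpose_one, Matrix.mul_one,
    Matrix.one_mul, ← hQeq] at h
  rw [← h]
  congr 1
  funext z
  simp only [Matrix.one_mul, Matrix.sub_mul, Matrix.mul_add, Matrix.neg_mul, Matrix.mul_assoc]
  congr 1
  rw [sub_add_eq_sub_sub, sub_eq_add_neg _ (A * z.2)]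

end Innovation

namespace MVDLM

variable {d p r : ℕ} (M : MVDLM d p r)

/-! ### Positivity and measurability of the recursively defined parameters. -/

section Recursions

theorem P_succ (t : ℕ) :
    M.P (t + 1) = M.RNext t - M.ANext t * M.QNext t * (M.ANext t)ᵀ := rfl

theorem N_isDiag {T : ℕ} (hM : M.IsAdmissible T) (t : ℕ) : (M.N t).IsDiag := by
  induction t with
  | zero => exact hM.N₀_diag
  | succ t ih => exact ih.add (Matrix.isDiag_one.smul _)

theorem N_pos {T : ℕ} (hM : M.IsAdmissible T) (t : ℕ) (i : Fin p) : 0 < M.N t i i := by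
  induction t with
  | zero => exact hM.N₀_pos i
  | succ t ih =>
    have : M.N (t + 1) i i = M.N t i i + r := by simp [N]
    rw [this]; positivity

theorem RNext_posSemidef {T t : ℕ} (hM : M.IsAdmissible T) (ht : t < T)
    (hP : (M.P t).PosSemidef) : (M.RNext t).PosSemidef :=
  (by simpa using hP.mul_mul_conjTranspose_same (M.G (t + 1)) :
    (M.G (t + 1) * M.P t * (M.G (t + 1))ᵀ).PosSemidef).add (hM.W_psd t ht)

theorem QNext_posDef {T t : ℕ} (hM : M.IsAdmissible T)
    (hQ : ∀ t < T, IsUnit (M.QNext t).det) (ht : t < T)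
    (hP : (M.P t).PosSemidef) : (M.QNext t).PosDef := by
  have h : (M.QNext t).PosSemidef :=
    (by simpa using (M.RNext_posSemidef hM ht hP).conjTranspose_mul_mul_same (M.F (t + 1)) :
      ((M.F (t + 1))ᵀ * M.RNext t * M.F (t + 1)).PosSemidef).add (hM.V_psd t ht)
  exact h.posDef_iff_det_ne_zero.2 (hQ t ht).ne_zero

theorem ANext_mul_QNext {t : ℕ} (hQ : IsUnit (M.QNext t).det) :
    M.ANext t * M.QNext t = M.RNext t * M.F (t + 1) := by
  rw [ANext, Matrix.mul_assoc, Matrix.nonsing_inv_mul _ hQ, Matrix.mul_one]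

theorem P_posSemidef {T : ℕ} (hM : M.IsAdmissible T)
    (hQ : ∀ t < T, IsUnit (M.QNext t).det) {t : ℕ} (ht : t ≤ T) : (M.P t).PosSemidef := by
  induction t with
  | zero => exact hM.P₀_psd
  | succ t ih =>
    have hP := ih (by omega)
    have hR := M.RNext_posSemidef hM ht hP
    have hQpd := M.QNext_posDef hM hQ ht hP
    -- `R - A Q A'` is rewritten as a sum of two congruences of semidefinite matrices.
    rw [P_succ, ← joseph_form (Q := M.QNext t) (F := M.F (t + 1)) (V := M.V (t + 1)) (by simpa [Matrix.IsHermitian] using hR.1)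
      (by simpa [Matrix.IsHermitian] using hQpd.1) rfl (M.ANext_mul_QNext (hQ t ht))]
    exact (by simpa only [conjTranspose_eq_transpose_of_trivial] using
        hR.mul_mul_conjTranspose_same (1 - M.ANext t * (M.F (t + 1))ᵀ) :
      ((1 - M.ANext t * (M.F (t + 1))ᵀ) * M.RNext t *
        (1 - M.ANext t * (M.F (t + 1))ᵀ)ᵀ).PosSemidef).add
      (by simpa only [conjTranspose_eq_transpose_of_trivial] using
        (hM.V_psd t ht).mul_mul_conjTranspose_same (-M.ANext t) :
        ((-M.ANext t) * M.V (t + 1) * (-M.ANext t)ᵀ).PosSemidef)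

/-- The scale matrix `N_t^{1/2} S_t N_t^{1/2}`. -/
def scale (t : ℕ) (h : Fin t → Matrix (Fin p) (Fin r) ℝ) : Matrix (Fin p) (Fin p) ℝ :=
  sqrtDiag (M.N t) * M.S t h * sqrtDiag (M.N t)

theorem S_succ_snoc (t : ℕ) (h : Fin t → Matrix (Fin p) (Fin r) ℝ)
    (Y : Matrix (Fin p) (Fin r) ℝ) :
    M.S (t + 1) (Fin.snoc h Y) = (sqrtDiag (M.N (t + 1)))⁻¹ *
      (M.scale t h + (Y - M.fNext t h) * (M.QNext t)⁻¹ * (Y - M.fNext t h)ᵀ) *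
        (sqrtDiag (M.N (t + 1)))⁻¹ := by
  simp only [S, Fin.snoc_castSucc, Fin.snoc_last, scale]

theorem m_succ_snoc (t : ℕ) (h : Fin t → Matrix (Fin p) (Fin r) ℝ)
    (Y : Matrix (Fin p) (Fin r) ℝ) :
    M.m (t + 1) (Fin.snoc h Y) = M.aNext t h + M.ANext t * (Y - M.fNext t h)ᵀ := by
  simp only [m, Fin.snoc_castSucc, Fin.snoc_last, aNext, fNext]

/-- The outer factors cancel because the diagonal of `N_{t+1}` is positive; in terms of the scale
matrix the recursion for `S` is a plain addition. -/
theorem scale_succ_snoc {T : ℕ} (hM : M.IsAdmissible T) (t : ℕ)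
    (h : Fin t → Matrix (Fin p) (Fin r) ℝ) (Y : Matrix (Fin p) (Fin r) ℝ) :
    M.scale (t + 1) (Fin.snoc h Y) =
      M.scale t h + (Y - M.fNext t h) * (M.QNext t)⁻¹ * (Y - M.fNext t h)ᵀ := by
  have hu : IsUnit (sqrtDiag (M.N (t + 1))).det :=
    isUnit_iff_ne_zero.2 (posDef_sqrtDiag (M.N_pos hM (t + 1))).det_pos.ne'
  rw [scale, S_succ_snoc, Matrix.mul_assoc, Matrix.mul_assoc, Matrix.nonsing_inv_mul _ hu,
    Matrix.mul_one, ← Matrix.mul_assoc, Matrix.mul_nonsing_inv _ hu, Matrix.one_mul]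

theorem S_posDef {T : ℕ} (hM : M.IsAdmissible T)
    (hQ : ∀ t < T, IsUnit (M.QNext t).det) {t : ℕ} (ht : t ≤ T)
    (h : Fin t → Matrix (Fin p) (Fin r) ℝ) : (M.S t h).PosDef := by
  induction t with
  | zero => exact hM.S₀_pd
  | succ t ih =>
    have hQpd := M.QNext_posDef hM hQ ht (M.P_posSemidef hM hQ (by omega))
    have hsc : (M.scale t (Fin.init h)).PosDef :=
      posDef_sqrtDiag_mul_mul (ih (by omega) _) (M.N_pos hM t)
    rw [← Fin.snoc_init_self h, S_succ_snoc]
    have hD := posDef_sqrtDiag (M.N_pos hM (t + 1))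
    have hDi : ((sqrtDiag (M.N (t + 1)))⁻¹)ᵀ = (sqrtDiag (M.N (t + 1)))⁻¹ := by
      simpa [Matrix.IsHermitian] using hD.inv.1
    have he : ((h (Fin.last t) - M.fNext t (Fin.init h)) * (M.QNext t)⁻¹ *
        (h (Fin.last t) - M.fNext t (Fin.init h))ᵀ).PosSemidef := by
      simpa using hQpd.inv.posSemidef.mul_mul_conjTranspose_same
        (h (Fin.last t) - M.fNext t (Fin.init h))
    have := (posDef_mul_mul_transpose_iff (B := (sqrtDiag (M.N (t + 1)))⁻¹)
      hD.inv.det_pos.ne').2 (hsc.add_posSemidef he)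
    rwa [hDi] at this

theorem measurable_m (t : ℕ) : Measurable (M.m t) := by
  induction t with
  | zero => exact measurable_const
  | succ t ih =>
    have h1 : Measurable fun h : Fin (t + 1) → Matrix (Fin p) (Fin r) ℝ =>
        fun i : Fin t => h i.castSucc := by fun_prop
    have h2 := ih.comp h1
    have h3 : Measurable fun h : Fin (t + 1) → Matrix (Fin p) (Fin r) ℝ => h (Fin.last t) := by
      fun_prop
    simp only [Function.comp_def] at h2
    have e : M.m (t + 1) = fun h => M.G (t + 1) * M.m t (fun i => h i.castSucc) +
        M.ANext t * (h (Fin.last t) -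
          ((M.F (t + 1))ᵀ * (M.G (t + 1) * M.m t (fun i => h i.castSucc)))ᵀ)ᵀ := rfl
    rw [e]
    fun_prop

theorem measurable_aNext (t : ℕ) : Measurable (M.aNext t) := by
  have := M.measurable_m t
  unfold aNext
  fun_prop

theorem measurable_fNext (t : ℕ) : Measurable (M.fNext t) := by
  have := M.measurable_aNext t
  unfold fNext
  fun_prop

theorem measurable_S (t : ℕ) : Measurable (M.S t) := by
  induction t with
  | zero => exact measurable_const
  | succ t ih =>
    have h1 : Measurable fun h : Fin (t + 1) → Matrix (Fin p) (Fin r) ℝ =>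
        fun i : Fin t => h i.castSucc := by fun_prop
    have h2 := ih.comp h1
    have h3 : Measurable fun h : Fin (t + 1) → Matrix (Fin p) (Fin r) ℝ => h (Fin.last t) := by
      fun_prop
    have h4 := (M.measurable_fNext t).comp h1
    simp only [Function.comp_def] at h2 h4
    have e : M.S (t + 1) = fun h => (sqrtDiag (M.N (t + 1)))⁻¹ *
        (sqrtDiag (M.N t) * M.S t (fun i => h i.castSucc) * sqrtDiag (M.N t) +
          (h (Fin.last t) - M.fNext t fun i => h i.castSucc) * (M.QNext t)⁻¹ *
            (h (Fin.last t) - M.fNext t fun i => h i.castSucc)ᵀ) *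
        (sqrtDiag (M.N (t + 1)))⁻¹ := rfl
    rw [e]
    fun_prop

theorem measurable_scale (t : ℕ) : Measurable (M.scale t) := by
  have := M.measurable_S t
  unfold scale
  fun_prop

end Recursions

/-! ### The Kalman recursion for fixed `s`. -/

section Filter

/-- The values of the innovations `Θ_0`, `ε_1', …, ε_T'`, `ω_1, …, ω_T`. -/
abbrev Innovations (d p r T : ℕ) : Type :=
  Matrix (Fin d) (Fin p) ℝ × (Fin T → Matrix (Fin r) (Fin p) ℝ) ×
    (Fin T → Matrix (Fin d) (Fin p) ℝ)

/-- The law of the innovations given `s`. -/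
def innovLaw (T : ℕ) (s : Matrix (Fin p) (Fin p) ℝ) : Measure (Innovations d p r T) :=
  (matrixNormal M.m₀ M.P₀ s).prod
    ((Measure.pi fun i : Fin T => matrixNormal (0 : Matrix (Fin r) (Fin p) ℝ)
        (M.V ((i : ℕ) + 1)) s).prod
      (Measure.pi fun i : Fin T => matrixNormal (0 : Matrix (Fin d) (Fin p) ℝ)
        (M.W ((i : ℕ) + 1)) s))

instance isProbabilityMeasure_innovLaw (T : ℕ) (s : Matrix (Fin p) (Fin p) ℝ) :
    IsProbabilityMeasure (M.innovLaw T s) := by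
  unfold innovLaw; infer_instance

variable {T : ℕ}

/-- The state `Θ_t` as a function of the innovations. -/
def state : ℕ → Innovations d p r T → Matrix (Fin d) (Fin p) ℝ
  | 0, x => x.1
  | t + 1, x => M.G (t + 1) * state t x + if h : t < T then x.2.2 ⟨t, h⟩ else 0

/-- The observation `y_{t+1}` as a function of the innovations. -/
def obs (t : ℕ) (x : Innovations d p r T) : Matrix (Fin p) (Fin r) ℝ :=
  ((M.F (t + 1))ᵀ * M.state (t + 1) x + if h : t < T then x.2.1 ⟨t, h⟩ else 0)ᵀ

/-- The observations `y_1, …, y_t` as a function of the innovations. -/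
def hist (t : ℕ) (x : Innovations d p r T) : Fin t → Matrix (Fin p) (Fin r) ℝ :=
  fun i => M.obs i x

/-- `Θ_t - m_t`. -/
def resid (t : ℕ) (x : Innovations d p r T) : Matrix (Fin d) (Fin p) ℝ :=
  M.state t x - M.m t (M.hist t x)

/-- `Θ_{t+1} - a_{t+1}`. -/
def priorResid (t : ℕ) (x : Innovations d p r T) : Matrix (Fin d) (Fin p) ℝ :=
  M.state (t + 1) x - M.aNext t (M.hist t x)

/-- `y_{t+1}' - f_{t+1}'`. -/
def obsResid (t : ℕ) (x : Innovations d p r T) : Matrix (Fin r) (Fin p) ℝ :=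
  (M.obs t x)ᵀ - (M.fNext t (M.hist t x))ᵀ

theorem measurable_state (t : ℕ) : Measurable (M.state (T := T) t) := by
  induction t with
  | zero => exact measurable_fst
  | succ t ih =>
    by_cases h : t < T
    · have e : M.state (T := T) (t + 1) =
          fun x => M.G (t + 1) * M.state t x + x.2.2 ⟨t, h⟩ := by
        funext x; simp [state, h]
      rw [e]; fun_prop
    · have e : M.state (T := T) (t + 1) = fun x => M.G (t + 1) * M.state t x := by
        funext x; simp [state, h]
      rw [e]; fun_prop

theorem measurable_obs (t : ℕ) : Measurable (M.obs (T := T) t) := by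
  have h1 := M.measurable_state (T := T) (t + 1)
  by_cases h : t < T
  · have e : M.obs (T := T) t =
        fun x => ((M.F (t + 1))ᵀ * M.state (t + 1) x + x.2.1 ⟨t, h⟩)ᵀ := by
      funext x; simp [obs, h]
    rw [e]; fun_prop
  · have e : M.obs (T := T) t = fun x => ((M.F (t + 1))ᵀ * M.state (t + 1) x)ᵀ := by
      funext x; simp [obs, h]
    rw [e]; fun_prop

theorem measurable_hist (t : ℕ) : Measurable (M.hist (T := T) t) :=
  measurable_pi_lambda _ fun i => M.measurable_obs i

theorem measurable_resid (t : ℕ) : Measurable (M.resid (T := T) t) :=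
  (M.measurable_state t).matrix_sub ((M.measurable_m t).comp (M.measurable_hist t))

theorem measurable_priorResid (t : ℕ) : Measurable (M.priorResid (T := T) t) :=
  (M.measurable_state (t + 1)).matrix_sub ((M.measurable_aNext t).comp (M.measurable_hist t))

theorem measurable_obsResid (t : ℕ) : Measurable (M.obsResid (T := T) t) :=
  (M.measurable_obs t).matrix_transpose.matrix_sub
    ((M.measurable_fNext t).comp (M.measurable_hist t)).matrix_transpose

theorem priorResid_eq {t : ℕ} (ht : t < T) (x : Innovations d p r T) :
    M.priorResid t x = M.G (t + 1) * M.resid t x + x.2.2 ⟨t, ht⟩ := by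
  simp only [priorResid, resid, state, ht, dite_true, aNext, Matrix.mul_sub]
  abel

theorem obsResid_eq {t : ℕ} (ht : t < T) (x : Innovations d p r T) :
    M.obsResid t x = (M.F (t + 1))ᵀ * M.priorResid t x + x.2.1 ⟨t, ht⟩ := by
  simp only [obsResid, priorResid, obs, ht, dite_true, fNext, Matrix.mul_sub,
    Matrix.transpose_transpose]
  abel

theorem hist_succ (t : ℕ) (x : Innovations d p r T) :
    M.hist (t + 1) x = Fin.snoc (M.hist t x) (M.fNext t (M.hist t x) + (M.obsResid t x)ᵀ) := by
  have h1 : M.fNext t (M.hist t x) + (M.obsResid t x)ᵀ = M.obs t x := by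
    simp [obsResid]
  rw [h1]
  exact (Fin.snoc_init_self (M.hist (t + 1) x)).symm

theorem resid_succ (t : ℕ) (x : Innovations d p r T) :
    M.resid (t + 1) x = M.priorResid t x - M.ANext t * M.obsResid t x := by
  rw [resid, hist_succ, m_succ_snoc, priorResid]
  simp only [add_sub_cancel_left, Matrix.transpose_transpose]
  rw [sub_add_eq_sub_sub]

/-- The innovations, with `ω_{t+1}` and `ε_{t+1}'` replaced by new values. -/
def resample (t : Fin T) (x : Innovations d p r T ×
    (Matrix (Fin d) (Fin p) ℝ × Matrix (Fin r) (Fin p) ℝ)) : Innovations d p r T :=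
  (x.1.1, Function.update x.1.2.1 t x.2.2, Function.update x.1.2.2 t x.2.1)

/-- Causality. Slot `t` holds the noise of time `t + 1`, and `Θ_k` uses only slots below `k`, so `k
= t` is allowed. The observation with index `k` is `y_{k+1}` and uses slot `k`, hence the strict
inequality in `obs_resample`. -/
theorem state_resample (t : Fin T) (x : Innovations d p r T ×
    (Matrix (Fin d) (Fin p) ℝ × Matrix (Fin r) (Fin p) ℝ)) {k : ℕ} (hk : k ≤ t) :
    M.state k (resample t x) = M.state k x.1 := by
  induction k with
  | zero => rfl
  | succ k ih =>
    have hkT : k < T := lt_of_lt_of_le hk t.2.le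
    have hne : (⟨k, hkT⟩ : Fin T) ≠ t := fun h => by
      rw [← h] at hk; simp at hk
    simp only [state, ih (by omega), hkT, dite_true]
    simp only [resample, Function.update_of_ne hne]

theorem obs_resample (t : Fin T) (x : Innovations d p r T ×
    (Matrix (Fin d) (Fin p) ℝ × Matrix (Fin r) (Fin p) ℝ)) {k : ℕ} (hk : k < t) :
    M.obs k (resample t x) = M.obs k x.1 := by
  have hkT : k < T := hk.trans t.2
  have hne : (⟨k, hkT⟩ : Fin T) ≠ t := fun h => by
    rw [← h] at hk; simp at hk
  simp only [obs, M.state_resample t x hk, hkT, dite_true]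
  simp only [resample, Function.update_of_ne hne]

theorem hist_resample (t : Fin T) (x : Innovations d p r T ×
    (Matrix (Fin d) (Fin p) ℝ × Matrix (Fin r) (Fin p) ℝ)) :
    M.hist t (resample t x) = M.hist t x.1 :=
  funext fun i => M.obs_resample t x i.2

theorem resid_resample (t : Fin T) (x : Innovations d p r T ×
    (Matrix (Fin d) (Fin p) ℝ × Matrix (Fin r) (Fin p) ℝ)) :
    M.resid t (resample t x) = M.resid t x.1 := by
  rw [resid, resid, M.state_resample t x le_rfl, M.hist_resample t x]

/-- Resampling the noise of time `t + 1` changes neither `y_1, …, y_t` nor `Θ_t - m_t`, so that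
noise is independent of both. -/
theorem map_hist_resid_innovations (s : Matrix (Fin p) (Fin p) ℝ) {t : ℕ} (ht : t < T) :
    (M.innovLaw T s).map (fun x => ((M.hist t x, M.resid t x), x.2.2 ⟨t, ht⟩, x.2.1 ⟨t, ht⟩)) =
      ((M.innovLaw T s).map fun x => (M.hist t x, M.resid t x)).prod
        ((matrixNormal 0 (M.W (t + 1)) s).prod (matrixNormal 0 (M.V (t + 1)) s)) := by
  have hΦ := measurePreserving_update_pair (matrixNormal M.m₀ M.P₀ s)
    (fun i : Fin T => matrixNormal (0 : Matrix (Fin r) (Fin p) ℝ) (M.V ((i : ℕ) + 1)) s)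
    (fun i : Fin T => matrixNormal (0 : Matrix (Fin d) (Fin p) ℝ) (M.W ((i : ℕ) + 1)) s) ⟨t, ht⟩
  refine map_prodMk_eq_prod_of_update (Φ := resample ⟨t, ht⟩) hΦ
    ((M.measurable_hist t).prodMk (M.measurable_resid t)) (fun x => ?_) (by fun_prop) fun x => ?_
  · exact Prod.ext (M.hist_resample ⟨t, ht⟩ x) (M.resid_resample ⟨t, ht⟩ x)
  · simp [resample]

/-- Prediction step: the state noise is merged into the residual through `G (Θ_t - m_t) + ω_{t+1}`,
while the observation noise is kept apart for the update. -/
theorem map_hist_priorResid_noise (hM : M.IsAdmissible T)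
    {s : Matrix (Fin p) (Fin p) ℝ} (hs : s.PosSemidef) {t : ℕ} (ht : t < T)
    (hP : (M.P t).PosSemidef)
    (ih : (M.innovLaw T s).map (fun x => (M.hist t x, M.resid t x)) =
      ((M.innovLaw T s).map (M.hist t)).prod (matrixNormal 0 (M.P t) s)) :
    (M.innovLaw T s).map (fun x => (M.hist t x, M.priorResid t x, x.2.1 ⟨t, ht⟩)) =
      ((M.innovLaw T s).map (M.hist t)).prod
        ((matrixNormal 0 (M.RNext t) s).prod (matrixNormal 0 (M.V (t + 1)) s)) := by
  have hη := Measure.isProbabilityMeasure_map (μ := M.innovLaw T s)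
    (M.measurable_hist t).aemeasurable
  have hmh := M.measurable_hist (T := T) t
  have hmr := M.measurable_resid (T := T) t
  have h0 : MeasurePreserving
      (fun x : Innovations d p r T => ((M.hist t x, M.resid t x), x.2.2 ⟨t, ht⟩, x.2.1 ⟨t, ht⟩))
      (M.innovLaw T s) ((((M.innovLaw T s).map (M.hist t)).prod (matrixNormal 0 (M.P t) s)).prod
        ((matrixNormal 0 (M.W (t + 1)) s).prod (matrixNormal 0 (M.V (t + 1)) s))) :=
    ⟨by fun_prop, by rw [map_hist_resid_innovations, ih]⟩
  have h1 := (measurePreserving_prodAssoc ((M.innovLaw T s).map (M.hist t))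
    (matrixNormal (0 : Matrix (Fin d) (Fin p) ℝ) (M.P t) s)
    ((matrixNormal (0 : Matrix (Fin d) (Fin p) ℝ) (M.W (t + 1)) s).prod
      (matrixNormal (0 : Matrix (Fin r) (Fin p) ℝ) (M.V (t + 1)) s)))
  have h2 := (measurePreserving_prodAssoc (matrixNormal (0 : Matrix (Fin d) (Fin p) ℝ) (M.P t) s)
    (matrixNormal (0 : Matrix (Fin d) (Fin p) ℝ) (M.W (t + 1)) s)
      (matrixNormal (0 : Matrix (Fin r) (Fin p) ℝ) (M.V (t + 1)) s)).symm
  have h3 : MeasurePreserving (fun z : Matrix (Fin d) (Fin p) ℝ × Matrix (Fin d) (Fin p) ℝ =>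
      (M.G (t + 1) * z.1 + z.2 : Matrix (Fin d) (Fin p) ℝ))
      ((matrixNormal 0 (M.P t) s).prod (matrixNormal 0 (M.W (t + 1)) s))
      (matrixNormal 0 (M.RNext t) s) :=
    ⟨by fun_prop, matrixNormal_prod_map_add (M.G (t + 1)) hP (hM.W_psd t ht) hs⟩
  have h4 := (MeasurePreserving.id ((M.innovLaw T s).map (M.hist t))).prod
    ((h3.prod (MeasurePreserving.id
      (matrixNormal (0 : Matrix (Fin r) (Fin p) ℝ) (M.V (t + 1)) s))).comp h2)
  rw [← (h4.comp (h1.comp h0)).map_eq]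
  congr 1
  funext x
  rw [M.priorResid_eq ht]
  rfl

/-- Update step: the pair (prior residual, noise) is turned into the pair (forecast error, new
residual), two independent normals still independent of the past. -/
theorem map_hist_obsResid_resid (hM : M.IsAdmissible T)
    (hQ : ∀ t < T, IsUnit (M.QNext t).det)
    {s : Matrix (Fin p) (Fin p) ℝ} (hs : s.PosSemidef) {t : ℕ} (ht : t < T)
    (ih : (M.innovLaw T s).map (fun x => (M.hist t x, M.resid t x)) =
      ((M.innovLaw T s).map (M.hist t)).prod (matrixNormal 0 (M.P t) s)) :
    (M.innovLaw T s).map (fun x => (M.hist t x, M.obsResid t x, M.resid (t + 1) x)) =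
      ((M.innovLaw T s).map (M.hist t)).prod
        ((matrixNormal 0 (M.QNext t) s).prod (matrixNormal 0 (M.P (t + 1)) s)) := by
  have hη := Measure.isProbabilityMeasure_map (μ := M.innovLaw T s)
    (M.measurable_hist t).aemeasurable
  have hmh := M.measurable_hist (T := T) t
  have hmr := M.measurable_priorResid (T := T) t
  have hP := M.P_posSemidef hM hQ ht.le
  have hQs : (M.QNext t).IsSymm := by
    simpa [Matrix.IsSymm, Matrix.IsHermitian] using (M.QNext_posDef hM hQ ht hP).1
  have h0 : MeasurePreserving
      (fun x : Innovations d p r T => (M.hist t x, M.priorResid t x, x.2.1 ⟨t, ht⟩))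
      (M.innovLaw T s) (((M.innovLaw T s).map (M.hist t)).prod
        ((matrixNormal 0 (M.RNext t) s).prod (matrixNormal 0 (M.V (t + 1)) s))) :=
    ⟨by fun_prop, map_hist_priorResid_noise M hM hs ht hP ih⟩
  have h1 : MeasurePreserving (fun z : Matrix (Fin d) (Fin p) ℝ × Matrix (Fin r) (Fin p) ℝ =>
      (((M.F (t + 1))ᵀ * z.1 + z.2 : Matrix (Fin r) (Fin p) ℝ),
        z.1 - M.ANext t * ((M.F (t + 1))ᵀ * z.1 + z.2)))
      ((matrixNormal 0 (M.RNext t) s).prod (matrixNormal 0 (M.V (t + 1)) s))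
      ((matrixNormal 0 (M.QNext t) s).prod (matrixNormal 0 (M.P (t + 1)) s)) :=
    ⟨by fun_prop, by
      rw [P_succ]
      exact matrixNormal_prod_map_innovation (M.RNext_posSemidef hM ht hP) (hM.V_psd t ht) hQs rfl
        (M.ANext_mul_QNext (hQ t ht)) hs⟩
  rw [← (((MeasurePreserving.id ((M.innovLaw T s).map (M.hist t))).prod h1).comp h0).map_eq]
  congr 1
  funext x
  rw [resid_succ, M.obsResid_eq ht]
  rfl

/-- The history `y_1, …, y_{t+1}` as a function of `y_1, …, y_t` and `y_{t+1}' - f_{t+1}'`. -/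
def appendObs (t : ℕ) (z : (Fin t → Matrix (Fin p) (Fin r) ℝ) × Matrix (Fin r) (Fin p) ℝ) :
    Fin (t + 1) → Matrix (Fin p) (Fin r) ℝ :=
  Fin.snoc z.1 (M.fNext t z.1 + z.2ᵀ)

theorem measurable_appendObs (t : ℕ) : Measurable (M.appendObs t) := by
  have hmf := M.measurable_fNext t
  refine measurable_pi_lambda _ fun i => ?_
  refine Fin.lastCases ?_ (fun j => ?_) i
  · simp only [appendObs, Fin.snoc_last]
    fun_prop
  · simp only [appendObs, Fin.snoc_castSucc]
    fun_prop

theorem map_prodMk_fst_of_map_prodMk_prod {X A B C : Type*} [MeasurableSpace X] [MeasurableSpace A]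
    [MeasurableSpace B] [MeasurableSpace C] {ρ : Measure X} {f : X → A} {g : X → B} {k : X → C}
    (hf : Measurable f) (hg : Measurable g) (hk : Measurable k) {a : Measure A} [SFinite a]
    {b : Measure B} [SFinite b] {c : Measure C} [IsProbabilityMeasure c]
    (h : ρ.map (fun x => (f x, g x, k x)) = a.prod (b.prod c)) :
    ρ.map (fun x => (f x, g x)) = a.prod b := by
  have h1 : MeasurePreserving (fun x => (f x, g x, k x)) ρ (a.prod (b.prod c)) :=
    ⟨by fun_prop, h⟩
  have h2 : MeasurePreserving (Prod.fst : B × C → B) (b.prod c) b := measurePreserving_fst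
  exact (((MeasurePreserving.id a).prod h2).comp h1).map_eq

/-- The Kalman recursion: given `s`, the residual `Θ_t - m_t` is independent of `y_1, …, y_t`,
with law `N_{d×p}(0, P_t, s)`. -/
theorem map_hist_resid (hM : M.IsAdmissible T) (hQ : ∀ t < T, IsUnit (M.QNext t).det)
    {s : Matrix (Fin p) (Fin p) ℝ} (hs : s.PosSemidef) {t : ℕ} (ht : t ≤ T) :
    (M.innovLaw T s).map (fun x => (M.hist t x, M.resid t x)) =
      ((M.innovLaw T s).map (M.hist t)).prod (matrixNormal 0 (M.P t) s) := by
  induction t with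
  | zero =>
    have h0 : MeasurePreserving (Prod.fst : Innovations d p r T → _) (M.innovLaw T s)
      (matrixNormal M.m₀ M.P₀ s) := measurePreserving_fst
    have h1 : MeasurePreserving (fun z => z - M.m₀) (matrixNormal M.m₀ M.P₀ s)
        (matrixNormal 0 M.P₀ s) := ⟨by fun_prop, matrixNormal_map_sub_const M.m₀ hM.P₀_psd hs⟩
    have e : (M.hist (T := T) 0) = fun _ => default := funext fun x => Subsingleton.elim _ _
    have e2 : (fun x : Innovations d p r T => (M.hist 0 x, M.resid 0 x)) =
        Prod.mk default ∘ ((fun z => z - M.m₀) ∘ Prod.fst) := by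
      funext x
      exact Prod.ext (Subsingleton.elim _ _) rfl
    rw [e2, e, Measure.map_const, measure_univ, one_smul, Measure.dirac_prod,
      ← Measure.map_map measurable_prodMk_left (by fun_prop), (h1.comp h0).map_eq]
    rfl
  | succ t ih =>
    have h := M.map_hist_obsResid_resid hM hQ hs ht (ih (by omega))
    have hη := Measure.isProbabilityMeasure_map (μ := M.innovLaw T s)
      (M.measurable_hist t).aemeasurable
    have hmh := M.measurable_hist (T := T) t
    have hmo := M.measurable_obsResid (T := T) t
    have hmr := M.measurable_resid (T := T) (t + 1)
    have h1 := map_prodMk_fst_of_map_prodMk_prod hmh hmo hmr h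
    have h2 := (measurePreserving_prodAssoc ((M.innovLaw T s).map (M.hist t))
      (matrixNormal (0 : Matrix (Fin r) (Fin p) ℝ) (M.QNext t) s)
      (matrixNormal (0 : Matrix (Fin d) (Fin p) ℝ) (M.P (t + 1)) s)).symm
    have h3 : MeasurePreserving
        (fun x : Innovations d p r T => (M.hist t x, M.obsResid t x, M.resid (t + 1) x))
        (M.innovLaw T s) _ := ⟨by fun_prop, h⟩
    -- The new history is a function of the old history and the forecast error alone, so the new
    -- residual, independent of that pair, is independent of the new history.
    have h4 : MeasurePreserving (M.appendObs t) (((M.innovLaw T s).map (M.hist t)).prod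
        (matrixNormal (0 : Matrix (Fin r) (Fin p) ℝ) (M.QNext t) s))
        ((M.innovLaw T s).map (M.hist (t + 1))) := by
      refine ⟨M.measurable_appendObs t, ?_⟩
      rw [← h1, Measure.map_map (M.measurable_appendObs t) (by fun_prop)]
      congr 1
      funext x
      exact (M.hist_succ t x).symm
    have h5 := Measure.isProbabilityMeasure_map (μ := M.innovLaw T s)
      (M.measurable_hist (t + 1)).aemeasurable
    rw [← ((h4.prod (MeasurePreserving.id
      (matrixNormal (0 : Matrix (Fin d) (Fin p) ℝ) (M.P (t + 1)) s))).comp (h2.comp h3)).map_eq]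
    congr 1
    funext x
    rw [hist_succ]
    rfl

theorem map_hist_priorResid (hM : M.IsAdmissible T) (hQ : ∀ t < T, IsUnit (M.QNext t).det)
    {s : Matrix (Fin p) (Fin p) ℝ} (hs : s.PosSemidef) {t : ℕ} (ht : t < T) :
    (M.innovLaw T s).map (fun x => (M.hist t x, M.priorResid t x)) =
      ((M.innovLaw T s).map (M.hist t)).prod (matrixNormal 0 (M.RNext t) s) := by
  have hη := Measure.isProbabilityMeasure_map (μ := M.innovLaw T s)
    (M.measurable_hist t).aemeasurable
  exact map_prodMk_fst_of_map_prodMk_prod (M.measurable_hist t) (M.measurable_priorResid t)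
    (by fun_prop) (M.map_hist_priorResid_noise hM hs ht (M.P_posSemidef hM hQ ht.le)
      (M.map_hist_resid hM hQ hs ht.le))

theorem map_hist_obsResid (hM : M.IsAdmissible T) (hQ : ∀ t < T, IsUnit (M.QNext t).det)
    {s : Matrix (Fin p) (Fin p) ℝ} (hs : s.PosSemidef) {t : ℕ} (ht : t < T) :
    (M.innovLaw T s).map (fun x => (M.hist t x, M.obsResid t x)) =
      ((M.innovLaw T s).map (M.hist t)).prod (matrixNormal 0 (M.QNext t) s) := by
  have hη := Measure.isProbabilityMeasure_map (μ := M.innovLaw T s)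
    (M.measurable_hist t).aemeasurable
  exact map_prodMk_fst_of_map_prodMk_prod (M.measurable_hist t) (M.measurable_obsResid t)
    (M.measurable_resid (t + 1)) (M.map_hist_obsResid_resid hM hQ hs ht
      (M.map_hist_resid hM hQ hs ht.le))

/-- The map `appendObs` does not involve `s`: one more observation multiplies the likelihood by the
normal density of the forecast error. -/
theorem map_hist_succ (hM : M.IsAdmissible T) (hQ : ∀ t < T, IsUnit (M.QNext t).det)
    {s : Matrix (Fin p) (Fin p) ℝ} (hs : s.PosSemidef) {t : ℕ} (ht : t < T) :
    (M.innovLaw T s).map (M.hist (t + 1)) =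
      (((M.innovLaw T s).map (M.hist t)).prod (matrixNormal 0 (M.QNext t) s)).map
        (M.appendObs t) := by
  have hmh := M.measurable_hist (T := T) t
  have hmo := M.measurable_obsResid (T := T) t
  rw [← M.map_hist_obsResid hM hQ hs ht, Measure.map_map (M.measurable_appendObs t) (by fun_prop)]
  congr 1
  funext x
  exact M.hist_succ t x

end Filter

/-! ### The likelihood as a function of `s`. -/

section Likelihood

variable {T : ℕ}

/-- Adding `r I` to `N` adds `r p` to the trace, hence `r/2` to the exponent, exactly the power
contributed by one normal factor. -/
theorem wishartKernel_succ (hM : M.IsAdmissible T) (t : ℕ)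
    (z : (Fin t → Matrix (Fin p) (Fin r) ℝ) × Matrix (Fin r) (Fin p) ℝ)
    {s : Matrix (Fin p) (Fin p) ℝ} (hs : s.PosDef) :
    wishartKernel (p + (M.N (t + 1)).trace / (2 * p)) (M.scale (t + 1) (M.appendObs t z)) s =
      wishartKernel (p + (M.N t).trace / (2 * p)) (M.scale t z.1) s *
        matrixNormalKernel (M.QNext t) s z.2 := by
  rw [wishartKernel_mul_matrixNormalKernel _ _ _ hs, appendObs, M.scale_succ_snoc hM,
    add_sub_cancel_left, Matrix.transpose_transpose]
  rcases Nat.eq_zero_or_pos p with rfl | hp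
  -- For `p = 0` the quotient by `2p` is zero and the exponents need not match, but the empty
  -- determinant is `1`.
  · simp only [wishartKernel, Matrix.det_fin_zero, Real.one_rpow]
  · congr 1
    have hp' : (p : ℝ) ≠ 0 := by positivity
    have : (M.N (t + 1)).trace = (M.N t).trace + r * p := by simp [N]
    rw [this]
    field_simp
    ring

theorem measurable_wishartKernel_scale (t : ℕ) : Measurable
    (Function.uncurry fun (h : Fin t → Matrix (Fin p) (Fin r) ℝ) (s : Matrix (Fin p) (Fin p) ℝ) =>
      wishartKernel (p + (M.N t).trace / (2 * p)) (M.scale t h) s) := by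
  have := M.measurable_scale t
  unfold Function.uncurry wishartKernel
  fun_prop

theorem measurable_wishartKernel_scale_left (t : ℕ) (s : Matrix (Fin p) (Fin p) ℝ) :
    Measurable fun h : Fin t → Matrix (Fin p) (Fin r) ℝ =>
      wishartKernel (p + (M.N t).trace / (2 * p)) (M.scale t h) s := by
  have := M.measurable_scale t
  unfold wishartKernel
  fun_prop

/-- As a function of `s`, the prior density times the likelihood of `y_1, …, y_t` is
proportional to the modified inverted Wishart density with the updated parameters. -/
theorem exists_map_hist_eq_withDensity (hM : M.IsAdmissible T)
    (hQ : ∀ t < T, IsUnit (M.QNext t).det) {t : ℕ} (ht : t ≤ T) :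
    ∃ b : Measure (Fin t → Matrix (Fin p) (Fin r) ℝ), SFinite b ∧
      ∀ s : Matrix (Fin p) (Fin p) ℝ, s.PosDef →
        wishartKernel (p + M.N₀.trace / (2 * p)) (sqrtDiag M.N₀ * M.S₀ * sqrtDiag M.N₀) s •
            (M.innovLaw T s).map (M.hist t) =
          b.withDensity fun h =>
            wishartKernel (p + (M.N t).trace / (2 * p)) (M.scale t h) s := by
  induction t with
  | zero =>
    -- There is a single history of length zero.
    refine ⟨Measure.dirac default, inferInstance, fun s hs => ?_⟩
    have e : (M.hist (T := T) 0) = fun _ => default := funext fun x => Subsingleton.elim _ _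
    have e2 : (fun h : Fin 0 → Matrix (Fin p) (Fin r) ℝ =>
        wishartKernel (p + (M.N 0).trace / (2 * p)) (M.scale 0 h) s) = fun _ =>
        wishartKernel (p + M.N₀.trace / (2 * p)) (sqrtDiag M.N₀ * M.S₀ * sqrtDiag M.N₀) s := rfl
    rw [e2, e, Measure.map_const, measure_univ, one_smul, withDensity_const]
  | succ t ih =>
    obtain ⟨b, hb, h⟩ := ih (by omega)
    have hQpd := M.QNext_posDef hM hQ ht (M.P_posSemidef hM hQ (by omega))
    obtain ⟨K, hK, hdens⟩ := exists_matrixNormal_eq_withDensity (p := p) hQpd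
    have hφ := M.measurable_appendObs t
    -- The reference measure collects every factor free of `s`: one copy of Lebesgue measure per
    -- forecast error, carried to histories by `appendObs`.
    refine ⟨(K • b.prod (matrixVolume r p)).map (M.appendObs t), inferInstance, fun s hs => ?_⟩
    have hm1 := M.measurable_wishartKernel_scale_left t s
    have hm2 := M.measurable_wishartKernel_scale_left (t + 1) s
    have hη := Measure.isProbabilityMeasure_map (μ := M.innovLaw T s)
      (M.measurable_hist t).aemeasurable
    rw [M.map_hist_succ hM hQ hs.posSemidef ht, ← map_withDensity_comp hφ hm2,
      ← Measure.map_smul, ← Measure.prod_smul_left, h s hs, hdens s hs, Measure.prod_smul_right,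
      prod_withDensity hm1 (measurable_matrixNormalKernel_right _ _), withDensity_smul_measure]
    simp only [M.wishartKernel_succ hM t _ hs]

end Likelihood
-- From fixed `s` to random `s`: posterior laws given the data.
section Conditional

variable {Ω : Type*} [MeasurableSpace Ω] {μ : Measure Ω} [IsProbabilityMeasure μ] {T : ℕ}
  {Sg : Ω → Matrix (Fin p) (Fin p) ℝ} {κ : Kernel (Matrix (Fin p) (Fin p) ℝ) (Innovations d p r T)}
  [IsMarkovKernel κ] {X : Ω → Innovations d p r T}

/-- Assembles the independence of history and residual, known for each fixed `s`, into conditional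
independence given `Sg`. -/
theorem map_statistic_eq_compProd (hSg : Measurable Sg) (hX : Measurable X)
    (hκ : ∀ᵐ s ∂(μ.map Sg), s.PosDef ∧ κ s = M.innovLaw T s)
    (hj : μ.map (fun w => (Sg w, X w)) = μ.map Sg ⊗ₘ κ) {a t : ℕ}
    {g : Innovations d p r T → Matrix (Fin a) (Fin p) ℝ} (hg : Measurable g)
    {P : Matrix (Fin a) (Fin a) ℝ}
    (hind : ∀ s : Matrix (Fin p) (Fin p) ℝ, s.PosDef →
      (M.innovLaw T s).map (fun x => (M.hist t x, g x)) =
        ((M.innovLaw T s).map (M.hist t)).prod (matrixNormal 0 P s))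
    {G : Kernel (Matrix (Fin p) (Fin p) ℝ) (Matrix (Fin a) (Fin p) ℝ)} [IsMarkovKernel G]
    (hG : ∀ s, s.PosDef → G s = matrixNormal 0 P s) :
    μ.map (fun w => (Sg w, (M.hist t (X w), g (X w)))) =
      μ.map Sg ⊗ₘ ((κ.map (M.hist t)) ×ₖ G) := by
  have hh := M.measurable_hist (T := T) t
  have hm : Measurable fun x => (M.hist t x, g x) := hh.prodMk hg
  have := Kernel.IsMarkovKernel.map κ hh
  have e : μ.map Sg ⊗ₘ ((κ.map (M.hist t)) ×ₖ G) =
      μ.map Sg ⊗ₘ (κ.map fun x => (M.hist t x, g x)) := by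
    refine Measure.compProd_congr ?_
    filter_upwards [hκ] with s hs
    rw [Kernel.prod_apply, Kernel.map_apply _ hh, Kernel.map_apply _ hm, hs.2, hG s hs.1,
      hind s hs.1]
  rw [e, Measure.compProd_map hm, ← hj, Measure.map_map (by fun_prop) (by fun_prop)]
  rfl

/-- Puts data and covariance in the form Bayes' formula needs: a joint density against a product
measure, obtained by multiplying the prior density by the likelihood. -/
theorem map_hist_scale_eq_withDensity (hM : M.IsAdmissible T)
    (hQ : ∀ t < T, IsUnit (M.QNext t).det) (hSg : Measurable Sg) (hX : Measurable X)
    (hlaw : μ.map Sg = MIW M.S₀ M.N₀ p)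
    (hκ : ∀ᵐ s ∂(μ.map Sg), s.PosDef ∧ κ s = M.innovLaw T s)
    (hj : μ.map (fun w => (Sg w, X w)) = μ.map Sg ⊗ₘ κ) {t : ℕ} (ht : t ≤ T) :
    ∃ b : Measure (Fin t → Matrix (Fin p) (Fin r) ℝ), SFinite b ∧
      μ.map (fun w => (M.hist t (X w), Sg w)) = (b.prod (posDefLebesgue p)).withDensity
        (Function.uncurry fun h s =>
          wishartKernel (p + (M.N t).trace / (2 * p)) (M.scale t h) s) := by
  obtain ⟨b, hb, hbs⟩ := M.exists_map_hist_eq_withDensity hM hQ ht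
  have hh := M.measurable_hist (T := T) t
  have hq := M.measurable_wishartKernel_scale t
  set q : (Fin t → Matrix (Fin p) (Fin r) ℝ) → Matrix (Fin p) (Fin p) ℝ → ENNReal := fun h s =>
    wishartKernel (p + (M.N t).trace / (2 * p)) (M.scale t h) s with hqdef
  set w₀ := wishartKernel (p + M.N₀.trace / (2 * p)) (sqrtDiag M.N₀ * M.S₀ * sqrtDiag M.N₀)
    with hw₀
  have hw₀m : Measurable w₀ := measurable_wishartKernel_right _ _
  set Z := (((posDefLebesgue p).withDensity w₀) Set.univ)⁻¹ with hZ
  have hprior : μ.map Sg = Z • (posDefLebesgue p).withDensity w₀ := hlaw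
  refine ⟨Z • b, inferInstance, ?_⟩
  ext A hA
  have hsw : Measurable (Prod.swap : Matrix (Fin p) (Fin p) ℝ × (Fin t → Matrix (Fin p) (Fin r) ℝ) →
    _) := measurable_swap
  have e1 : μ.map (fun w => (M.hist t (X w), Sg w)) =
      (μ.map Sg ⊗ₘ (κ.map (M.hist t))).map Prod.swap := by
    rw [Measure.compProd_map hh, ← hj, Measure.map_map (by fun_prop) (by fun_prop),
      Measure.map_map (by fun_prop) (by fun_prop)]
    rfl
  have hsec : ∀ s, MeasurableSet (Prod.mk s ⁻¹' (Prod.swap ⁻¹' A)) := fun s =>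
    measurable_prodMk_left (hsw hA)
  rw [e1, Measure.map_apply hsw hA, Measure.compProd_apply (hsw hA)]
  have hmκ : Measurable fun s => (κ.map (M.hist t)) s (Prod.mk s ⁻¹' (Prod.swap ⁻¹' A)) :=
    Kernel.measurable_kernel_prodMk_left (hsw hA)
  -- With `Z = 0` the prior would be the zero measure. Nonvanishing lets almost everywhere
  -- statements pass from the prior to its unnormalized density.
  have hZ0 : Z ≠ 0 := by
    intro h0
    have := Measure.isProbabilityMeasure_map (μ := μ) hSg.aemeasurable
    have h1 := measure_univ (μ := μ.map Sg)
    rw [hprior, h0, zero_smul] at h1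
    simp at h1
  rw [hprior, Measure.ae_ennreal_smul_measure_iff hZ0, ae_withDensity_iff hw₀m] at hκ
  have hae : ∀ᵐ s ∂(posDefLebesgue p), w₀ s * (κ.map (M.hist t)) s
      (Prod.mk s ⁻¹' (Prod.swap ⁻¹' A)) =
        ∫⁻ h, A.indicator (Function.uncurry q) (h, s) ∂b := by
    filter_upwards [hκ, ae_posDef_posDefLebesgue p] with s hs hpd
    have e2 : w₀ s * (κ.map (M.hist t)) s (Prod.mk s ⁻¹' (Prod.swap ⁻¹' A)) =
        (w₀ s • (M.innovLaw T s).map (M.hist t)) (Prod.mk s ⁻¹' (Prod.swap ⁻¹' A)) := by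
      rw [Measure.smul_apply, smul_eq_mul]
      -- Where the prior density vanishes, `κ s` is not identified, but both sides are zero.
      by_cases h0 : w₀ s = 0
      · rw [h0, zero_mul, zero_mul]
      · rw [Kernel.map_apply _ hh, (hs h0).2]
    rw [e2, hbs s hpd, withDensity_apply _ (hsec s), ← lintegral_indicator (hsec s)]
    rfl
  rw [hprior, lintegral_smul_measure, lintegral_withDensity_eq_lintegral_mul _ hw₀m hmκ]
  simp only [Pi.mul_apply]
  rw [lintegral_congr_ae hae, withDensity_apply _ hA, ← lintegral_indicator hA,
    Measure.prod_smul_left, lintegral_smul_measure,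
    lintegral_prod_symm _ (hq.indicator hA).aemeasurable]

/-- Bayes' formula also yields that the `MIW` law is a probability measure for almost every history,
so no convergence of inverted Wishart integrals has to be checked. -/
theorem exists_kernel_MIW_posterior (hM : M.IsAdmissible T)
    (hQ : ∀ t < T, IsUnit (M.QNext t).det) (hSg : Measurable Sg) (hX : Measurable X)
    (hlaw : μ.map Sg = MIW M.S₀ M.N₀ p)
    (hκ : ∀ᵐ s ∂(μ.map Sg), s.PosDef ∧ κ s = M.innovLaw T s)
    (hj : μ.map (fun w => (Sg w, X w)) = μ.map Sg ⊗ₘ κ) {t : ℕ} (ht : t ≤ T) :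
    ∃ K : Kernel (Fin t → Matrix (Fin p) (Fin r) ℝ) (Matrix (Fin p) (Fin p) ℝ),
      IsFiniteKernel K ∧
      μ.map (fun w => (M.hist t (X w), Sg w)) = μ.map (fun w => M.hist t (X w)) ⊗ₘ K ∧
      ∀ᵐ h ∂(μ.map fun w => M.hist t (X w)), K h = MIW (M.S t h) (M.N t) p ∧
        IsProbabilityMeasure (K h) := by
  have hh := M.measurable_hist (T := T) t
  obtain ⟨b, hb, hν⟩ := M.map_hist_scale_eq_withDensity hM hQ hSg hX hlaw hκ hj ht
  have := Measure.isProbabilityMeasure_map (μ := μ) (f := fun w => (M.hist t (X w), Sg w))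
    (by fun_prop)
  obtain ⟨K, hK, hKν, hKae⟩ := exists_kernel_normalized_withDensity
    (M.measurable_wishartKernel_scale t) hν
  rw [Measure.map_map measurable_fst (by fun_prop)] at hKν hKae
  exact ⟨K, hK, hKν, hKae⟩

/-- If the residual `g` is independent of the observations and matrix normal given `Sg`, then the
posterior law of `(mm (y_1, …, y_t) + g, Sg)` is normal modified inverted Wishart. -/
theorem hasCondLaw_NMIW (hM : M.IsAdmissible T)
    (hQ : ∀ t < T, IsUnit (M.QNext t).det) (hSg : Measurable Sg) (hX : Measurable X)
    (hlaw : μ.map Sg = MIW M.S₀ M.N₀ p)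
    (hκ : ∀ᵐ s ∂(μ.map Sg), s.PosDef ∧ κ s = M.innovLaw T s)
    (hj : μ.map (fun w => (Sg w, X w)) = μ.map Sg ⊗ₘ κ) {a t : ℕ} (ht : t ≤ T)
    {g : Innovations d p r T → Matrix (Fin a) (Fin p) ℝ} (hg : Measurable g)
    {P : Matrix (Fin a) (Fin a) ℝ} (hP : P.PosSemidef)
    (hind : ∀ s : Matrix (Fin p) (Fin p) ℝ, s.PosDef →
      (M.innovLaw T s).map (fun x => (M.hist t x, g x)) =
        ((M.innovLaw T s).map (M.hist t)).prod (matrixNormal 0 P s))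
    {mm : (Fin t → Matrix (Fin p) (Fin r) ℝ) → Matrix (Fin a) (Fin p) ℝ} (hmm : Measurable mm) :
    HasCondLaw (fun w => (mm (M.hist t (X w)) + g (X w), Sg w)) (fun w => M.hist t (X w))
        (fun h => NMIW (mm h) P (M.S t h) (M.N t) p) μ ∧
      (P.PosDef → HasCondLaw (fun w => mm (M.hist t (X w)) + g (X w)) (fun w => M.hist t (X w))
        (fun h => MT (mm h) P (M.S t h) (M.N t) p) μ) ∧
      HasCondLaw (fun w => mm (M.hist t (X w)) + g (X w)) (fun w => (Sg w, M.hist t (X w)))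
        (fun sh => matrixNormal (mm sh.2) P sh.1) μ := by
  have hh := M.measurable_hist (T := T) t
  have := Kernel.IsMarkovKernel.map κ hh
  obtain ⟨G, hGm, hG⟩ := exists_kernel_matrixNormal (p := p) hP
  obtain ⟨K, hK, hKj, hKae⟩ := M.exists_kernel_MIW_posterior hM hQ hSg hX hlaw hκ hj ht
  have hstat := M.map_statistic_eq_compProd hSg hX hκ hj hg hind hG
  have hpost := map_eq_compProd_of_condIndep_of_posterior hSg (Y := fun w => M.hist t (X w))
    (X := fun w => g (X w)) (by fun_prop) (by fun_prop) hstat hKj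
  have hfull := map_eq_compProd_of_condIndep hSg (Y := fun w => M.hist t (X w))
    (X := fun w => g (X w)) (by fun_prop) (by fun_prop) hstat
  -- For a fixed history the joint posterior of covariance and residual is "`K h`, then `G`", which
  -- is an `NMIW` law once the known mean `mm h` is added.
  have hE : ∀ h, (K ⊗ₖ Kernel.comap G Prod.snd measurable_snd) h = K h ⊗ₘ G := fun h => by
    rw [Kernel.compProd_apply_eq_compProd_sectR]
    congr 1
  have hφ : Measurable (Function.uncurry fun (h : Fin t → Matrix (Fin p) (Fin r) ℝ)
      (x : Matrix (Fin p) (Fin p) ℝ × Matrix (Fin a) (Fin p) ℝ) => (mm h + x.2, x.1)) := by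
    unfold Function.uncurry; fun_prop
  have h1 := hasCondLaw_of_map_eq_compProd (by fun_prop) (by fun_prop) hpost hφ
  have hNM : ∀ᵐ h ∂(μ.map fun w => M.hist t (X w)),
      ((K ⊗ₖ Kernel.comap G Prod.snd measurable_snd) h).map (fun x => (mm h + x.2, x.1)) =
        NMIW (mm h) P (M.S t h) (M.N t) p ∧ IsProbabilityMeasure (MIW (M.S t h) (M.N t) p) := by
    filter_upwards [hKae] with h hh
    have := hh.2
    rw [hE, NMIW_eq (mm h) hP _ _ _ hG, ← hh.1]
    exact ⟨rfl, this⟩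
  refine ⟨h1.congr (hNM.mono fun h hh => hh.1), fun hPd => ?_, ?_⟩
  · have hφ' : Measurable (Function.uncurry fun (h : Fin t → Matrix (Fin p) (Fin r) ℝ)
        (x : Matrix (Fin p) (Fin p) ℝ × Matrix (Fin a) (Fin p) ℝ) => mm h + x.2) := by
      unfold Function.uncurry; fun_prop
    refine (hasCondLaw_of_map_eq_compProd (by fun_prop) (by fun_prop) hpost hφ').congr ?_
    filter_upwards [hNM] with h hh
    have := hh.2
    rw [← NMIW_map_fst (mm h) hPd (M.S_posDef hM hQ ht h) (M.N_pos hM t), ← hh.1,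
      Measure.map_map measurable_fst (by fun_prop)]
    rfl
  · have hφ' : Measurable (Function.uncurry fun (x : Matrix (Fin p) (Fin p) ℝ ×
        (Fin t → Matrix (Fin p) (Fin r) ℝ)) (z : Matrix (Fin a) (Fin p) ℝ) => mm x.2 + z) := by
      unfold Function.uncurry; fun_prop
    -- Here the covariance belongs to the conditioning variables, so the disintegration over `(Sg,
    -- history)` is used instead of the posterior.
    refine (hasCondLaw_of_map_eq_compProd (by fun_prop) (by fun_prop) hfull hφ').congr ?_
    have hpd : ∀ᵐ x ∂(μ.map fun w => (Sg w, M.hist t (X w))), x.1.PosDef := by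
      have h2 : ∀ᵐ s ∂((μ.map fun w => (Sg w, M.hist t (X w))).map Prod.fst), s.PosDef := by
        rw [Measure.map_map measurable_fst (by fun_prop)]
        exact hκ.mono fun s hs => hs.1
      exact ae_of_ae_map measurable_fst.aemeasurable h2
    filter_upwards [hpd] with x hx
    rw [Kernel.comap_apply, hG _ hx, matrixNormal_map_const_add _ hP hx.posSemidef]

end Conditional
end MVDLM

/-! ### Transfer to random matrices that follow the model. -/

namespace MVDLM

variable {d p r : ℕ} {M : MVDLM d p r} {Ω : Type*} [MeasurableSpace Ω] {μ : Measure Ω}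
  [IsProbabilityMeasure μ] {T : ℕ} {Sg : Ω → Matrix (Fin p) (Fin p) ℝ}
  {Θ : ℕ → Ω → Matrix (Fin d) (Fin p) ℝ} {y ε : ℕ → Ω → Matrix (Fin p) (Fin r) ℝ}
  {ω : ℕ → Ω → Matrix (Fin d) (Fin p) ℝ}

/-- The random matrices `Θ_0`, `ε_1', …, ε_T'`, `ω_1, …, ω_T`. -/
def innovations (T : ℕ) (Θ : ℕ → Ω → Matrix (Fin d) (Fin p) ℝ)
    (ε : ℕ → Ω → Matrix (Fin p) (Fin r) ℝ) (ω : ℕ → Ω → Matrix (Fin d) (Fin p) ℝ) (w : Ω) :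
    Innovations d p r T :=
  (Θ 0 w, fun i => (ε ((i : ℕ) + 1) w)ᵀ, fun i => ω ((i : ℕ) + 1) w)

theorem Follows.measurable_innovations (h : M.Follows μ T Sg Θ y ε ω) :
    Measurable (innovations T Θ ε ω) := by
  refine h.measurable_Θ₀.prodMk (Measurable.prodMk (measurable_pi_lambda _ fun i => ?_)
    (measurable_pi_lambda _ fun i => h.measurable_ω i i.2))
  have := h.measurable_ε i i.2
  fun_prop

theorem Follows.state_innovations (h : M.Follows μ T Sg Θ y ε ω) {t : ℕ} (ht : t ≤ T) (w : Ω) :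
    M.state t (innovations T Θ ε ω w) = Θ t w := by
  induction t with
  | zero => rfl
  | succ t ih =>
    have ht' : t < T := ht
    rw [state, ih ht'.le, dif_pos ht', h.evolution t ht']
    rfl

theorem Follows.obs_innovations (h : M.Follows μ T Sg Θ y ε ω) {t : ℕ} (ht : t < T) (w : Ω) :
    M.obs t (innovations T Θ ε ω w) = y (t + 1) w := by
  rw [obs, h.state_innovations ht, dif_pos ht, ← Matrix.transpose_transpose (y (t + 1) w),
    h.observation t ht]
  rfl

theorem Follows.hist_innovations (h : M.Follows μ T Sg Θ y ε ω) {t : ℕ} (ht : t ≤ T) (w : Ω) :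
    M.hist t (innovations T Θ ε ω w) = history y t w :=
  funext fun i => h.obs_innovations (i.2.trans_le ht) w

/-- The regular conditional distribution itself serves as the kernel, so `innovLaw` need not be
shown measurable in `s`. -/
theorem Follows.exists_kernel_innovLaw (h : M.Follows μ T Sg Θ y ε ω) :
    ∃ κ : Kernel (Matrix (Fin p) (Fin p) ℝ) (Innovations d p r T), IsMarkovKernel κ ∧
      (∀ᵐ s ∂(μ.map Sg), s.PosDef ∧ κ s = M.innovLaw T s) ∧
      μ.map (fun w => (Sg w, innovations T Θ ε ω w)) = μ.map Sg ⊗ₘ κ := by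
  refine ⟨condDistrib (innovations T Θ ε ω) Sg μ, inferInstance, ?_,
    (compProd_map_condDistrib h.measurable_innovations.aemeasurable).symm⟩
  have hpd : ∀ᵐ s ∂(μ.map Sg), s.PosDef := h.law_Sg ▸ ae_posDef_MIW _ _ _
  filter_upwards [hpd, h.law_innovations] with s h1 h2 using ⟨h1, h2⟩

theorem Follows.posterior (h : M.Follows μ T Sg Θ y ε ω) (hM : M.IsAdmissible T)
    (hQ : ∀ t < T, IsUnit (M.QNext t).det) {t : ℕ} (ht : t ≤ T) :
    HasCondLaw (fun w => (Θ t w, Sg w)) (history y t)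
      (fun h => NMIW (M.m t h) (M.P t) (M.S t h) (M.N t) p) μ := by
  obtain ⟨κ, hκm, hκ, hj⟩ := h.exists_kernel_innovLaw
  have key := (M.hasCondLaw_NMIW hM hQ h.measurable_Sg h.measurable_innovations h.law_Sg hκ hj ht
    (M.measurable_resid t) (M.P_posSemidef hM hQ ht)
    (fun s hs => M.map_hist_resid hM hQ hs.posSemidef ht) (M.measurable_m t)).1
  simpa only [resid, add_sub_cancel, h.state_innovations ht, h.hist_innovations ht] using key

theorem Follows.prior (h : M.Follows μ T Sg Θ y ε ω) (hM : M.IsAdmissible T)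
    (hQ : ∀ t < T, IsUnit (M.QNext t).det) {t : ℕ} (ht : t < T) :
    HasCondLaw (fun w => (Θ (t + 1) w, Sg w)) (history y t)
      (fun h => NMIW (M.aNext t h) (M.RNext t) (M.S t h) (M.N t) p) μ := by
  obtain ⟨κ, hκm, hκ, hj⟩ := h.exists_kernel_innovLaw
  have key := (M.hasCondLaw_NMIW hM hQ h.measurable_Sg h.measurable_innovations h.law_Sg hκ hj
    ht.le (M.measurable_priorResid t) (M.RNext_posSemidef hM ht (M.P_posSemidef hM hQ ht.le))
    (fun s hs => M.map_hist_priorResid hM hQ hs.posSemidef ht) (M.measurable_aNext t)).1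
  simpa only [priorResid, add_sub_cancel, h.state_innovations ht, h.hist_innovations ht.le]
    using key

theorem Follows.forecast (h : M.Follows μ T Sg Θ y ε ω) (hM : M.IsAdmissible T)
    (hQ : ∀ t < T, IsUnit (M.QNext t).det) {t : ℕ} (ht : t < T) :
    HasCondLaw (fun w => (y (t + 1) w)ᵀ) (fun w => (Sg w, history y t w))
        (fun sh => matrixNormal (M.fNext t sh.2)ᵀ (M.QNext t) sh.1) μ ∧
      HasCondLaw (fun w => (y (t + 1) w)ᵀ) (history y t)
        (fun h => MT (M.fNext t h)ᵀ (M.QNext t) (M.S t h) (M.N t) p) μ := by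
  obtain ⟨κ, hκm, hκ, hj⟩ := h.exists_kernel_innovLaw
  have hQpd := M.QNext_posDef hM hQ ht (M.P_posSemidef hM hQ ht.le)
  have key := (M.hasCondLaw_NMIW hM hQ h.measurable_Sg h.measurable_innovations h.law_Sg hκ hj
    ht.le (M.measurable_obsResid t) hQpd.posSemidef
    (fun s hs => M.map_hist_obsResid hM hQ hs.posSemidef ht)
    (mm := fun h => (M.fNext t h)ᵀ) (M.measurable_fNext t).matrix_transpose).2
  simp only [obsResid, add_sub_cancel, h.obs_innovations ht, h.hist_innovations ht.le] at key
  exact ⟨key.2, key.1 hQpd⟩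

end MVDLM

end

theorem proposition4 {Ω : Type*} [MeasurableSpace Ω] (μ : Measure Ω) [IsProbabilityMeasure μ]
    {d p r : ℕ} (T : ℕ) (M : MVDLM d p r) (hM : M.IsAdmissible T)
    (hQ : ∀ t < T, IsUnit (M.QNext t).det)
    (Sg : Ω → Matrix (Fin p) (Fin p) ℝ) (Θ : ℕ → Ω → Matrix (Fin d) (Fin p) ℝ)
    (y ε : ℕ → Ω → Matrix (Fin p) (Fin r) ℝ) (ω : ℕ → Ω → Matrix (Fin d) (Fin p) ℝ)
    (hmodel : M.Follows μ T Sg Θ y ε ω) :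
    -- starting values of the recursions
    ((∀ h, M.m 0 h = M.m₀) ∧ M.P 0 = M.P₀ ∧ (∀ h, M.S 0 h = M.S₀) ∧ M.N 0 = M.N₀) ∧
    ∀ t < T,
      -- (a) posterior at time `t`
      HasCondLaw (fun w => (Θ t w, Sg w)) (history y t)
        (fun h => NMIW (M.m t h) (M.P t) (M.S t h) (M.N t) p) μ ∧
      -- (b) prior at time `t + 1`
      HasCondLaw (fun w => (Θ (t + 1) w, Sg w)) (history y t)
        (fun h => NMIW (M.aNext t h) (M.RNext t) (M.S t h) (M.N t) p) μ ∧
      -- (c) one-step forecast at time `t + 1`, conditional on `Sg` and marginal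
      HasCondLaw (fun w => (y (t + 1) w)ᵀ) (fun w => (Sg w, history y t w))
        (fun sh => matrixNormal (M.fNext t sh.2)ᵀ (M.QNext t) sh.1) μ ∧
      HasCondLaw (fun w => (y (t + 1) w)ᵀ) (history y t)
        (fun h => MT (M.fNext t h)ᵀ (M.QNext t) (M.S t h) (M.N t) p) μ ∧
      -- (d) posterior at time `t + 1`
      HasCondLaw (fun w => (Θ (t + 1) w, Sg w)) (history y (t + 1))
        (fun h => NMIW (M.m (t + 1) h) (M.P (t + 1)) (M.S (t + 1) h) (M.N (t + 1)) p) μ ∧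
      -- the parameters are legitimate ones
      (M.RNext t).PosSemidef ∧ (M.QNext t).PosDef ∧ (M.P (t + 1)).PosSemidef ∧
      (∀ h, (M.S (t + 1) h).PosDef) ∧ (M.N (t + 1)).IsDiag ∧ (∀ i, 0 < M.N (t + 1) i i) ∧
      -- the recursions
      M.RNext t = M.G (t + 1) * M.P t * (M.G (t + 1))ᵀ + M.W (t + 1) ∧
      M.QNext t = (M.F (t + 1))ᵀ * M.RNext t * M.F (t + 1) + M.V (t + 1) ∧
      M.ANext t = M.RNext t * M.F (t + 1) * (M.QNext t)⁻¹ ∧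
      M.P (t + 1) = M.RNext t - M.ANext t * M.QNext t * (M.ANext t)ᵀ ∧
      M.N (t + 1) = M.N t + (r : ℝ) • (1 : Matrix (Fin p) (Fin p) ℝ) ∧
      ∀ (h : Fin t → Matrix (Fin p) (Fin r) ℝ) (Y : Matrix (Fin p) (Fin r) ℝ),
        M.aNext t h = M.G (t + 1) * M.m t h ∧
        (M.fNext t h)ᵀ = (M.F (t + 1))ᵀ * M.aNext t h ∧
        M.m (t + 1) (Fin.snoc h Y) = M.aNext t h + M.ANext t * (Y - M.fNext t h)ᵀ ∧
        sqrtDiag (M.N (t + 1)) * M.S (t + 1) (Fin.snoc h Y) * sqrtDiag (M.N (t + 1)) =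
          sqrtDiag (M.N t) * M.S t h * sqrtDiag (M.N t) +
            (Y - M.fNext t h) * (M.QNext t)⁻¹ * (Y - M.fNext t h)ᵀ := by
  refine ⟨⟨fun _ => rfl, rfl, fun _ => rfl, rfl⟩, fun t ht => ?_⟩
  have hP := M.P_posSemidef hM hQ ht.le
  obtain ⟨hc, hc'⟩ := hmodel.forecast hM hQ ht
  -- The posterior is available for all times up to and including `T`, so (d) is (a) one step later,
  -- with `t < T` read as `t + 1 ≤ T`.
  refine ⟨hmodel.posterior hM hQ ht.le, hmodel.prior hM hQ ht, hc, hc', hmodel.posterior hM hQ ht,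
    M.RNext_posSemidef hM ht hP, M.QNext_posDef hM hQ ht hP, M.P_posSemidef hM hQ ht,
    M.S_posDef hM hQ ht, M.N_isDiag hM (t + 1), M.N_pos hM (t + 1), rfl, rfl, rfl, rfl, rfl,
    fun h Y => ⟨rfl, ?_, M.m_succ_snoc t h Y, ?_⟩⟩
  · rw [MVDLM.fNext, Matrix.transpose_transpose]
  · exact M.scale_succ_snoc hM t h Y
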